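/- Let $0<\delta\le 1$ and $q=2+\delta$. For each $n$ let $X_1,\dots,X_n$ be i.i.d. random vectors in $\mathbb{R}^{p}$ with mean $\mu$, finite second moments and covariance matrix $\Sigma\neq 0$; the dimension $p=p_n$ and the common law may depend on $n$ arbitrarily. Let $|\cdot|$ be the Euclidean norm, $f_1=\mathrm{tr}(\Sigma)$, $f=[\mathrm{tr}(\Sigma^2)]^{1/2}$, and, for $0\le\delta'\le 1$ and independent copies $X,X'$ of $X_1$, $$K_{\delta'}^{2+\delta'}=\mathbb{E}\left|\frac{|X-\mu|^2-f_1}{f}\right|^{2+\delta'},\qquad D_{\delta'}^{2+\delta'}=\mathbb{E}\left|\frac{(X-\mu)^T(X'-\mu)}{f}\right|^{2+\delta'}.$$ With $\xi\sim N(0,1)$ and $\|\zeta\|_r=(\mathbb{E}|\zeta|^r)^{1/r}$ put $c_{\delta'}=(1+\delta')^{1/2}\|\xi^2-1\|_{2+\delta'}$, $d_{\delta'}=(1+\delta')^{1/2}\|\xi\|_{2+\delta'}^2$, $\tilde K_{\delta'}=K_{\delta'}+c_{\delta'}$, $\tilde D_{\delta'}=D_{\delta'}+d_{\delta'}$. Assume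 that $K_\delta<\infty$ and $D_\delta<\infty$ for every $n$, and let $m=m_n\in\mathbb{N}$ satisfy $m\to\infty$, $m=o(n)$ and $$\frac{\tilde K_0^2}{m}+\frac{\tilde K_\delta^q}{m^{q-1}}+\frac{\mathbb{E}\big[((X-\mu)^T\Sigma (X-\mu))^{q/2}\big]}{m^{\delta/2}f^q}+\frac{\tilde D_\delta^q}{m^\delta}\to 0\qquad (n\to\infty).$$ For $B\subset\{1,\dots,n\}$ let $\bar X_B=|B|^{-1}\sum_{b\in B}X_b$, where $|B|$ is the cardinality of $B$, and let $\bar X=n^{-1}\sum_{i=1}^nX_i$. Then the following hold. (i) Let $L=\lfloor n/m\rfloor$, $B_j=\{l:(j-1)m<l\le jm\}$ for $1\le j\le L$, and $$\hat F(t)=\frac1L\sum_{j=1}^L\mathbf 1\{m|\bar X_{B_j}-\bar X|^2\le t(1-m/n)\}.$$ Then $\sup_{t\in\mathbb{R}}|\hat F(t)-\mathbb{P}(n|\bar X-\mu|^2\le t)|\to0$ in probability as $n\to\infty$. (ii) Let $J=J_n\to\infty$, let $A_1,\dots,A_J$ be i.i.d. uniformly distributed on the subsets of $\{1,\dots,n\}$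 of cardinality $m$ (for all $n$ large enough that $m\le n$), with the family $(A_j)$ independent of $(X_i)$, and let $$\check F(t)=\frac1J\sum_{j=1}^J\mathbf 1\{m|\bar X_{A_j}-\bar X|^2\le t(1-m/n)\}.$$ Then $\sup_{t\in\mathbb{R}}|\check F(t)-\mathbb{P}(n|\bar X-\mu|^2\le t)|\to0$ in probability as $n\to\infty$. -/

import Mathlib

open MeasureTheory ProbabilityTheory Filter Topology Asymptotics

noncomputable section

namespace HighDimMean

/-! ### Functionals of the law of a random vector in `ℝ^p` -/

section Law

variable {p : ℕ}

/-- The mean `μ = E X` of a random vector `X` with law `ν`. -/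
def mean (ν : Measure (EuclideanSpace ℝ (Fin p))) : EuclideanSpace ℝ (Fin p) :=
  ∫ x, x ∂ν

/-- The covariance matrix `Σ = cov(X)` of a random vector `X` with law `ν`. -/
def covMat (ν : Measure (EuclideanSpace ℝ (Fin p))) : Matrix (Fin p) (Fin p) ℝ :=
  Matrix.of fun j k => covariance (fun x => x j) (fun x => x k) ν

/-- `f_k = [tr(Σ^k)]^{1/k}`. The case `k = 2` is the Frobenius norm of `Σ`, written `f`. -/
def fNorm (ν : Measure (EuclideanSpace ℝ (Fin p))) (k : ℕ) : ℝ :=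
  ((covMat ν ^ k).trace) ^ (1 / (k : ℝ))

/-- `((X - μ)ᵀ (X - μ) - f_1) / f`, as a function of the value `x` of `X`. -/
def diagTerm (ν : Measure (EuclideanSpace ℝ (Fin p))) (x : EuclideanSpace ℝ (Fin p)) : ℝ :=
  (‖x - mean ν‖ ^ 2 - fNorm ν 1) / fNorm ν 2

/-- `(X_1 - μ)ᵀ (X_2 - μ) / f`, as a function of the value `z` of the pair `(X_1, X_2)`. -/
def crossTerm (ν : Measure (EuclideanSpace ℝ (Fin p)))
    (z : EuclideanSpace ℝ (Fin p) × EuclideanSpace ℝ (Fin p)) : ℝ :=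
  inner ℝ (z.1 - mean ν) (z.2 - mean ν) / fNorm ν 2

/-- `K_δ`, where `K_δ^{2+δ} = E |((X - μ)ᵀ (X - μ) - f_1) / f|^{2+δ}`. -/
def K (ν : Measure (EuclideanSpace ℝ (Fin p))) (δ : ℝ) : ℝ :=
  (∫ x, |diagTerm ν x| ^ (2 + δ) ∂ν) ^ (1 / (2 + δ))

/-- `D_δ`, where `D_δ^{2+δ} = E |(X_1 - μ)ᵀ (X_2 - μ) / f|^{2+δ}`,
with `X_1, X_2` independent of law `ν`. -/
def D (ν : Measure (EuclideanSpace ℝ (Fin p))) (δ : ℝ) : ℝ :=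
  (∫ z, |crossTerm ν z| ^ (2 + δ) ∂(ν.prod ν)) ^ (1 / (2 + δ))

/-- The quadratic form `(x - μ)ᵀ Σ (x - μ)`. -/
def quadForm (ν : Measure (EuclideanSpace ℝ (Fin p))) (x : EuclideanSpace ℝ (Fin p)) : ℝ :=
  ∑ j, ∑ k, (x j - mean ν j) * covMat ν j k * (x k - mean ν k)

/-- `c_δ = (1+δ)^{1/2} ‖ξ² - 1‖_{2+δ}` with `ξ` standard normal. -/
def c (δ : ℝ) : ℝ :=
  (1 + δ) ^ (1 / 2 : ℝ) *
    (∫ u, |u ^ 2 - 1| ^ (2 + δ) ∂(gaussianReal 0 1)) ^ (1 / (2 + δ))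

/-- `d_δ = (1+δ)^{1/2} ‖ξ‖²_{2+δ}` with `ξ` standard normal. -/
def d (δ : ℝ) : ℝ :=
  (1 + δ) ^ (1 / 2 : ℝ) *
    ((∫ u, |u| ^ (2 + δ) ∂(gaussianReal 0 1)) ^ (1 / (2 + δ))) ^ 2

/-- With `q = 2 + δ`, `K̃_δ = K_δ + c_δ`, `D̃_δ = D_δ + d_δ`, the quantity
`K̃_0² / s + K̃_δ^q / s^{q-1} + E((X-μ)ᵀ Σ (X-μ))^{q/2} / (s^{δ/2} f^q) + D̃_δ^q / s^δ`
for the sample size `s`. -/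
def momentBound (ν : Measure (EuclideanSpace ℝ (Fin p))) (δ s : ℝ) : ℝ :=
  (K ν 0 + c 0) ^ 2 / s
    + (K ν δ + c δ) ^ (2 + δ) / s ^ (1 + δ)
    + (∫ x, (quadForm ν x) ^ ((2 + δ) / 2) ∂ν) / (s ^ (δ / 2) * fNorm ν 2 ^ (2 + δ))
    + (D ν δ + d δ) ^ (2 + δ) / s ^ δ

end Law

/-! ### Sample means and the subsampling distribution functions -/

section Sample

variable {n : ℕ} {E : Type*} [NormedAddCommGroup E] [NormedSpace ℝ E]

/-- `X̄_B = (∑_{b ∈ B} X_b) / |B|`. -/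
def subMean (x : Fin n → E) (B : Finset (Fin n)) : E :=
  (B.card : ℝ)⁻¹ • ∑ b ∈ B, x b

/-- `X̄ = (∑_{i ≤ n} X_i) / n`. -/
def sampleMean (x : Fin n → E) : E := subMean x Finset.univ

/-- The `j`-th block of length `m`, with zero-based indices: `{l : j m ≤ l < (j+1) m}`. -/
def block (n m j : ℕ) : Finset (Fin n) :=
  Finset.univ.filter fun l : Fin n => j * m ≤ (l : ℕ) ∧ (l : ℕ) < (j + 1) * m

open Classical in
/-- `N⁻¹ ∑_{j < N} 1{ m |X̄_{B_j} - X̄|² ≤ t (1 - m/n) }` for index sets `B_j`, `j < N`. -/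
def empDF (m N : ℕ) (B : Fin N → Finset (Fin n)) (x : Fin n → E) (t : ℝ) : ℝ :=
  (N : ℝ)⁻¹ * ∑ j : Fin N,
    if (m : ℝ) * ‖subMean x (B j) - sampleMean x‖ ^ 2 ≤ t * (1 - (m : ℝ) / (n : ℝ))
      then 1 else 0

/-- `F̂`: the empirical distribution function over the `L = ⌊n/m⌋` consecutive blocks. -/
def blockDF (m : ℕ) (x : Fin n → E) (t : ℝ) : ℝ :=
  empDF m (n / m) (fun j => block n m j) x t

end Sample

/-- The distribution function `F(t) = P(n |X̄ - μ|² ≤ t)`. -/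
def targetDF {n p : ℕ} {Ω : Type*} [MeasurableSpace Ω] (P : Measure Ω)
    (X : Fin n → Ω → EuclideanSpace ℝ (Fin p)) (μ : EuclideanSpace ℝ (Fin p)) (t : ℝ) : ℝ :=
  P.real {ω | (n : ℝ) * ‖sampleMean (fun i => X i ω) - μ‖ ^ 2 ≤ t}

/-- `A_1, …, A_J` are i.i.d. uniformly distributed on the `m`-element subsets of the index set,
and the family `(A_j)` is independent of the family `(X_i)`. -/
structure IsUniformSubsampling {n p J : ℕ} {Ω : Type*} [MeasurableSpace Ω] (P : Measure Ω)
    (X : Fin n → Ω → EuclideanSpace ℝ (Fin p)) (m : ℕ)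
    (A : Fin J → Ω → Finset (Fin n)) : Prop where
  uniform : ∀ j, HasLaw (A j) (uniformOn {S : Finset (Fin n) | S.card = m}) P
  indep : iIndepFun A P
  indep_data : IndepFun (fun ω j => A j ω) (fun ω i => X i ω) P

/-- `Z_n → 0` in probability, where `Z_n` lives on its own probability space for each `n`. -/
def TendstoZeroInProb {Ω : ℕ → Type*} [∀ n, MeasurableSpace (Ω n)] (P : ∀ n, Measure (Ω n))
    (Z : ∀ n, Ω n → ℝ) : Prop :=
  ∀ ε : ℝ, 0 < ε → Tendsto (fun n => P n {ω | ε ≤ |Z n ω|}) atTop (𝓝 0)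

end HighDimMean

end

noncomputable section

namespace HighDimMean

/-! ### Elementary inequalities -/

/-! Centre the data and scale by `f^{-1/2}`, so that `tr Σ² = 1`; write `a` for the trace of the new
covariance. The normalised statistic of `s` summands is `|S|²/s - a`. It need not be asymptotically
normal or have any limit as the dimension varies, but it is close in law to `|Z|² - a` with `Z`
Gaussian of the same covariance, and this law does not depend on `s`. Hence the statistics for
sample sizes `m` and `n` are close to the same law, and that is why subsampling works.

The comparison with the Gaussian law is Lindeberg's replacement argument on smooth test functions
(`swap_bound`, `lindeberg`). Adding `y` to a sum `w` changes the statistic by a multiple of `2⟨w,y⟩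
+ |y|² - a`. This is centred given `w`, and its main second order part `4⟨w,y⟩²` has a conditional
mean that depends only on the covariance. The mixed terms and the remainder of order `2 + δ` are
controlled by the moment hypotheses, with Rosenthal's inequality for the moments of `⟨w,y⟩`. To pass
to distribution functions, `|Z|²` must not concentrate: this is a weighted chi-square variable with
squared weights summing to one, and its characteristic function is at most `(1 + 4s²)^{-1/4}`
whatever the weights are (`stdPi_quadratic_Icc_le`). The outcome, `exists_kolmogorov_bound`, is
uniform in the dimension and the law.

For disjoint blocks, centring at the sample mean perturbs each block statistic by `O(m/n)` in mean
square (`integral_hatStat_sub_sq_le`), while the uncentred block statistics are independent, so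
their empirical distribution function has variance at most `1/L`. For random subsets, the average
over all subsets of size `m` is the average of block versions over all permutations of the indices,
hence no farther from the Gaussian distribution function in `L¹`; sampling `J` subsets adds a
conditional variance of at most `1/J` (`integral_jointLaw_le`). Pointwise closeness becomes uniform
on a finite grid whose size depends only on `δ` and the tolerance (`exists_measure_sup_le`). -/

/-- Up to the factor `2 + δ`, the map `x ↦ |x|^δ x` is the derivative of `|x|^(2+δ)`; this estimate
of its increments feeds the mean value argument below. It rests on `r^δ ≤ r` for `r = |z|/|x| ≥ 1`.
-/
lemma abs_abs_rpow_mul_sub_le {δ : ℝ} (h0 : 0 < δ) (h1 : δ ≤ 1) (x z : ℝ) :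
    |(|z| ^ δ * z) - |x| ^ δ * x| ≤ |z - x| * (|x| ^ δ + |z| ^ δ) := by
  wlog hxz : |x| ≤ |z| generalizing x z with H
  · have := H z x (le_of_not_ge hxz)
    rw [abs_sub_comm, abs_sub_comm z x, add_comm]
    exact this
  have key : |x| * (|z| ^ δ - |x| ^ δ) ≤ |x| ^ δ * (|z| - |x|) := by
    rcases eq_or_lt_of_le (abs_nonneg x) with hx | hx
    · rw [← hx]; simp [Real.zero_rpow h0.ne']
    · have h2 : (|z| / |x|) ^ δ ≤ |z| / |x| := by
        calc (|z| / |x|) ^ δ ≤ (|z| / |x|) ^ (1 : ℝ) :=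
              Real.rpow_le_rpow_of_exponent_le ((one_le_div hx).2 hxz) h1
          _ = _ := Real.rpow_one _
      rw [Real.div_rpow (abs_nonneg _) (abs_nonneg _),
        div_le_div_iff₀ (Real.rpow_pos_of_pos hx _) hx] at h2
      nlinarith
  have h3 : |x| ^ δ ≤ |z| ^ δ := Real.rpow_le_rpow (abs_nonneg _) hxz h0.le
  have h4 : 0 ≤ |x| ^ δ := by positivity
  have h5 : |z| - |x| ≤ |z - x| := abs_sub_abs_le_abs_sub z x
  calc |(|z| ^ δ * z) - |x| ^ δ * x|
      = |(|z| ^ δ * (z - x)) + x * (|z| ^ δ - |x| ^ δ)| := by congr 1; ring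
    _ ≤ |(|z| ^ δ * (z - x))| + |x * (|z| ^ δ - |x| ^ δ)| := abs_add_le _ _
    _ = |z| ^ δ * |z - x| + |x| * (|z| ^ δ - |x| ^ δ) := by
        rw [abs_mul, abs_mul, abs_of_nonneg (by positivity : 0 ≤ |z| ^ δ),
          abs_of_nonneg (sub_nonneg.2 h3)]
    _ ≤ |z| ^ δ * |z - x| + |x| ^ δ * |z - x| := by nlinarith
    _ = _ := by ring

lemma abs_mul_rpow_two_add {δ : ℝ} (h0 : 0 < δ) (y : ℝ) :
    y ^ 2 * |y| ^ δ = |y| ^ (2 + δ) := by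
  rcases eq_or_ne y 0 with rfl | hy
  · simp [Real.zero_rpow (by linarith : (2 : ℝ) + δ ≠ 0)]
  · rw [Real.rpow_add (abs_pos.2 hy), ← sq_abs]; norm_num

/-- The linear term is kept exactly because it integrates to zero when `y` is centred and
independent of `x`; the coefficient `1` of `|x|^(2+δ)` then lets the bound be iterated without
growing constants. The proof is the mean value theorem along `t ↦ x + t y`. -/
lemma abs_add_rpow_le {δ : ℝ} (h0 : 0 < δ) (h1 : δ ≤ 1) (x y : ℝ) :
    |x + y| ^ (2 + δ) ≤ |x| ^ (2 + δ) + (2 + δ) * (|x| ^ δ * x * y)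
      + 6 * (|x| ^ δ * y ^ 2 + |y| ^ (2 + δ)) := by
  rcases eq_or_ne y 0 with rfl | hy
  · simp [Real.zero_rpow (by linarith : (2 : ℝ) + δ ≠ 0)]
  obtain ⟨t, ht, htd⟩ : ∃ t ∈ Set.Ioo (0 : ℝ) 1,
      (2 + δ) * |x + t * y| ^ δ * (x + t * y) * y =
        (|x + 1 * y| ^ (2 + δ) - |x + 0 * y| ^ (2 + δ)) / (1 - 0) := by
    have hd : ∀ t : ℝ, HasDerivAt (fun t : ℝ => |x + t * y| ^ (2 + δ))
        ((2 + δ) * |x + t * y| ^ δ * (x + t * y) * y) t := by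
      intro t
      have ha := hasDerivAt_abs_rpow (x + t * y) (p := 2 + δ) (by linarith)
      have hb : HasDerivAt (fun t : ℝ => x + t * y) y t := by
        simpa using ((hasDerivAt_id t).mul_const y).const_add x
      have := ha.comp t hb
      simpa [Function.comp_def] using this
    exact exists_hasDerivAt_eq_slope (fun t : ℝ => |x + t * y| ^ (2 + δ)) _ one_pos
      (fun t _ => (hd t).continuousAt.continuousWithinAt) (fun t _ => hd t)
  set z := x + t * y with hz
  have hzx : |z - x| ≤ |y| := by
    rw [hz, add_sub_cancel_left, abs_mul, abs_of_pos ht.1]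
    nlinarith [abs_nonneg y, ht.2]
  have hzδ : |z| ^ δ ≤ |x| ^ δ + |y| ^ δ := by
    calc |z| ^ δ ≤ (|x| + |y|) ^ δ := by
          apply Real.rpow_le_rpow (abs_nonneg _) _ h0.le
          calc |z| = |x + (z - x)| := by ring_nf
            _ ≤ |x| + |z - x| := abs_add_le _ _
            _ ≤ _ := by linarith
      _ ≤ _ := Real.rpow_add_le_add_rpow (abs_nonneg _) (abs_nonneg _) h0.le h1
  have h2 := abs_abs_rpow_mul_sub_le h0 h1 x z
  have e : |x + y| ^ (2 + δ) - |x| ^ (2 + δ) - (2 + δ) * (|x| ^ δ * x * y)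
      = (2 + δ) * ((|z| ^ δ * z - |x| ^ δ * x) * y) := by
    simp only [one_mul, zero_mul, add_zero, sub_zero, div_one] at htd
    linear_combination -htd
  have h6 : (|z| ^ δ * z - |x| ^ δ * x) * y ≤ 2 * (|x| ^ δ * y ^ 2) + |y| ^ (2 + δ) := by
    calc (|z| ^ δ * z - |x| ^ δ * x) * y
        ≤ |(|z| ^ δ * z - |x| ^ δ * x)| * |y| := by rw [← abs_mul]; exact le_abs_self _
      _ ≤ (|z - x| * (|x| ^ δ + |z| ^ δ)) * |y| := by gcongr
      _ ≤ (|y| * (|x| ^ δ + (|x| ^ δ + |y| ^ δ))) * |y| := by gcongr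
      _ = 2 * (|x| ^ δ * |y| ^ 2) + |y| ^ 2 * |y| ^ δ := by ring
      _ = _ := by rw [sq_abs, abs_mul_rpow_two_add h0]
  have h7 : (0 : ℝ) ≤ |x| ^ δ * y ^ 2 := by positivity
  have h8 : (0 : ℝ) ≤ |y| ^ (2 + δ) := by positivity
  nlinarith

lemma add_rpow_le_mul_add_rpow {δ : ℝ} (h0 : 0 < δ) (h1 : δ ≤ 1) {a b : ℝ} (ha : 0 ≤ a)
    (hb : 0 ≤ b) : (a + b) ^ (2 + δ) ≤ 4 * (a ^ (2 + δ) + b ^ (2 + δ)) := by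
  have h := (convexOn_rpow (by linarith : (1 : ℝ) ≤ 2 + δ)).2 (Set.mem_Ici.2 ha)
    (Set.mem_Ici.2 hb) (by norm_num : (0 : ℝ) ≤ 1 / 2) (by norm_num : (0 : ℝ) ≤ 1 / 2)
    (by norm_num)
  simp only [smul_eq_mul] at h
  rw [show (1 / 2 : ℝ) * a + 1 / 2 * b = (1 / 2) * (a + b) by ring,
    Real.mul_rpow (by norm_num) (by positivity)] at h
  have h2 : (1 / 8 : ℝ) ≤ (1 / 2 : ℝ) ^ (2 + δ) := by
    calc (1 / 8 : ℝ) = (1 / 2 : ℝ) ^ (3 : ℝ) := by norm_num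
      _ ≤ _ := Real.rpow_le_rpow_of_exponent_ge (by norm_num) (by norm_num) (by linarith)
  have h3 : 0 ≤ (a + b) ^ (2 + δ) := by positivity
  nlinarith

lemma sq_le_one_add_abs_rpow {δ : ℝ} (h0 : 0 < δ) (x : ℝ) : x ^ 2 ≤ 1 + |x| ^ (2 + δ) := by
  rcases le_total |x| 1 with h | h
  · have : (0 : ℝ) ≤ |x| ^ (2 + δ) := by positivity
    nlinarith [sq_abs x, abs_nonneg x]
  · have : |x| ^ (2 : ℝ) ≤ |x| ^ (2 + δ) :=
      Real.rpow_le_rpow_of_exponent_le h (by linarith)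
    rw [Real.rpow_two, sq_abs] at this
    linarith

/-! ### A smooth step function with a second order expansion -/

/-- `h1`, `h2` are the coefficients of a second order expansion of `h` with remainder of
order `2 + δ`; everything is bounded by `M`. -/
structure SecondOrder (δ M : ℝ) (h h1 h2 : ℝ → ℝ) : Prop where
  cont : Continuous h
  cont1 : Continuous h1
  cont2 : Continuous h2
  bound : ∀ x, |h x| ≤ 1
  bound1 : ∀ x, |h1 x| ≤ M
  bound2 : ∀ x, |h2 x| ≤ M
  taylor : ∀ x y, |h (x + y) - h x - h1 x * y - h2 x * y ^ 2 / 2| ≤ M * |y| ^ (2 + δ)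

lemma exists_bound_of_eq_zero_outside {g : ℝ → ℝ} (hg : Continuous g)
    (h0 : ∀ x, x < 0 → g x = 0) (h1 : ∀ x, 1 < x → g x = 0) : ∃ M, 0 ≤ M ∧ ∀ x, |g x| ≤ M := by
  obtain ⟨M, hM⟩ := (isCompact_Icc (a := (0 : ℝ)) (b := 1)).exists_bound_of_continuousOn
    hg.continuousOn
  refine ⟨max M 0, le_max_right _ _, fun x => ?_⟩
  rcases lt_or_ge x 0 with hx | hx
  · simp [h0 x hx]
  rcases lt_or_ge 1 x with hx' | hx'
  · simp [h1 x hx']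
  · exact (hM x ⟨hx, hx'⟩).trans (le_max_left _ _)

lemma deriv_eq_zero_of_eventually_const {g : ℝ → ℝ} {U : Set ℝ} (hU : IsOpen U) {c : ℝ}
    (h : ∀ x ∈ U, g x = c) : ∀ x ∈ U, deriv g x = 0 := by
  intro x hx
  have : g =ᶠ[𝓝 x] fun _ => c := by
    filter_upwards [hU.mem_nhds hx] with y hy using h y hy
  rw [this.deriv_eq]; simp

lemma exists_smooth_step {δ : ℝ} (hδ0 : 0 < δ) (hδ1 : δ ≤ 1) : ∃ (M : ℝ) (h h1 h2 : ℝ → ℝ),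
    SecondOrder δ M h h1 h2 ∧ (∀ x, 0 ≤ h x) ∧ (∀ x ≤ 0, h x = 1) ∧ (∀ x, 1 ≤ x → h x = 0) := by
  let h : ℝ → ℝ := fun x => Real.smoothTransition (1 - x)
  have hc : ContDiff ℝ 3 h :=
    (Real.smoothTransition.contDiff (n := 3)).comp (contDiff_const.sub contDiff_id)
  have hneg : ∀ x ≤ 0, h x = 1 := fun x hx => Real.smoothTransition.one_of_one_le (by linarith)
  have hpos : ∀ x, 1 ≤ x → h x = 0 := fun x hx =>
    Real.smoothTransition.zero_of_nonpos (by linarith)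
  have c1 : ContDiff ℝ 2 (deriv h) := by
    have := (contDiff_succ_iff_deriv (n := 2) (f := h)).1 (by exact_mod_cast hc)
    exact this.2.2
  have c2 : ContDiff ℝ 1 (deriv (deriv h)) := by
    have := (contDiff_succ_iff_deriv (n := 1) (f := deriv h)).1 (by exact_mod_cast c1)
    exact this.2.2
  have c3 : Continuous (deriv (deriv (deriv h))) := c2.continuous_deriv le_rfl
  have zn1 := deriv_eq_zero_of_eventually_const (g := h) isOpen_Iio (c := 1)
    (fun x (hx : x < 0) => hneg x hx.le)
  have zp1 := deriv_eq_zero_of_eventually_const (g := h) isOpen_Ioi (c := 0)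
    (fun x (hx : 1 < x) => hpos x hx.le)
  have zn2 := deriv_eq_zero_of_eventually_const isOpen_Iio zn1
  have zp2 := deriv_eq_zero_of_eventually_const isOpen_Ioi zp1
  have zn3 := deriv_eq_zero_of_eventually_const isOpen_Iio zn2
  have zp3 := deriv_eq_zero_of_eventually_const isOpen_Ioi zp2
  obtain ⟨M1, hM1, b1⟩ := exists_bound_of_eq_zero_outside c1.continuous zn1 zp1
  obtain ⟨M2, hM2, b2⟩ := exists_bound_of_eq_zero_outside c2.continuous zn2 zp2
  obtain ⟨M3, hM3, b3⟩ := exists_bound_of_eq_zero_outside c3 zn3 zp3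
  have d0 : ∀ x, HasDerivAt h (deriv h x) x := fun x =>
    (hc.differentiable (by norm_num) x).hasDerivAt
  have d1 : ∀ x, HasDerivAt (deriv h) (deriv (deriv h) x) x := fun x =>
    (c1.differentiable (by norm_num) x).hasDerivAt
  have d2 : ∀ x, HasDerivAt (deriv (deriv h)) (deriv (deriv (deriv h)) x) x := fun x =>
    (c2.differentiable (by norm_num) x).hasDerivAt
  -- The second derivative is `δ`-Hölder: for small increments it is Lipschitz with constant `M3`,
  -- for large ones it is bounded by `M2`. Integrating this twice gives the remainder of order `2 +
  -- δ`.
  set A := 2 * M2 + M3 with hA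
  have hol : ∀ x t, |deriv (deriv h) (x + t) - deriv (deriv h) x| ≤ A * |t| ^ δ := by
    intro x t
    have hp : 0 ≤ |t| ^ δ := by positivity
    rcases le_total |t| 1 with ht | ht
    · have := Convex.norm_image_sub_le_of_norm_hasDerivWithin_le (f := deriv (deriv h))
        (f' := deriv (deriv (deriv h))) (C := M3) (s := Set.univ) (x := x) (y := x + t)
        (fun y _ => (d2 y).hasDerivWithinAt) (fun y _ => b3 y) convex_univ trivial trivial
      simp only [Real.norm_eq_abs, add_sub_cancel_left] at this
      have h3 : |t| ≤ |t| ^ δ := by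
        rcases eq_or_lt_of_le (abs_nonneg t) with h | h
        · rw [← h]; simp [Real.zero_rpow hδ0.ne']
        · calc |t| = |t| ^ (1 : ℝ) := (Real.rpow_one _).symm
            _ ≤ _ := Real.rpow_le_rpow_of_exponent_ge h ht hδ1
      nlinarith
    · have h3 : 1 ≤ |t| ^ δ := Real.one_le_rpow ht hδ0.le
      have := abs_sub (deriv (deriv h) (x + t)) (deriv (deriv h) x)
      have := b2 (x + t)
      have := b2 x
      nlinarith
  have dx : ∀ x t, HasDerivAt (fun t : ℝ => x + t) 1 t := fun x t => by
    simpa using (hasDerivAt_id t).const_add x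
  have e1 : ∀ x t, |deriv h (x + t) - deriv h x - deriv (deriv h) x * t|
      ≤ A * |t| ^ δ * |t| := by
    intro x t
    have := Convex.norm_image_sub_le_of_norm_hasDerivWithin_le
        (f := fun t => deriv h (x + t) - deriv (deriv h) x * t)
        (f' := fun t => deriv (deriv h) (x + t) - deriv (deriv h) x) (C := A * |t| ^ δ)
        (s := Set.uIcc 0 t) (x := 0) (y := t)
        (fun y _ => HasDerivAt.hasDerivWithinAt (by
          have := ((d1 (x + y)).comp y (dx x y)).sub ((hasDerivAt_id y).const_mul (deriv (deriv h) x))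
          exact this.congr_deriv (by simp)))
        (fun y hy => by
          refine (hol x y).trans ?_
          have : |y| ≤ |t| := by simpa using Set.abs_sub_left_of_mem_uIcc hy
          have hA0 : 0 ≤ A := by positivity
          gcongr) (convex_uIcc 0 t) (by simp) (by simp)
    simp only [Real.norm_eq_abs, add_zero, mul_zero, sub_zero] at this
    convert this using 2
    ring
  have e0 : ∀ x y, |h (x + y) - h x - deriv h x * y - deriv (deriv h) x * y ^ 2 / 2|
      ≤ A * |y| ^ (2 + δ) := by
    intro x t
    have := Convex.norm_image_sub_le_of_norm_hasDerivWithin_le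
        (f := fun t => h (x + t) - deriv h x * t - deriv (deriv h) x / 2 * t ^ 2)
        (f' := fun t => deriv h (x + t) - deriv h x - deriv (deriv h) x * t)
        (C := A * |t| ^ δ * |t|)
        (s := Set.uIcc 0 t) (x := 0) (y := t)
        (fun y _ => HasDerivAt.hasDerivWithinAt (by
          have := (((d0 (x + y)).comp y (dx x y)).sub
            ((hasDerivAt_id y).const_mul (deriv h x))).sub
            ((hasDerivAt_pow 2 y).const_mul (deriv (deriv h) x / 2))
          exact this.congr_deriv (by simp; ring)))
        (fun y hy => by
          refine (e1 x y).trans ?_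
          have : |y| ≤ |t| := by simpa using Set.abs_sub_left_of_mem_uIcc hy
          have hA0 : 0 ≤ A := by positivity
          gcongr) (convex_uIcc 0 t) (by simp) (by simp)
    simp only [Real.norm_eq_abs, add_zero, mul_zero, sub_zero] at this
    rw [← abs_mul_rpow_two_add hδ0, ← sq_abs t]
    calc _ = _ := by congr 1; simp; ring
      _ ≤ _ := this
      _ = _ := by ring
  refine ⟨max A M1, h, deriv h, deriv (deriv h), ⟨hc.continuous, c1.continuous, c2.continuous,
    fun x => ?_, fun x => (b1 x).trans (le_max_right _ _), fun x => (b2 x).trans ?_,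
    fun x y => (e0 x y).trans ?_⟩,
    fun x => Real.smoothTransition.nonneg _, hneg, hpos⟩
  · rw [abs_of_nonneg (Real.smoothTransition.nonneg _)]; exact Real.smoothTransition.le_one _
  · exact le_trans (by linarith) (le_max_left A M1)
  · gcongr; exact le_max_left _ _

/-- Smooth upper bounds for the indicator of a half line, on the scale `ε`. -/
lemma exists_smooth_indicator {δ : ℝ} (hδ0 : 0 < δ) (hδ1 : δ ≤ 1) {ε : ℝ} (hε : 0 < ε) :
    ∃ M : ℝ, 0 ≤ M ∧ ∀ u : ℝ, ∃ h h1 h2 : ℝ → ℝ, SecondOrder δ M h h1 h2 ∧ (∀ x, 0 ≤ h x) ∧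
      (∀ x ≤ u, h x = 1) ∧ (∀ x, u + ε ≤ x → h x = 0) := by
  obtain ⟨M, h, h1, h2, H, hn, hl, hr⟩ := exists_smooth_step hδ0 hδ1
  have hM : 0 ≤ M := (abs_nonneg _).trans (H.bound1 0)
  -- One constant dominates the three rescaled bounds. It depends on `ε` but not on the threshold
  -- `u`, which makes the later estimates uniform in `u`.
  refine ⟨M * ε⁻¹ + M * (ε⁻¹) ^ 2 + M * (ε⁻¹) ^ (2 + δ), by positivity, fun u =>
    ⟨fun x => h ((x - u) * ε⁻¹), fun x => h1 ((x - u) * ε⁻¹) * ε⁻¹,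
      fun x => h2 ((x - u) * ε⁻¹) * (ε⁻¹) ^ 2, ⟨?_, ?_, ?_, ?_, ?_, ?_, ?_⟩, ?_, ?_, ?_⟩⟩
  · exact H.cont.comp (by fun_prop)
  · exact (H.cont1.comp (by fun_prop)).mul continuous_const
  · exact (H.cont2.comp (by fun_prop)).mul continuous_const
  · exact fun x => H.bound _
  · intro x
    rw [abs_mul, abs_of_pos (inv_pos.2 hε)]
    have := mul_le_mul_of_nonneg_right (H.bound1 ((x - u) * ε⁻¹)) (inv_pos.2 hε).le
    have : 0 ≤ M * (ε⁻¹) ^ 2 + M * (ε⁻¹) ^ (2 + δ) := by positivity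
    linarith
  · intro x
    rw [abs_mul, abs_of_pos (pow_pos (inv_pos.2 hε) 2)]
    have := mul_le_mul_of_nonneg_right (H.bound2 ((x - u) * ε⁻¹)) (pow_pos (inv_pos.2 hε) 2).le
    have : 0 ≤ M * (ε⁻¹) + M * (ε⁻¹) ^ (2 + δ) := by positivity
    linarith
  · intro x y
    have := H.taylor ((x - u) * ε⁻¹) (y * ε⁻¹)
    rw [abs_mul, Real.mul_rpow (abs_nonneg _) (abs_nonneg _), abs_of_pos (inv_pos.2 hε)] at this
    calc _ = _ := by
          rw [show (x + y - u) * ε⁻¹ = (x - u) * ε⁻¹ + y * ε⁻¹ by ring]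
          congr 1
          ring
      _ ≤ _ := this
      _ = (M * ε⁻¹ ^ (2 + δ)) * |y| ^ (2 + δ) := by ring
      _ ≤ _ := by
        gcongr
        have : 0 ≤ M * (ε⁻¹) + M * (ε⁻¹) ^ 2 := by positivity
        linarith
  · exact fun x => hn _
  · exact fun x hx => hl _ (mul_nonpos_of_nonpos_of_nonneg (by linarith) (inv_pos.2 hε).le)
  · intro x hx
    apply hr
    rw [← div_eq_mul_inv, one_le_div hε]
    linarith

/-! ### Moments of sums of independent real random variables -/

section Moments

variable {Ω : Type*} [MeasurableSpace Ω] {P : Measure Ω} [IsProbabilityMeasure P]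

lemma integrable_abs_rpow_of_memLp {X : Ω → ℝ} {q r : ℝ} (hr : 0 ≤ r) (hrq : r ≤ q)
    (hX : MemLp X (ENNReal.ofReal q) P) : Integrable (fun ω => |X ω| ^ r) P := by
  have := (hX.mono_exponent (ENNReal.ofReal_le_ofReal hrq)).integrable_norm_rpow'
  simpa [ENNReal.toReal_ofReal hr] using this

lemma integrable_sq_of_memLp {X : Ω → ℝ} {q : ℝ} (hq : 2 ≤ q)
    (hX : MemLp X (ENNReal.ofReal q) P) : Integrable (fun ω => X ω ^ 2) P := by
  have := integrable_abs_rpow_of_memLp zero_le_two hq hX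
  simpa using this

omit [IsProbabilityMeasure P] in
lemma memLp_of_integrable_abs_rpow {X : Ω → ℝ} {q : ℝ} (hq : 0 < q)
    (hm : AEStronglyMeasurable X P) (hX : Integrable (fun ω => |X ω| ^ q) P) :
    MemLp X (ENNReal.ofReal q) P := by
  rw [← integrable_norm_rpow_iff hm (by simpa using hq) (by simp)]
  simpa [ENNReal.toReal_ofReal hq.le] using hX

/-- Jensen's inequality for the concave power `δ/2`. -/
lemma integral_abs_rpow_le_integral_sq_rpow {X : Ω → ℝ} {δ : ℝ} (h0 : 0 < δ) (h1 : δ ≤ 1)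
    (hX : MemLp X (ENNReal.ofReal (2 + δ)) P) :
    ∫ ω, |X ω| ^ δ ∂P ≤ (∫ ω, X ω ^ 2 ∂P) ^ (δ / 2) := by
  have e : ∀ ω, |X ω| ^ δ = (X ω ^ 2) ^ (δ / 2) := fun ω => by
    rw [← sq_abs, ← Real.rpow_two, ← Real.rpow_mul (abs_nonneg _)]
    congr 1; ring
  have hi := integrable_abs_rpow_of_memLp h0.le (by linarith : δ ≤ 2 + δ) hX
  simp_rw [e] at hi ⊢
  exact (Real.concaveOn_rpow (by positivity) (by linarith)).le_map_integral
    (Real.continuous_rpow_const (by positivity)).continuousOn isClosed_Ici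
    (ae_of_all _ fun ω => Set.mem_Ici.2 (sq_nonneg _))
    (integrable_sq_of_memLp (by linarith) hX) hi

lemma integral_abs_add_rpow_le {X Y : Ω → ℝ} {δ : ℝ} (h0 : 0 < δ) (h1 : δ ≤ 1)
    (hX : MemLp X (ENNReal.ofReal (2 + δ)) P) (hY : MemLp Y (ENNReal.ofReal (2 + δ)) P)
    (hXY : IndepFun X Y P) (hY0 : ∫ ω, Y ω ∂P = 0) :
    ∫ ω, |X ω + Y ω| ^ (2 + δ) ∂P ≤ ∫ ω, |X ω| ^ (2 + δ) ∂P
      + 6 * ((∫ ω, X ω ^ 2 ∂P) ^ (δ / 2) * ∫ ω, Y ω ^ 2 ∂P + ∫ ω, |Y ω| ^ (2 + δ) ∂P) := by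
  have hδ : 0 ≤ 2 + δ := by linarith
  have i1 := integrable_abs_rpow_of_memLp hδ le_rfl (hX.add hY)
  have i2 := integrable_abs_rpow_of_memLp hδ le_rfl hX
  have i3 := integrable_abs_rpow_of_memLp hδ le_rfl hY
  have i4 := integrable_abs_rpow_of_memLp h0.le (by linarith : δ ≤ 2 + δ) hX
  have i5 := integrable_sq_of_memLp (by linarith) hY
  have i6 : Integrable Y P := hY.integrable (by simpa using by linarith)
  have i7 : Integrable (fun ω => |X ω| ^ δ * X ω) P := by
    have := integrable_abs_rpow_of_memLp (by linarith : 0 ≤ 1 + δ)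
      (by linarith : 1 + δ ≤ 2 + δ) hX
    refine this.mono ?_ (ae_of_all _ fun ω => le_of_eq ?_)
    · have := hX.1.aemeasurable
      exact AEMeasurable.aestronglyMeasurable (by fun_prop)
    · rw [Real.norm_eq_abs, Real.norm_eq_abs, abs_mul, abs_of_nonneg (by positivity : 0 ≤ |X ω| ^ δ),
        abs_of_nonneg (by positivity : 0 ≤ |X ω| ^ (1 + δ)),
        Real.rpow_add' (abs_nonneg _) (by linarith), Real.rpow_one, mul_comm]
  have g1 : Measurable fun x : ℝ => |x| ^ δ * x := by fun_prop
  have g2 : Measurable fun x : ℝ => |x| ^ δ := by fun_prop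
  have g3 : Measurable fun x : ℝ => x ^ 2 := by fun_prop
  have j1 : IndepFun (fun ω => |X ω| ^ δ * X ω) Y P := hXY.comp g1 measurable_id
  have j2 : IndepFun (fun ω => |X ω| ^ δ) (fun ω => Y ω ^ 2) P := hXY.comp g2 g3
  have k1 : Integrable (fun ω => |X ω| ^ δ * X ω * Y ω) P := j1.integrable_mul i7 i6
  have k2 : Integrable (fun ω => |X ω| ^ δ * Y ω ^ 2) P := j2.integrable_mul i4 i5
  have e1 : ∫ ω, |X ω| ^ δ * X ω * Y ω ∂P = 0 := by
    rw [j1.integral_fun_mul_eq_mul_integral i7.1 i6.1, hY0, mul_zero]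
  have e2 : ∫ ω, |X ω| ^ δ * Y ω ^ 2 ∂P = (∫ ω, |X ω| ^ δ ∂P) * ∫ ω, Y ω ^ 2 ∂P :=
    j2.integral_fun_mul_eq_mul_integral i4.1 i5.1
  have e3 := integral_abs_rpow_le_integral_sq_rpow h0 h1 hX
  have e4 : 0 ≤ ∫ ω, Y ω ^ 2 ∂P := integral_nonneg fun ω => sq_nonneg _
  calc ∫ ω, |X ω + Y ω| ^ (2 + δ) ∂P
      ≤ ∫ ω, (|X ω| ^ (2 + δ) + (2 + δ) * (|X ω| ^ δ * X ω * Y ω)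
        + 6 * (|X ω| ^ δ * Y ω ^ 2 + |Y ω| ^ (2 + δ))) ∂P :=
        integral_mono i1 ((i2.add (k1.const_mul _)).add ((k2.add i3).const_mul _))
          fun ω => abs_add_rpow_le h0 h1 _ _
    _ = ∫ ω, |X ω| ^ (2 + δ) ∂P + 6 * ((∫ ω, |X ω| ^ δ ∂P) * ∫ ω, Y ω ^ 2 ∂P
          + ∫ ω, |Y ω| ^ (2 + δ) ∂P) := by
        have a1 : Integrable (fun ω => |X ω| ^ (2 + δ) + (2 + δ) * (|X ω| ^ δ * X ω * Y ω)) P :=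
          i2.add (k1.const_mul _)
        have a2 : Integrable (fun ω => 6 * (|X ω| ^ δ * Y ω ^ 2 + |Y ω| ^ (2 + δ))) P :=
          (k2.add i3).const_mul _
        rw [integral_add a1 a2, integral_add i2 (k1.const_mul _), integral_const_mul,
          integral_const_mul, integral_add k2 i3, e1, e2]
        ring
    _ ≤ _ := by gcongr

omit [IsProbabilityMeasure P] in
lemma integral_add_sq_of_indepFun {X Y : Ω → ℝ} (hX : MemLp X 2 P) (hY : MemLp Y 2 P)
    (hXY : IndepFun X Y P) (hY0 : ∫ ω, Y ω ∂P = 0) :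
    ∫ ω, (X ω + Y ω) ^ 2 ∂P = ∫ ω, X ω ^ 2 ∂P + ∫ ω, Y ω ^ 2 ∂P := by
  have i1 := hX.integrable_sq
  have i2 := hY.integrable_sq
  have i3 : Integrable (fun ω => X ω * Y ω) P := hX.integrable_mul hY
  have e : ∫ ω, X ω * Y ω ∂P = 0 := by
    rw [hXY.integral_fun_mul_eq_mul_integral hX.1 hY.1, hY0, mul_zero]
  calc ∫ ω, (X ω + Y ω) ^ 2 ∂P = ∫ ω, ((X ω ^ 2 + 2 * (X ω * Y ω)) + Y ω ^ 2) ∂P := by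
        congr 1; ext ω; ring
    _ = _ := by
        have a1 : Integrable (fun ω => X ω ^ 2 + 2 * (X ω * Y ω)) P := i1.add (i3.const_mul 2)
        rw [integral_add a1 i2, integral_add i1 (i3.const_mul 2), integral_const_mul, e]
        ring

/-- Rosenthal's inequality for exponents in `(2, 3]`. -/
lemma integral_abs_sum_rpow_le {ι : Type*} {Y : ι → Ω → ℝ} {δ : ℝ} (h0 : 0 < δ) (h1 : δ ≤ 1)
    (hY : ∀ k, MemLp (Y k) (ENNReal.ofReal (2 + δ)) P) (hm : ∀ k, Measurable (Y k))
    (hi : iIndepFun Y P) (hY0 : ∀ k, ∫ ω, Y k ω ∂P = 0) (s : Finset ι) :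
    ∫ ω, (∑ k ∈ s, Y k ω) ^ 2 ∂P = ∑ k ∈ s, ∫ ω, Y k ω ^ 2 ∂P ∧
    ∫ ω, |∑ k ∈ s, Y k ω| ^ (2 + δ) ∂P ≤
      6 * ((∑ k ∈ s, ∫ ω, Y k ω ^ 2 ∂P) ^ ((2 + δ) / 2)
        + ∑ k ∈ s, ∫ ω, |Y k ω| ^ (2 + δ) ∂P) := by
  classical
  have h2 : (2 : ENNReal) ≤ ENNReal.ofReal (2 + δ) := by
    rw [show (2 : ENNReal) = ENNReal.ofReal 2 by simp]
    exact ENNReal.ofReal_le_ofReal (by linarith)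
  have hq : (2 : ℝ) + δ ≠ 0 := by linarith
  induction s using Finset.induction_on with
  | empty =>
    simp [Real.zero_rpow hq, Real.zero_rpow (by linarith : (2 + δ) / 2 ≠ 0)]
  | insert k s hk ih =>
    have hS : MemLp (fun ω => ∑ j ∈ s, Y j ω) (ENNReal.ofReal (2 + δ)) P :=
      memLp_finsetSum s fun j _ => hY j
    have hind : IndepFun (fun ω => ∑ j ∈ s, Y j ω) (Y k) P := by
      have := hi.indepFun_finsetSum_of_notMem hm hk
      convert this using 1
      ext ω; simp
    have st := integral_abs_add_rpow_le h0 h1 hS (hY k) hind (hY0 k)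
    have sq := integral_add_sq_of_indepFun (hS.mono_exponent h2) ((hY k).mono_exponent h2) hind
      (hY0 k)
    simp_rw [Finset.sum_insert hk, add_comm (Y k _)]
    refine ⟨by rw [sq, ih.1, add_comm], st.trans ?_⟩
    have ih2 := ih.2
    rw [ih.1]
    set V := ∑ j ∈ s, ∫ ω, Y j ω ^ 2 ∂P with hV
    set v := ∫ ω, Y k ω ^ 2 ∂P with hv
    have hV0 : 0 ≤ V := Finset.sum_nonneg fun j _ => integral_nonneg fun ω => sq_nonneg _
    have hv0 : 0 ≤ v := integral_nonneg fun ω => sq_nonneg _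
    -- Superadditivity of the variance term: the contribution `V^(δ/2) v` of a new summand is
    -- absorbed by the growth of `V^((2+δ)/2)`, so the constant `6` does not accumulate over the
    -- induction.
    have key : V ^ ((2 + δ) / 2) + V ^ (δ / 2) * v ≤ (v + V) ^ ((2 + δ) / 2) := by
      rw [show (2 + δ) / 2 = δ / 2 + 1 by ring, Real.rpow_add_one' hV0 (by linarith),
        Real.rpow_add_one' (by positivity) (by linarith), ← mul_add, add_comm V v]
      gcongr
      linarith
    linarith

end Moments

/-! ### The standard Gaussian product measure and weighted chi-square variables -/

/-- `2 + δ` moments of the standard normal chaoses of order one and two. -/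
def gaussConst (δ : ℝ) : ℝ :=
  7 * (1 + (∫ u, |u| ^ (2 + δ) ∂(gaussianReal 0 1))
    + ((∫ u, (u ^ 2 - 1) ^ 2 ∂(gaussianReal 0 1)) ^ ((2 + δ) / 2)
    + ∫ u, |u ^ 2 - 1| ^ (2 + δ) ∂(gaussianReal 0 1)))

lemma integral_sq_gaussianReal : ∫ u, u ^ 2 ∂(gaussianReal 0 1) = 1 := by
  have := variance_id_gaussianReal (μ := 0) (v := 1)
  rw [variance_eq_sub (memLp_id_gaussianReal 2)] at this
  simpa using this

lemma memLp_id_gaussian (r : ℝ) : MemLp (fun u : ℝ => u) (ENNReal.ofReal r) (gaussianReal 0 1) :=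
  memLp_id_gaussianReal' _ (by simp)

lemma memLp_sq_gaussian (r : ℝ) :
    MemLp (fun u : ℝ => u ^ 2 - 1) (ENNReal.ofReal r) (gaussianReal 0 1) := by
  have h : MemLp (fun u : ℝ => u * u) (ENNReal.ofReal r) (gaussianReal 0 1) := by
    have := (memLp_id_gaussianReal' (μ := 0) (v := 1) (ENNReal.ofReal r * 2)
      (by finiteness))
    have ht : ENNReal.HolderTriple (ENNReal.ofReal r * 2) (ENNReal.ofReal r * 2)
        (ENNReal.ofReal r) := by
      constructor
      rw [ENNReal.mul_inv (by simp) (by simp), ← mul_add, ENNReal.inv_two_add_inv_two, mul_one]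
    exact this.mul this
  simp_rw [sq]
  exact h.sub (memLp_const 1)

section Chaos

variable {ι : Type*} [Fintype ι]

/-- The law of a vector of independent standard normal variables. -/
def stdPi (ι : Type*) [Fintype ι] : Measure (ι → ℝ) := Measure.pi fun _ => gaussianReal 0 1

instance : IsProbabilityMeasure (stdPi ι) := by unfold stdPi; infer_instance

lemma gaussConst_nonneg_parts {δ : ℝ} :
    0 ≤ (∫ u, |u| ^ (2 + δ) ∂(gaussianReal 0 1)) ∧
    0 ≤ ((∫ u, (u ^ 2 - 1) ^ 2 ∂(gaussianReal 0 1)) ^ ((2 + δ) / 2)) ∧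
    0 ≤ ∫ u, |u ^ 2 - 1| ^ (2 + δ) ∂(gaussianReal 0 1) :=
  ⟨integral_nonneg fun _ => by positivity,
    Real.rpow_nonneg (integral_nonneg fun _ => sq_nonneg _) _,
    integral_nonneg fun _ => by positivity⟩

lemma one_le_gaussConst {δ : ℝ} : 1 ≤ gaussConst δ := by
  obtain ⟨h1, h2, h3⟩ := gaussConst_nonneg_parts (δ := δ)
  unfold gaussConst; linarith

/-- Rosenthal's inequality for weighted sums of independent copies of a standardised function of a
normal variable. -/
lemma integral_abs_weighted_sum_rpow_le {g : ℝ → ℝ} {δ : ℝ} (h0 : 0 < δ) (h1 : δ ≤ 1)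
    (hg : Measurable g) (hgp : MemLp g (ENNReal.ofReal (2 + δ)) (gaussianReal 0 1))
    (hg0 : ∫ u, g u ∂(gaussianReal 0 1) = 0) (a : ι → ℝ) :
    ∫ ξ, (∑ k, a k * g (ξ k)) ^ 2 ∂(stdPi ι)
      = (∑ k, a k ^ 2) * ∫ u, g u ^ 2 ∂(gaussianReal 0 1) ∧
    ∫ ξ, |∑ k, a k * g (ξ k)| ^ (2 + δ) ∂(stdPi ι) ≤
      6 * ((∫ u, g u ^ 2 ∂(gaussianReal 0 1)) ^ ((2 + δ) / 2)
        + ∫ u, |g u| ^ (2 + δ) ∂(gaussianReal 0 1)) * (∑ k, a k ^ 2) ^ ((2 + δ) / 2) := by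
  have hY : ∀ k, MemLp (fun ξ : ι → ℝ => a k * g (ξ k)) (ENNReal.ofReal (2 + δ)) (stdPi ι) :=
    fun k => (hgp.comp_measurePreserving (measurePreserving_eval _ k)).const_mul (a k)
  have hm : ∀ k, Measurable (fun ξ : ι → ℝ => a k * g (ξ k)) := fun k => by fun_prop
  have hi : iIndepFun (fun k (ξ : ι → ℝ) => a k * g (ξ k)) (stdPi ι) :=
    iIndepFun_pi (X := fun k u => a k * g u) fun k => by fun_prop
  have hY0 : ∀ k, ∫ ξ, a k * g (ξ k) ∂(stdPi ι) = 0 := fun k => by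
    rw [integral_const_mul, stdPi, integral_comp_eval (μ := fun _ : ι => gaussianReal 0 1) (f := g)
      hg.aestronglyMeasurable, hg0, mul_zero]
  have s2 : ∀ k, ∫ ξ, (a k * g (ξ k)) ^ 2 ∂(stdPi ι)
      = a k ^ 2 * ∫ u, g u ^ 2 ∂(gaussianReal 0 1) := fun k => by
    simp_rw [mul_pow]
    rw [integral_const_mul, stdPi, integral_comp_eval (μ := fun _ : ι => gaussianReal 0 1)
      (f := fun u => g u ^ 2) (by fun_prop)]
  have sq : ∀ k, ∫ ξ, |a k * g (ξ k)| ^ (2 + δ) ∂(stdPi ι)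
      = |a k| ^ (2 + δ) * ∫ u, |g u| ^ (2 + δ) ∂(gaussianReal 0 1) := fun k => by
    simp_rw [abs_mul, Real.mul_rpow (abs_nonneg _) (abs_nonneg _)]
    rw [integral_const_mul, stdPi, integral_comp_eval (μ := fun _ : ι => gaussianReal 0 1)
      (f := fun u => |g u| ^ (2 + δ)) (Measurable.aestronglyMeasurable (by fun_prop))]
  obtain ⟨e, H⟩ := integral_abs_sum_rpow_le h0 h1 hY hm hi hY0 Finset.univ
  simp_rw [s2, sq, ← Finset.sum_mul] at e H
  refine ⟨e, H.trans ?_⟩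
  set A := ∑ k, a k ^ 2 with hA
  have hA0 : 0 ≤ A := Finset.sum_nonneg fun k _ => sq_nonneg _
  -- The `ℓ^(2+δ)` norm is at most the `ℓ²` norm, so the bound depends on the weights through `∑ a k
  -- ^ 2` alone and is free of the dimension.
  have hle : ∑ k, |a k| ^ (2 + δ) ≤ A ^ ((2 + δ) / 2) := by
    calc ∑ k, |a k| ^ (2 + δ) ≤ ∑ k, a k ^ 2 * A ^ (δ / 2) := by
          refine Finset.sum_le_sum fun k _ => ?_
          rw [← abs_mul_rpow_two_add h0]
          gcongr
          rw [show |a k| ^ δ = (a k ^ 2) ^ (δ / 2) by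
            rw [← sq_abs, ← Real.rpow_two, ← Real.rpow_mul (abs_nonneg _)]; congr 1; ring]
          gcongr
          exact Finset.single_le_sum (f := fun k => a k ^ 2) (fun j _ => sq_nonneg _)
            (Finset.mem_univ k)
      _ = _ := by
          rw [← Finset.sum_mul, ← hA, show (2 + δ) / 2 = 1 + δ / 2 by ring,
            Real.rpow_add' hA0 (by positivity), Real.rpow_one]
  have hv0 : 0 ≤ ∫ u, g u ^ 2 ∂(gaussianReal 0 1) := integral_nonneg fun ω => sq_nonneg _
  have hm0 : 0 ≤ ∫ u, |g u| ^ (2 + δ) ∂(gaussianReal 0 1) := integral_nonneg fun ω => by positivity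
  rw [Real.mul_rpow hA0 hv0]
  nlinarith [mul_le_mul_of_nonneg_right hle hm0]

lemma integral_abs_linear_stdPi_le {δ : ℝ} (h0 : 0 < δ) (h1 : δ ≤ 1) (a : ι → ℝ) :
    ∫ ξ, (∑ k, a k * ξ k) ^ 2 ∂(stdPi ι) = ∑ k, a k ^ 2 ∧
    ∫ ξ, |∑ k, a k * ξ k| ^ (2 + δ) ∂(stdPi ι) ≤
      gaussConst δ * (∑ k, a k ^ 2) ^ ((2 + δ) / 2) := by
  obtain ⟨e, H⟩ := integral_abs_weighted_sum_rpow_le h0 h1 (g := fun u => u) measurable_id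
    (memLp_id_gaussian _) (by simp) a
  rw [integral_sq_gaussianReal] at e H
  refine ⟨by simpa using e, H.trans ?_⟩
  obtain ⟨h1, h2, h3⟩ := gaussConst_nonneg_parts (δ := δ)
  rw [Real.one_rpow]
  gcongr
  unfold gaussConst
  linarith

lemma integral_abs_quadratic_stdPi_le {δ : ℝ} (h0 : 0 < δ) (h1 : δ ≤ 1) {l : ι → ℝ}
    (hl : ∑ k, l k ^ 2 = 1) :
    ∫ ξ, |∑ k, l k * (ξ k ^ 2 - 1)| ^ (2 + δ) ∂(stdPi ι) ≤ gaussConst δ := by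
  have i := (memLp_sq_gaussian (2 + δ))
  obtain ⟨-, H⟩ := integral_abs_weighted_sum_rpow_le h0 h1 (g := fun u => u ^ 2 - 1) (by fun_prop)
    i (by
      have j : Integrable (fun u : ℝ => u ^ 2) (gaussianReal 0 1) :=
        integrable_sq_of_memLp le_rfl (memLp_id_gaussian 2)
      rw [integral_sub j (integrable_const _), integral_sq_gaussianReal]; simp) l
  refine H.trans ?_
  obtain ⟨h1, h2, h3⟩ := gaussConst_nonneg_parts (δ := δ)
  rw [hl, Real.one_rpow, mul_one]
  unfold gaussConst
  linarith

/-- Jensen's inequality for the weighted mean with weights `w` reduces the bound to a single normal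
variable, again without any dependence on the dimension. -/
lemma integral_sum_sq_rpow_stdPi_le {δ : ℝ} (h0 : 0 < δ) {w : ι → ℝ}
    (hw0 : ∀ k, 0 ≤ w k) (hw : ∑ k, w k = 1) :
    ∫ ξ, (∑ k, w k * ξ k ^ 2) ^ ((2 + δ) / 2) ∂(stdPi ι) ≤ gaussConst δ := by
  have e : ∀ u : ℝ, (u ^ 2) ^ ((2 + δ) / 2) = |u| ^ (2 + δ) := fun u => by
    rw [← sq_abs, ← Real.rpow_two, ← Real.rpow_mul (abs_nonneg _)]; congr 1; ring
  have hint : ∀ k, Integrable (fun ξ : ι → ℝ => |ξ k| ^ (2 + δ)) (stdPi ι) := fun k =>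
    integrable_comp_eval (μ := fun _ : ι => gaussianReal 0 1) (f := fun u => |u| ^ (2 + δ))
      (integrable_abs_rpow_of_memLp (by linarith) le_rfl (memLp_id_gaussian (2 + δ)))
  have hsum : Integrable (fun ξ : ι → ℝ => ∑ k, w k * |ξ k| ^ (2 + δ)) (stdPi ι) :=
    integrable_finsetSum _ fun k _ => (hint k).const_mul _
  calc ∫ ξ, (∑ k, w k * ξ k ^ 2) ^ ((2 + δ) / 2) ∂(stdPi ι)
      ≤ ∫ ξ, ∑ k, w k * |ξ k| ^ (2 + δ) ∂(stdPi ι) := by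
        refine integral_mono_of_nonneg (ae_of_all _ fun ξ => ?_) hsum (ae_of_all _ fun ξ => ?_)
        · exact Real.rpow_nonneg (Finset.sum_nonneg fun k _ =>
            mul_nonneg (hw0 k) (sq_nonneg _)) _
        · have := Real.rpow_arith_mean_le_arith_mean_rpow Finset.univ w (fun k => ξ k ^ 2)
            (fun k _ => hw0 k) hw (fun k _ => sq_nonneg _) (by linarith : 1 ≤ (2 + δ) / 2)
          simpa only [e] using this
    _ = ∑ k, w k * ∫ u, |u| ^ (2 + δ) ∂(gaussianReal 0 1) := by
        rw [integral_finsetSum _ fun k _ => (hint k).const_mul _]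
        refine Finset.sum_congr rfl fun k _ => ?_
        rw [integral_const_mul, stdPi, integral_comp_eval (μ := fun _ : ι => gaussianReal 0 1)
          (f := fun u => |u| ^ (2 + δ)) (Measurable.aestronglyMeasurable (by fun_prop))]
    _ ≤ _ := by
        rw [← Finset.sum_mul, hw, one_mul]
        obtain ⟨h1, h2, h3⟩ := gaussConst_nonneg_parts (δ := δ)
        unfold gaussConst
        linarith

/-! ### Anti-concentration of weighted chi-square variables -/

/-- The integral equals `(1 - 2is)^{-1/2}`. The fourth power of the modulus is taken so that neither
the complex square root nor a real root remains. -/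
lemma norm_charFun_sq_gaussian (s : ℝ) :
    ‖∫ u, Complex.exp (((s * u ^ 2 : ℝ) : ℂ) * Complex.I) ∂(gaussianReal 0 1)‖ ^ 4
      = (1 + 4 * s ^ 2)⁻¹ := by
  have hb : 0 < (1 / 2 - s * Complex.I : ℂ).re := by simp
  have e : ∫ u, Complex.exp (((s * u ^ 2 : ℝ) : ℂ) * Complex.I) ∂(gaussianReal 0 1)
      = ((√(2 * Real.pi))⁻¹ : ℝ) * (Real.pi / (1 / 2 - s * Complex.I)) ^ (1 / 2 : ℂ) := by
    rw [integral_gaussianReal_eq_integral_smul one_ne_zero, ← integral_gaussian_complex hb,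
      ← integral_const_mul]
    congr 1; ext u
    rw [gaussianPDFReal, Complex.real_smul]
    push_cast
    rw [mul_assoc, ← Complex.exp_add]
    congr 2 <;> simp
    ring
  have e2 : ((Real.pi / (1 / 2 - s * Complex.I) : ℂ) ^ (1 / 2 : ℂ)) ^ 2
      = Real.pi / (1 / 2 - s * Complex.I) := by
    have := Complex.cpow_nat_inv_pow (Real.pi / (1 / 2 - s * Complex.I) : ℂ) two_ne_zero
    rwa [Nat.cast_two, ← one_div] at this
  have e3 : ‖(1 / 2 - s * Complex.I : ℂ)‖ ^ 2 = 1 / 4 + s ^ 2 := by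
    rw [← Complex.normSq_eq_norm_sq, Complex.normSq_apply]; simp; ring
  rw [e, norm_mul, mul_pow, show (4 : ℕ) = 2 * 2 from rfl, pow_mul ‖_ ^ _‖, ← norm_pow (_ ^ _), e2,
    norm_div, div_pow, e3, Complex.norm_real, Complex.norm_real, Real.norm_eq_abs,
    Real.norm_eq_abs, abs_of_pos Real.pi_pos, abs_of_pos (by positivity), inv_pow, pow_mul,
    Real.sq_sqrt (by positivity)]
  have := Real.pi_pos
  field_simp
  ring

omit [Fintype ι] in
lemma one_add_sum_le_prod_one_add {f : ι → ℝ} (hf : ∀ k, 0 ≤ f k) (s : Finset ι) :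
    1 + ∑ k ∈ s, f k ≤ ∏ k ∈ s, (1 + f k) := by
  classical
  induction s using Finset.induction_on with
  | empty => simp
  | insert k s hk ih =>
    rw [Finset.sum_insert hk, Finset.prod_insert hk]
    have := hf k
    have : 0 ≤ ∑ k ∈ s, f k := Finset.sum_nonneg fun j _ => hf j
    nlinarith

/-- The characteristic function factorises over coordinates, and expanding the product `∏ (1 + 4 s²
l_k²)` leaves at least `1 + 4 s²`. The bound is the same whether one weight dominates or all are
small. -/
lemma norm_charFun_quadratic_le {l : ι → ℝ} (hl : ∑ k, l k ^ 2 = 1) (s : ℝ) :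
    ‖∫ ξ, Complex.exp (((s * ∑ k, l k * ξ k ^ 2 : ℝ) : ℂ) * Complex.I) ∂(stdPi ι)‖
      ≤ ((1 + 4 * s ^ 2)⁻¹) ^ (1 / 4 : ℝ) := by
  have e : ∫ ξ, Complex.exp (((s * ∑ k, l k * ξ k ^ 2 : ℝ) : ℂ) * Complex.I) ∂(stdPi ι)
      = ∏ k, ∫ u, Complex.exp (((s * l k * u ^ 2 : ℝ) : ℂ) * Complex.I) ∂(gaussianReal 0 1) := by
    rw [stdPi, ← integral_fintype_prod_eq_prod
      (f := fun k u => Complex.exp (((s * l k * u ^ 2 : ℝ) : ℂ) * Complex.I))]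
    congr 1; ext ξ
    rw [← Complex.exp_sum, Finset.mul_sum]
    push_cast
    rw [Finset.sum_mul]
    congr 1
    exact Finset.sum_congr rfl fun k _ => by ring
  have h4 : ‖∫ ξ, Complex.exp (((s * ∑ k, l k * ξ k ^ 2 : ℝ) : ℂ) * Complex.I) ∂(stdPi ι)‖ ^ 4
      ≤ (1 + 4 * s ^ 2)⁻¹ := by
    rw [e, norm_prod, ← Finset.prod_pow]
    simp_rw [norm_charFun_sq_gaussian]
    rw [Finset.prod_inv_distrib]
    gcongr
    calc 1 + 4 * s ^ 2 = 1 + ∑ k, 4 * (s * l k) ^ 2 := by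
          simp_rw [mul_pow, ← mul_assoc]
          rw [← Finset.mul_sum, hl, mul_one]
      _ ≤ _ := one_add_sum_le_prod_one_add (fun k => by positivity) _
  calc _ = (‖∫ ξ, Complex.exp (((s * ∑ k, l k * ξ k ^ 2 : ℝ) : ℂ) * Complex.I) ∂(stdPi ι)‖ ^ 4)
        ^ (1 / 4 : ℝ) := by
        rw [← Real.rpow_natCast, ← Real.rpow_mul (norm_nonneg _)]; norm_num
    _ ≤ _ := by gcongr

/-- The modulus of continuity of weighted chi-square distributions. -/
def chiModulus (ε : ℝ) : ℝ :=
  Real.exp (1 / 2) * ∫ g, ((1 + 4 * (g / ε) ^ 2)⁻¹) ^ (1 / 4 : ℝ) ∂(gaussianReal 0 1)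

/-- Dominated convergence as the scale tends to zero: the integrand is at most `1` and vanishes in
the limit except at `g = 0`, a null set. -/
lemma exists_chiModulus_le {η : ℝ} (hη : 0 < η) : ∃ ε, 0 < ε ∧ chiModulus ε ≤ η := by
  have ht : Tendsto (fun n : ℕ => chiModulus (1 / ((n : ℝ) + 1))) atTop
      (𝓝 (Real.exp (1 / 2) * ∫ _, (0 : ℝ) ∂(gaussianReal 0 1))) := by
    refine Tendsto.const_mul _ ?_
    refine tendsto_integral_of_dominated_convergence (fun _ => 1) (fun n => ?_)
      (integrable_const _) (fun n => ae_of_all _ fun g => ?_) ?_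
    · exact Measurable.aestronglyMeasurable (by fun_prop)
    · rw [Real.norm_eq_abs, abs_of_nonneg (by positivity)]
      exact Real.rpow_le_one (by positivity) (inv_le_one_of_one_le₀ (by
        have : 0 ≤ 4 * (g / (1 / ((n : ℝ) + 1))) ^ 2 := by positivity
        linarith)) (by norm_num)
    · have h0 : ∀ᵐ g ∂(gaussianReal 0 1), g ≠ 0 := by
        have : NullSingletonClass (gaussianReal 0 1) := nullSingletonClass_gaussianReal one_ne_zero
        have : (gaussianReal 0 1) {0} = 0 := measure_singleton 0
        simp [ae_iff]
      filter_upwards [h0] with g hg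
      have t1 : Tendsto (fun n : ℕ => 1 + 4 * (g / (1 / ((n : ℝ) + 1))) ^ 2) atTop atTop := by
        have a : Tendsto (fun n : ℕ => ((n : ℝ) + 1)) atTop atTop :=
          tendsto_atTop_add_const_right _ _ tendsto_natCast_atTop_atTop
        have b : Tendsto (fun n : ℕ => 4 * g ^ 2 * ((n : ℝ) + 1) ^ 2) atTop atTop :=
          ((tendsto_pow_atTop two_ne_zero).comp a).const_mul_atTop (by positivity)
        refine (tendsto_atTop_add_const_left _ 1 b).congr fun n => ?_
        field_simp
      have t2 := (tendsto_inv_atTop_zero.comp t1).rpow_const (p := 1 / 4)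
        (Or.inr (by norm_num))
      simpa [Function.comp_def] using t2
  simp only [integral_zero, mul_zero] at ht
  obtain ⟨n, hn⟩ := (ht.eventually (ge_mem_nhds hη)).exists
  exact ⟨_, by positivity, hn⟩

/-- Fourier smoothing: the indicator of `|v| ≤ 1` is at most `e^{1/2} e^{-v²/2}`, and `e^{-v²/2}` is
the characteristic function of a standard normal `g`. By Fubini the probability is bounded by an
average over `g` of the characteristic function of the quadratic form at `g/ε`. -/
lemma stdPi_quadratic_Icc_le {l : ι → ℝ} (hl : ∑ k, l k ^ 2 = 1) {ε : ℝ} (hε : 0 < ε) (t : ℝ) :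
    (stdPi ι).real {ξ | |(∑ k, l k * ξ k ^ 2) - t| ≤ ε} ≤ chiModulus ε := by
  set V : (ι → ℝ) → ℝ := fun ξ => ∑ k, l k * ξ k ^ 2 with hV
  have hVm : Measurable V := by fun_prop
  have hG : Integrable (fun ξ => Real.exp (-(((V ξ - t) / ε) ^ 2) / 2)) (stdPi ι) := by
    refine Integrable.of_bound (Measurable.aestronglyMeasurable (by fun_prop)) 1
      (ae_of_all _ fun ξ => ?_)
    rw [Real.norm_eq_abs, abs_of_pos (Real.exp_pos _), Real.exp_le_one_iff]
    have := sq_nonneg ((V ξ - t) / ε)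
    linarith
  have s1 : (stdPi ι).real {ξ | |V ξ - t| ≤ ε}
      ≤ Real.exp (1 / 2) * ∫ ξ, Real.exp (-(((V ξ - t) / ε) ^ 2) / 2) ∂(stdPi ι) := by
    have hms : MeasurableSet {ξ | |V ξ - t| ≤ ε} :=
      measurableSet_le (by fun_prop) measurable_const
    rw [← integral_indicator_one hms, ← integral_const_mul]
    refine integral_mono ((integrable_const _).indicator hms) (hG.const_mul _) fun ξ => ?_
    by_cases hx : |V ξ - t| ≤ ε
    · rw [Set.indicator_of_mem (by exact hx)]
      rw [← Real.exp_add, Pi.one_apply, Real.one_le_exp_iff]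
      have : ((V ξ - t) / ε) ^ 2 ≤ 1 := by
        rw [div_pow, div_le_one (by positivity), sq_le_sq, abs_of_pos hε]
        exact hx
      linarith
    · rw [Set.indicator_of_notMem (by exact hx)]
      positivity
  refine s1.trans (mul_le_mul_of_nonneg_left ?_ (Real.exp_pos _).le)
  have s2 : ((∫ ξ, Real.exp (-(((V ξ - t) / ε) ^ 2) / 2) ∂(stdPi ι) : ℝ) : ℂ)
      = ∫ g, (∫ ξ, Complex.exp (((g / ε * V ξ : ℝ) : ℂ) * Complex.I) ∂(stdPi ι))
          * Complex.exp (((-(g / ε * t) : ℝ) : ℂ) * Complex.I) ∂(gaussianReal 0 1) := by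
    have a : ∀ ξ, ((Real.exp (-(((V ξ - t) / ε) ^ 2) / 2) : ℝ) : ℂ)
        = ∫ g, Complex.exp (((g / ε * V ξ : ℝ) : ℂ) * Complex.I)
          * Complex.exp (((-(g / ε * t) : ℝ) : ℂ) * Complex.I) ∂(gaussianReal 0 1) := by
      intro ξ
      have := charFun_gaussianReal (μ := 0) (v := 1) ((V ξ - t) / ε)
      rw [charFun_apply_real] at this
      calc _ = Complex.exp (((V ξ - t) / ε : ℝ) * (0 : ℝ) * Complex.I
            - ((1 : NNReal) : ℝ) * (((V ξ - t) / ε : ℝ) : ℂ) ^ 2 / 2) := by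
            push_cast
            congr 1
            ring
        _ = _ := this.symm
        _ = _ := by
            congr 1; ext g
            rw [← Complex.exp_add]
            congr 1
            push_cast
            ring
    rw [← integral_complex_ofReal]
    simp_rw [a, ← integral_mul_const]
    rw [integral_integral_swap]
    refine Integrable.of_bound (Measurable.aestronglyMeasurable (by
      unfold Function.uncurry; fun_prop)) 1 (ae_of_all _ fun z => ?_)
    simp only [Function.uncurry, norm_mul, Complex.norm_exp_ofReal_mul_I]
    norm_num
  have s3 : ∫ ξ, Real.exp (-(((V ξ - t) / ε) ^ 2) / 2) ∂(stdPi ι)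
      ≤ ‖((∫ ξ, Real.exp (-(((V ξ - t) / ε) ^ 2) / 2) ∂(stdPi ι) : ℝ) : ℂ)‖ := by
    rw [Complex.norm_real]; exact le_abs_self _
  refine s3.trans ?_
  rw [s2]
  refine norm_integral_le_of_norm_le ?_ (ae_of_all _ fun g => ?_)
  · refine Integrable.of_bound (Measurable.aestronglyMeasurable (by fun_prop)) 1
      (ae_of_all _ fun g => ?_)
    rw [Real.norm_eq_abs, abs_of_nonneg (by positivity)]
    exact Real.rpow_le_one (by positivity) (inv_le_one_of_one_le₀ (by
        have : 0 ≤ 4 * (g / ε) ^ 2 := by positivity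
        linarith)) (by norm_num)
  · rw [norm_mul, Complex.norm_exp_ofReal_mul_I, mul_one]
    exact norm_charFun_quadratic_le hl _

end Chaos

section Vector

variable {p : ℕ}

local notation "E" => EuclideanSpace ℝ (Fin p)

/-! ### Laws with a common covariance operator -/

/-- The variance of `⟨y, Z⟩` for a centred random vector `Z` with law `ν`. -/
def dirVar (ν : Measure E) (y : E) : ℝ := ∫ z, (inner ℝ y z) ^ 2 ∂ν

/-- The expected squared norm. -/
def sqMoment (ν : Measure E) : ℝ := ∫ z, ‖z‖ ^ 2 ∂ν

/-- `ρ` is centred, has the same covariance operator as `ν`, and finite moments of order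
`2 (2 + δ)`. -/
structure SameCov (δ : ℝ) (ν ρ : Measure E) : Prop where
  prob : IsProbabilityMeasure ρ
  mean : ∫ z, z ∂ρ = 0
  memLp : MemLp (fun z => z) (ENNReal.ofReal (2 * (2 + δ))) ρ
  var : ∀ y, ∫ z, (inner ℝ y z) ^ 2 ∂ρ = dirVar ν y
  trace : ∫ z, ‖z‖ ^ 2 ∂ρ = sqMoment ν

lemma memLp_inner_of_memLp {ρ : Measure E} {r : ENNReal} (h : MemLp (fun z : E => z) r ρ)
    (y : E) : MemLp (fun z : E => (inner ℝ y z : ℝ)) r ρ := h.const_inner y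

lemma integral_inner_eq_zero {ρ : Measure E} (hi : Integrable (fun z : E => z) ρ)
    (h : ∫ z, z ∂ρ = 0) (y : E) : ∫ z, (inner ℝ y z : ℝ) ∂ρ = 0 := by
  rw [integral_inner hi, h, inner_zero_right]

/-- The second moment matrix of a centred law is diagonal in a suitable orthonormal basis. -/
lemma exists_diagonalization {ν : Measure E}
    (hν : MemLp (fun z => z) 2 ν) :
    ∃ (b : OrthonormalBasis (Fin p) ℝ E) (l : Fin p → ℝ), (∀ k, 0 ≤ l k) ∧
      (∀ y, dirVar ν y = ∑ k, l k * (inner ℝ (b k) y) ^ 2) ∧ sqMoment ν = ∑ k, l k ∧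
      ∫ y, dirVar ν y ∂ν = ∑ k, l k ^ 2 := by
  have hin : ∀ y : E, MemLp (fun z : E => (inner ℝ y z : ℝ)) 2 ν := memLp_inner_of_memLp hν
  have hint : ∀ x y : E, Integrable (fun z : E => (inner ℝ x z : ℝ) * inner ℝ y z) ν :=
    fun x y => (hin x).integrable_mul (hin y)
  let e : Fin p → E := fun i => EuclideanSpace.single i (1 : ℝ)
  have he : ∀ i (z : E), (inner ℝ (e i) z : ℝ) = z i := fun i z => by
    simp [e, EuclideanSpace.inner_single_left]
  let C : Matrix (Fin p) (Fin p) ℝ := Matrix.of fun i j => ∫ z, z i * z j ∂ν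
  have hC : C.IsHermitian := by
    ext i j
    simp [C, mul_comm]
  have hcoord : ∀ i j, Integrable (fun z : E => z i * z j) ν := fun i j => by
    simpa only [he] using hint (e i) (e j)
  have hB : ∀ x y : E, ∫ z, (inner ℝ x z : ℝ) * inner ℝ y z ∂ν
      = ∑ i, x i * (C.mulVec y) i := by
    intro x y
    have : ∀ z : E, (inner ℝ x z : ℝ) * inner ℝ y z
        = ∑ i, ∑ j, x i * y j * (z i * z j) := fun z => by
      simp only [PiLp.inner_apply, RCLike.inner_apply, conj_trivial, Finset.sum_mul_sum]
      exact Finset.sum_congr rfl fun i _ => Finset.sum_congr rfl fun j _ => by ring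
    simp_rw [this]
    rw [integral_finsetSum _ fun i _ => integrable_finsetSum _ fun j _ =>
      (hcoord i j).const_mul _]
    refine Finset.sum_congr rfl fun i _ => ?_
    rw [integral_finsetSum _ fun j _ => (hcoord i j).const_mul _, Matrix.mulVec, dotProduct,
      Finset.mul_sum]
    refine Finset.sum_congr rfl fun j _ => ?_
    rw [integral_const_mul]
    simp only [C, Matrix.of_apply]
    ring
  let b := hC.eigenvectorBasis
  let l := hC.eigenvalues
  -- In the eigenbasis the coordinates are uncorrelated with second moments `l k`; all four
  -- conclusions follow from this.
  have hbb : ∀ j k, ∫ z, (inner ℝ (b j) z : ℝ) * inner ℝ (b k) z ∂ν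
      = if j = k then l k else 0 := by
    intro j k
    rw [hB, hC.mulVec_eigenvectorBasis k]
    have : ∑ i, (b j) i * ((l k • (b k).ofLp) i) = l k * inner ℝ (b j) (b k) := by
      simp only [PiLp.inner_apply, RCLike.inner_apply, conj_trivial, Finset.mul_sum,
        Pi.smul_apply, smul_eq_mul]
      exact Finset.sum_congr rfl fun i _ => by ring
    refine this.trans ?_
    rw [b.inner_eq_ite]
    simp
  have hl : ∀ k, l k = ∫ z, (inner ℝ (b k) z : ℝ) ^ 2 ∂ν := fun k => by
    have := hbb k k
    simp only [if_true] at this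
    rw [← this]; congr 1; ext z; ring
  have hvar : ∀ y, dirVar ν y = ∑ k, l k * (inner ℝ (b k) y) ^ 2 := by
    intro y
    have : ∀ z : E, (inner ℝ y z : ℝ) ^ 2 = ∑ j, ∑ k, (inner ℝ (b j) y * inner ℝ (b k) y) *
        ((inner ℝ (b j) z : ℝ) * inner ℝ (b k) z) := fun z => by
      rw [← b.sum_inner_mul_inner y z, sq, Finset.sum_mul_sum]
      refine Finset.sum_congr rfl fun i _ => Finset.sum_congr rfl fun j _ => ?_
      rw [real_inner_comm y, real_inner_comm y]; ring
    unfold dirVar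
    simp_rw [this]
    rw [integral_finsetSum _ fun i _ => integrable_finsetSum _ fun j _ =>
      (hint _ _).const_mul _]
    refine Finset.sum_congr rfl fun j _ => ?_
    rw [integral_finsetSum _ fun k _ => (hint _ _).const_mul _]
    simp_rw [integral_const_mul, hbb]
    simp
    ring
  have hsq : ∀ k, Integrable (fun z : E => (inner ℝ (b k) z : ℝ) ^ 2) ν := fun k =>
    (hin _).integrable_sq
  refine ⟨b, l, fun k => ?_, hvar, ?_, ?_⟩
  · rw [hl]; exact integral_nonneg fun z => sq_nonneg _
  · unfold sqMoment
    simp_rw [← b.sum_sq_inner_right]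
    rw [integral_finsetSum _ fun k _ => hsq k]
    exact Finset.sum_congr rfl fun k _ => (hl k).symm
  · simp_rw [hvar]
    rw [integral_finsetSum _ fun k _ => (hsq k).const_mul _]
    refine Finset.sum_congr rfl fun k _ => ?_
    rw [integral_const_mul, ← hl, sq]

/-! ### Convolution powers -/

/-- The law of the sum of `k` independent vectors with law `ρ`. -/
def convPow (ρ : Measure E) : ℕ → Measure E
  | 0 => Measure.dirac 0
  | k + 1 => (convPow ρ k).conv ρ

instance isProbabilityMeasure_convPow (ρ : Measure E) [IsProbabilityMeasure ρ] (k : ℕ) :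
    IsProbabilityMeasure (convPow ρ k) := by
  induction k with
  | zero => unfold convPow; infer_instance
  | succ k ih => unfold convPow; infer_instance

lemma charFun_convPow (ρ : Measure E) [IsProbabilityMeasure ρ] (k : ℕ) (t : E) :
    charFun (convPow ρ k) t = (charFun ρ t) ^ k := by
  induction k with
  | zero => simp [convPow]
  | succ k ih => rw [convPow, charFun_conv, ih, pow_succ]

/-! ### The Gaussian law with a given covariance operator -/

/-- `γ` is a centred Gaussian law with the covariance operator of `ν`; only the properties used in
the comparison are recorded. -/
structure GaussianMatch (δ : ℝ) (ν γ : Measure E) : Prop where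
  same : SameCov δ ν γ
  quad : ∫ z, |‖z‖ ^ 2 - sqMoment ν| ^ (2 + δ) ∂γ ≤ gaussConst δ
  lin : ∀ y, ∫ z, |inner ℝ y z| ^ (2 + δ) ∂γ ≤ gaussConst δ * dirVar ν y ^ ((2 + δ) / 2)
  form : ∫ z, dirVar ν z ^ ((2 + δ) / 2) ∂γ ≤ gaussConst δ
  stable : ∀ s : ℕ, convPow γ s = γ.map (fun z => √s • z)
  conc : ∀ t ε : ℝ, 0 < ε → γ.real {z | |‖z‖ ^ 2 - t| ≤ ε} ≤ chiModulus ε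

/-- Take `Z = ∑ √l_k ξ_k b_k` in an eigenbasis. Then `|Z|² = ∑ l_k ξ_k²` and the normalisation says
`∑ l_k² = 1`, so every bound becomes one of the chaos estimates above. Stability is read off the
characteristic function `exp(-dirVar/2)`, which also covers degenerate covariances. -/
lemma exists_gaussianMatch {δ : ℝ} (h0 : 0 < δ) (h1 : δ ≤ 1) {ν : Measure E}
    (hν : MemLp (fun z => z) 2 ν) (hunit : ∫ y, dirVar ν y ∂ν = 1) :
    ∃ γ : Measure E, GaussianMatch δ ν γ := by
  obtain ⟨b, l, hl0, hvar, htr, hsum⟩ := exists_diagonalization hν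
  rw [hunit] at hsum
  let Z : (Fin p → ℝ) → E := fun ξ => ∑ k, (√(l k) * ξ k) • b k
  have hZ : Measurable Z := by fun_prop
  have hZc : ∀ ξ k, (inner ℝ (b k) (Z ξ) : ℝ) = √(l k) * ξ k := fun ξ k => by
    simp [Z, inner_sum, inner_smul_right, b.inner_eq_ite]
  have hZy : ∀ ξ y, (inner ℝ y (Z ξ) : ℝ) = ∑ k, (√(l k) * inner ℝ (b k) y) * ξ k := fun ξ y => by
    rw [← b.sum_inner_mul_inner]
    refine Finset.sum_congr rfl fun k _ => ?_
    rw [hZc, real_inner_comm]; ring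
  have hZn : ∀ ξ, ‖Z ξ‖ ^ 2 = ∑ k, l k * ξ k ^ 2 := fun ξ => by
    rw [← b.sum_sq_inner_right]
    refine Finset.sum_congr rfl fun k _ => ?_
    rw [hZc, mul_pow, Real.sq_sqrt (hl0 k)]
  have hsqrt : ∀ y, ∑ k, (√(l k) * inner ℝ (b k) y) ^ 2 = dirVar ν y := fun y => by
    rw [hvar]
    refine Finset.sum_congr rfl fun k _ => ?_
    rw [mul_pow, Real.sq_sqrt (hl0 k)]
  have hL : ∀ k (r : ℝ), MemLp (fun ξ : Fin p → ℝ => ξ k) (ENNReal.ofReal r) (stdPi (Fin p)) :=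
    fun k r => (memLp_id_gaussian r).comp_measurePreserving (measurePreserving_eval _ k)
  have hZL : ∀ r : ℝ, MemLp Z (ENNReal.ofReal r) (stdPi (Fin p)) := fun r => by
    refine memLp_finsetSum _ fun k _ => ?_
    have h := ((hL k r).const_mul (√(l k)))
    refine (h.norm.const_mul ‖b k‖).mono (Measurable.aestronglyMeasurable (by fun_prop))
      (ae_of_all _ fun ξ => ?_)
    simp [norm_smul]
  have hdvm : Measurable (dirVar ν) := by
    have : dirVar ν = fun y => ∑ k, l k * (inner ℝ (b k) y) ^ 2 := funext hvar
    rw [this]; fun_prop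
  refine ⟨(stdPi (Fin p)).map Z, ⟨?_, ?_, ?_, ?_, ?_⟩, ?_, ?_, ?_, ?_, ?_⟩
  · exact Measure.isProbabilityMeasure_map hZ.aemeasurable
  · rw [integral_map hZ.aemeasurable (by fun_prop)]
    have hi : ∀ k, Integrable (fun ξ : Fin p → ℝ => ξ k) (stdPi (Fin p)) := fun k => by
      have := hL k 1
      rw [ENNReal.ofReal_one] at this
      exact memLp_one_iff_integrable.1 this
    have hm : ∀ k, ∫ ξ, ξ k ∂(stdPi (Fin p)) = 0 := fun k => by
      rw [stdPi, integral_comp_eval (μ := fun _ : Fin p => gaussianReal 0 1) (f := fun u => u)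
        (by fun_prop)]
      simp
    rw [integral_finsetSum _ fun k _ => ((hi k).const_mul _).smul_const _]
    simp [integral_smul_const, integral_const_mul, hm]
  · exact (memLp_map_measure_iff (by fun_prop) hZ.aemeasurable).2 (hZL _)
  · intro y
    rw [integral_map hZ.aemeasurable (by fun_prop)]
    simp_rw [hZy]
    rw [(integral_abs_linear_stdPi_le h0 h1 _).1, hsqrt]
  · rw [integral_map hZ.aemeasurable (by fun_prop)]
    simp_rw [hZn]
    have hi : ∀ k, Integrable (fun ξ : Fin p → ℝ => ξ k ^ 2) (stdPi (Fin p)) := fun k =>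
      integrable_sq_of_memLp le_rfl (hL k 2)
    rw [integral_finsetSum _ fun k _ => (hi k).const_mul _, htr]
    refine Finset.sum_congr rfl fun k _ => ?_
    rw [integral_const_mul, stdPi, integral_comp_eval (μ := fun _ : Fin p => gaussianReal 0 1)
      (f := fun u => u ^ 2) (by fun_prop), integral_sq_gaussianReal, mul_one]
  · rw [integral_map hZ.aemeasurable (Measurable.aestronglyMeasurable (by fun_prop))]
    refine le_of_eq_of_le ?_ (integral_abs_quadratic_stdPi_le h0 h1 hsum.symm)
    congr 1; ext ξ
    rw [hZn, htr, ← Finset.sum_sub_distrib]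
    congr 2
    exact Finset.sum_congr rfl fun k _ => by ring
  · intro y
    rw [integral_map hZ.aemeasurable (Measurable.aestronglyMeasurable (by fun_prop))]
    simp_rw [hZy]
    have := (integral_abs_linear_stdPi_le h0 h1 (fun k => √(l k) * inner ℝ (b k) y)).2
    rwa [hsqrt] at this
  · rw [integral_map hZ.aemeasurable (Measurable.aestronglyMeasurable (by fun_prop))]
    refine le_of_eq_of_le ?_ (integral_sum_sq_rpow_stdPi_le h0 (fun k => sq_nonneg (l k))
      hsum.symm)
    congr 1; ext ξ
    rw [hvar]
    congr 1
    refine Finset.sum_congr rfl fun k _ => ?_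
    rw [hZc, mul_pow, Real.sq_sqrt (hl0 k)]; ring
  · intro s
    have hp : IsProbabilityMeasure ((stdPi (Fin p)).map Z) :=
      Measure.isProbabilityMeasure_map hZ.aemeasurable
    have hcf : ∀ t, charFun ((stdPi (Fin p)).map Z) t = Complex.exp (-(dirVar ν t : ℂ) / 2) := by
      intro t
      rw [charFun_apply, integral_map hZ.aemeasurable
        (Measurable.aestronglyMeasurable (by fun_prop))]
      have : ∀ ξ, Complex.exp ((inner ℝ (Z ξ) t : ℝ) * Complex.I)
          = ∏ k, Complex.exp (((√(l k) * inner ℝ (b k) t : ℝ) : ℂ) * (ξ k : ℝ) * Complex.I) :=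
          fun ξ => by
        rw [real_inner_comm, hZy, ← Complex.exp_sum]
        push_cast
        rw [Finset.sum_mul]
      simp_rw [this]
      rw [stdPi, integral_fintype_prod_eq_prod (f := fun k (u : ℝ) =>
        Complex.exp (((√(l k) * inner ℝ (b k) t : ℝ) : ℂ) * (u : ℝ) * Complex.I))]
      simp_rw [← charFun_apply_real, charFun_gaussianReal]
      rw [← Complex.exp_sum, ← hsqrt]
      congr 1
      push_cast
      simp only [mul_zero, zero_mul, one_mul, zero_sub]
      rw [Finset.sum_neg_distrib, ← Finset.sum_div]
      ring
    have hp' : IsProbabilityMeasure (((stdPi (Fin p)).map Z).map fun z => √(s : ℝ) • z) :=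
      Measure.isProbabilityMeasure_map (by fun_prop)
    refine Measure.ext_of_charFun (funext fun t => ?_)
    rw [charFun_convPow, charFun_map_smul, hcf, hcf, ← Complex.exp_nat_mul]
    congr 1
    have : dirVar ν (√(s : ℝ) • t) = s * dirVar ν t := by
      simp only [dirVar, inner_smul_left, mul_pow, conj_trivial, Real.sq_sqrt (Nat.cast_nonneg s)]
      rw [integral_const_mul]
    rw [this]
    push_cast
    ring
  · intro t ε hε
    rw [map_measureReal_apply hZ (measurableSet_le (by fun_prop) (by fun_prop))]
    have := stdPi_quadratic_Icc_le hsum.symm hε t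
    simpa [hZn] using this

/-! ### Moments of partial sums -/

lemma memLp_conv {ω ρ : Measure E} [IsProbabilityMeasure ω] [IsProbabilityMeasure ρ] {r : ENNReal}
    (hω : MemLp (fun z => z) r ω) (hρ : MemLp (fun z => z) r ρ) :
    MemLp (fun z => z) r (ω.conv ρ) := by
  rw [Measure.conv, memLp_map_measure_iff (by fun_prop) (by fun_prop)]
  exact (hω.comp_measurePreserving measurePreserving_fst).add
    (hρ.comp_measurePreserving measurePreserving_snd)

lemma integral_conv_eq_integral_prod {ω ρ : Measure E} {f : E → ℝ} (hf : Measurable f) :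
    ∫ z, f z ∂(ω.conv ρ) = ∫ z : E × E, f (z.1 + z.2) ∂(ω.prod ρ) := by
  rw [Measure.conv, integral_map (by fun_prop) hf.aestronglyMeasurable]

lemma ofReal_two_mul_le {δ : ℝ} (h0 : 0 < δ) :
    ENNReal.ofReal (2 + δ) ≤ ENNReal.ofReal (2 * (2 + δ)) :=
  ENNReal.ofReal_le_ofReal (by linarith)

lemma two_le_ofReal {r : ℝ} (h : 2 ≤ r) : (2 : ENNReal) ≤ ENNReal.ofReal r := by
  rw [show (2 : ENNReal) = ENNReal.ofReal 2 by simp]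
  exact ENNReal.ofReal_le_ofReal h

lemma integrable_id_of_memLp {δ : ℝ} (h0 : 0 < δ) {ρ : Measure E} [IsProbabilityMeasure ρ]
    (h : MemLp (fun z => z) (ENNReal.ofReal (2 * (2 + δ))) ρ) : Integrable (fun z => z) ρ :=
  h.integrable (le_trans (by norm_num) (two_le_ofReal (by linarith)))

/-- The mean, covariance and directional moments of order `2 + δ` of the sum of `i` independent
vectors with law `ν` and `j` independent vectors with law `γ`. -/
structure PartialSum (δ : ℝ) (ν γ : Measure E) (i j : ℕ) (ω : Measure E) : Prop where
  prob : IsProbabilityMeasure ω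
  mean : ∫ z, z ∂ω = 0
  memLp : MemLp (fun z => z) (ENNReal.ofReal (2 * (2 + δ))) ω
  var : ∀ y, ∫ z, (inner ℝ y z) ^ 2 ∂ω = (i + j : ℕ) * dirVar ν y
  mom : ∀ y, ∫ z, |inner ℝ y z| ^ (2 + δ) ∂ω ≤
    6 * (((i + j : ℕ) * dirVar ν y) ^ ((2 + δ) / 2) + i * ∫ z, |inner ℝ y z| ^ (2 + δ) ∂ν
      + j * ∫ z, |inner ℝ y z| ^ (2 + δ) ∂γ)

lemma dirVar_nonneg (ν : Measure E) (y : E) : 0 ≤ dirVar ν y :=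
  integral_nonneg fun _ => sq_nonneg _

/-- The induction step of Rosenthal's inequality, carried out for all directions `y` at once on the
level of laws. The summand may have either law, since only the common covariance enters the variance
term. -/
lemma conv_moments {δ : ℝ} (h0 : 0 < δ) (h1 : δ ≤ 1) {ν γ ω ρ : Measure E} {i j : ℕ}
    (hω : PartialSum δ ν γ i j ω) (hρ : SameCov δ ν ρ) :
    IsProbabilityMeasure (ω.conv ρ) ∧ ∫ z, z ∂(ω.conv ρ) = 0 ∧
    MemLp (fun z => z) (ENNReal.ofReal (2 * (2 + δ))) (ω.conv ρ) ∧
    (∀ y, ∫ z, (inner ℝ y z) ^ 2 ∂(ω.conv ρ) = ((i + j : ℕ) + 1) * dirVar ν y) ∧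
    (∀ y, ∫ z, |inner ℝ y z| ^ (2 + δ) ∂(ω.conv ρ) ≤
      6 * ((((i + j : ℕ) + 1) * dirVar ν y) ^ ((2 + δ) / 2)
        + i * ∫ z, |inner ℝ y z| ^ (2 + δ) ∂ν + j * ∫ z, |inner ℝ y z| ^ (2 + δ) ∂γ
        + ∫ z, |inner ℝ y z| ^ (2 + δ) ∂ρ)) := by
  have := hω.prob
  have := hρ.prob
  have hL := memLp_conv hω.memLp hρ.memLp
  have hm : ∫ z, z ∂(ω.conv ρ) = 0 := by
    have i1 := integrable_id_of_memLp h0 hω.memLp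
    have i2 := integrable_id_of_memLp h0 hρ.memLp
    rw [Measure.conv, integral_map (by fun_prop) (by fun_prop),
      integral_add (i1.comp_fst _) (i2.comp_snd _)]
    rw [integral_fun_fst (fun z => z), integral_fun_snd (fun z => z), hω.mean, hρ.mean]
    simp
  have hX : ∀ y : E, MemLp (fun z : E × E => (inner ℝ y z.1 : ℝ)) (ENNReal.ofReal (2 + δ))
      (ω.prod ρ) := fun y =>
    ((hω.memLp.mono_exponent (ofReal_two_mul_le h0)).const_inner y).comp_measurePreserving
      measurePreserving_fst
  have hY : ∀ y : E, MemLp (fun z : E × E => (inner ℝ y z.2 : ℝ)) (ENNReal.ofReal (2 + δ))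
      (ω.prod ρ) := fun y =>
    ((hρ.memLp.mono_exponent (ofReal_two_mul_le h0)).const_inner y).comp_measurePreserving
      measurePreserving_snd
  have hind : ∀ y : E, IndepFun (fun z : E × E => (inner ℝ y z.1 : ℝ))
      (fun z : E × E => (inner ℝ y z.2 : ℝ)) (ω.prod ρ) := fun y =>
    indepFun_prod (X := fun z : E => (inner ℝ y z : ℝ)) (Y := fun z : E => (inner ℝ y z : ℝ))
      (by fun_prop) (by fun_prop)
  have hY0 : ∀ y : E, ∫ z : E × E, (inner ℝ y z.2 : ℝ) ∂(ω.prod ρ) = 0 := fun y => by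
    rw [integral_fun_snd (fun z : E => (inner ℝ y z : ℝ)),
      integral_inner_eq_zero (integrable_id_of_memLp h0 hρ.memLp) hρ.mean]
    simp
  have eX : ∀ (y : E) (f : ℝ → ℝ), ∫ z : E × E, f (inner ℝ y z.1) ∂(ω.prod ρ)
      = ∫ z, f (inner ℝ y z) ∂ω := fun y f => by
    rw [integral_fun_fst (fun z : E => f (inner ℝ y z))]; simp
  have eY : ∀ (y : E) (f : ℝ → ℝ), ∫ z : E × E, f (inner ℝ y z.2) ∂(ω.prod ρ)
      = ∫ z, f (inner ℝ y z) ∂ρ := fun y f => by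
    rw [integral_fun_snd (fun z : E => f (inner ℝ y z))]; simp
  refine ⟨inferInstance, hm, hL, fun y => ?_, fun y => ?_⟩
  · rw [integral_conv_eq_integral_prod (by fun_prop)]
    simp_rw [inner_add_right]
    rw [integral_add_sq_of_indepFun ((hX y).mono_exponent (two_le_ofReal (by linarith)))
      ((hY y).mono_exponent (two_le_ofReal (by linarith))) (hind y) (hY0 y),
      eX y (fun u => u ^ 2), eY y (fun u => u ^ 2), hω.var, hρ.var]
    ring
  · rw [integral_conv_eq_integral_prod (by fun_prop)]
    simp_rw [inner_add_right]
    refine (integral_abs_add_rpow_le h0 h1 (hX y) (hY y) (hind y) (hY0 y)).trans ?_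
    rw [eX y (fun u => u ^ 2), eY y (fun u => u ^ 2), hω.var, hρ.var,
      eX y (fun u => |u| ^ (2 + δ)), eY y (fun u => |u| ^ (2 + δ))]
    have hmom := hω.mom y
    set V := ((i + j : ℕ) : ℝ) * dirVar ν y with hV
    have hv0 := dirVar_nonneg ν y
    have hV0 : 0 ≤ V := by positivity
    have key : V ^ ((2 + δ) / 2) + V ^ (δ / 2) * dirVar ν y
        ≤ (((i + j : ℕ) + 1) * dirVar ν y) ^ ((2 + δ) / 2) := by
      rw [show (((i + j : ℕ) : ℝ) + 1) * dirVar ν y = V + dirVar ν y by rw [hV]; ring,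
        show (2 + δ) / 2 = δ / 2 + 1 by ring, Real.rpow_add_one' hV0 (by linarith),
        Real.rpow_add_one' (by positivity) (by linarith), ← mul_add]
      gcongr
      linarith
    linarith

lemma partialSum_dirac {δ : ℝ} (h0 : 0 < δ) (ν γ : Measure E) :
    PartialSum δ ν γ 0 0 (Measure.dirac 0) where
  prob := inferInstance
  mean := by simp
  memLp := by
    have : (fun z : E => z) =ᵐ[Measure.dirac 0] fun _ => 0 := by
      rw [Filter.EventuallyEq, ae_dirac_eq]; rfl
    exact (memLp_congr_ae this).2 MemLp.zero'
  var := by simp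
  mom := by
    simp [Real.zero_rpow (by linarith : (2 : ℝ) + δ ≠ 0),
      Real.zero_rpow (by linarith : ((2 : ℝ) + δ) / 2 ≠ 0)]

lemma partialSum_succ_left {δ : ℝ} (h0 : 0 < δ) (h1 : δ ≤ 1) {ν γ ω : Measure E} {i j : ℕ}
    (hν : SameCov δ ν ν) (hω : PartialSum δ ν γ i j ω) :
    PartialSum δ ν γ (i + 1) j (ω.conv ν) := by
  obtain ⟨a, b, c, d, e⟩ := conv_moments h0 h1 hω hν
  refine ⟨a, b, c, fun y => ?_, fun y => ?_⟩
  · rw [d]; push_cast; ring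
  · refine (e y).trans (le_of_eq ?_)
    push_cast
    rw [show ((i : ℝ) + j + 1) = i + 1 + j by ring]
    ring

lemma partialSum_succ_right {δ : ℝ} (h0 : 0 < δ) (h1 : δ ≤ 1) {ν γ ω : Measure E} {i j : ℕ}
    (hγ : SameCov δ ν γ) (hω : PartialSum δ ν γ i j ω) :
    PartialSum δ ν γ i (j + 1) (ω.conv γ) := by
  obtain ⟨a, b, c, d, e⟩ := conv_moments h0 h1 hω hγ
  refine ⟨a, b, c, fun y => ?_, fun y => ?_⟩
  · rw [d]; push_cast; ring
  · refine (e y).trans (le_of_eq ?_)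
    push_cast
    rw [show ((i : ℝ) + j + 1) = i + (j + 1) by ring]
    ring

lemma partialSum_convPow {δ : ℝ} (h0 : 0 < δ) (h1 : δ ≤ 1) {ν γ : Measure E}
    (hν : SameCov δ ν ν) (hγ : SameCov δ ν γ) (i j : ℕ) :
    PartialSum δ ν γ i j ((convPow ν i).conv (convPow γ j)) := by
  have := hν.prob
  have := hγ.prob
  induction j with
  | zero =>
    rw [convPow, Measure.conv_dirac_zero]
    induction i with
    | zero => exact partialSum_dirac h0 ν γ
    | succ i ih => exact partialSum_succ_left h0 h1 hν ih
  | succ j ih =>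
    rw [convPow, ← Measure.conv_assoc]
    exact partialSum_succ_right h0 h1 hγ ih

/-- With `convPow_conv_succ`: two neighbours in the interpolation between `ν` and `γ` are one common
base law convolved with `ν` and with `γ` respectively. -/
lemma convPow_succ_conv {ν γ : Measure E} [IsProbabilityMeasure ν] [IsProbabilityMeasure γ]
    (i j : ℕ) : (convPow ν (i + 1)).conv (convPow γ j)
      = ((convPow ν i).conv (convPow γ j)).conv ν := by
  rw [convPow, Measure.conv_assoc, Measure.conv_comm ν, ← Measure.conv_assoc]

lemma convPow_conv_succ {ν γ : Measure E} [IsProbabilityMeasure ν] [IsProbabilityMeasure γ]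
    (i j : ℕ) : (convPow ν i).conv (convPow γ (j + 1))
      = ((convPow ν i).conv (convPow γ j)).conv γ := by
  rw [convPow, ← Measure.conv_assoc]

/-! ### Replacing one summand -/

/-- The statistic `|w|² / s - a` for a sum `w` of `s` vectors. -/
def stat (ν : Measure E) (s : ℕ) (w : E) : ℝ := ‖w‖ ^ 2 / s - sqMoment ν

lemma measurable_stat (ν : Measure E) (s : ℕ) : Measurable (stat ν s) := by
  unfold stat; fun_prop

lemma memLp_normSq_sub {δ : ℝ} {ρ : Measure E} [IsProbabilityMeasure ρ]
    (h : MemLp (fun z => z) (ENNReal.ofReal (2 * (2 + δ))) ρ) (a : ℝ) :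
    MemLp (fun z => ‖z‖ ^ 2 - a) (ENNReal.ofReal (2 + δ)) ρ := by
  have : MemLp (fun z : E => ‖z‖ * ‖z‖) (ENNReal.ofReal (2 + δ)) ρ := by
    have ht : ENNReal.HolderTriple (ENNReal.ofReal (2 * (2 + δ))) (ENNReal.ofReal (2 * (2 + δ)))
        (ENNReal.ofReal (2 + δ)) := by
      constructor
      rw [mul_comm, ENNReal.ofReal_mul' (by norm_num), ENNReal.ofReal_ofNat,
        ENNReal.mul_inv (by simp) (by simp), ← mul_add, ENNReal.inv_two_add_inv_two, mul_one]
    exact h.norm.mul h.norm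
  simp_rw [sq]
  exact this.sub (memLp_const a)

lemma memLp_inner_prod {ω ρ : Measure E} [IsProbabilityMeasure ω]
    [IsProbabilityMeasure ρ] {r : ℝ} (hr : 0 < r) (hω : MemLp (fun z => z) (ENNReal.ofReal r) ω)
    (hρ : MemLp (fun z => z) (ENNReal.ofReal r) ρ) :
    MemLp (fun z : E × E => (inner ℝ z.1 z.2 : ℝ)) (ENNReal.ofReal r) (ω.prod ρ) := by
  have h := hω.integrable_norm_rpow'.mul_prod hρ.integrable_norm_rpow'
  rw [ENNReal.toReal_ofReal hr.le] at h
  refine memLp_of_integrable_abs_rpow hr (by fun_prop) (h.mono (Measurable.aestronglyMeasurable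
    (by fun_prop)) (ae_of_all _ fun z => ?_))
  rw [Real.norm_eq_abs, Real.norm_eq_abs, ← Real.mul_rpow (norm_nonneg _) (norm_nonneg _),
    abs_of_nonneg (by positivity : 0 ≤ |(inner ℝ z.1 z.2 : ℝ)| ^ r),
    abs_of_nonneg (by positivity : 0 ≤ (‖z.1‖ * ‖z.2‖) ^ r)]
  exact Real.rpow_le_rpow (abs_nonneg _) (abs_real_inner_le_norm z.1 z.2) hr.le

lemma SameCov.memLp' {δ : ℝ} (h0 : 0 < δ) {ν ρ : Measure E} (h : SameCov δ ν ρ) :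
    MemLp (fun z => z) (ENNReal.ofReal (2 + δ)) ρ := by
  have := h.prob
  exact h.memLp.mono_exponent (ofReal_two_mul_le h0)

/-- Both sides are double integrals of `⟨y,z⟩²`; by Fubini `ρ` enters only through its covariance.
-/
lemma integral_dirVar_of_sameCov {δ : ℝ} (h0 : 0 < δ) {ν ρ : Measure E} (hν : SameCov δ ν ν)
    (hρ : SameCov δ ν ρ) : ∫ y, dirVar ν y ∂ρ = ∫ y, dirVar ν y ∂ν := by
  have := hν.prob
  have := hρ.prob
  have hi := integrable_sq_of_memLp (by linarith)
    (memLp_inner_prod (by linarith : 0 < 2 + δ) (hρ.memLp' h0) (hν.memLp' h0))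
  have := integral_integral_swap (f := fun y z : E => (inner ℝ y z : ℝ) ^ 2) hi
  unfold dirVar at *
  rw [this]
  congr 1; ext z
  simp_rw [real_inner_comm z]
  exact hρ.var z

lemma integrable_dirVar {δ : ℝ} (h0 : 0 < δ) {ν ρ : Measure E} [IsProbabilityMeasure ρ]
    (hν : SameCov δ ν ν) (hρ : MemLp (fun z => z) (ENNReal.ofReal (2 + δ)) ρ) :
    Integrable (dirVar ν) ρ := by
  have := hν.prob
  exact (integrable_sq_of_memLp (by linarith)
    (memLp_inner_prod (by linarith : 0 < 2 + δ) hρ (hν.memLp' h0))).integral_prod_left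

/-- The expected value after adding one summand with law `ρ` depends on `ρ` only through its
covariance, up to the stated error. -/
lemma swap_bound {δ : ℝ} (h0 : 0 < δ) (h1 : δ ≤ 1) {ν γ ω ρ : Measure E} {i j s : ℕ} (hs : 1 ≤ s)
    (hij : i + j ≤ s) (hν : SameCov δ ν ν) (hunit : ∫ y, dirVar ν y ∂ν = 1)
    (hω : PartialSum δ ν γ i j ω) (hρ : SameCov δ ν ρ) {M : ℝ} {f f1 f2 : ℝ → ℝ}
    (H : SecondOrder δ M f f1 f2) {τ : ℝ} (hτ : 0 < τ) :
    |∫ w, f (stat ν s w) ∂(ω.conv ρ) - (∫ w, f (stat ν s w + sqMoment ν / s) ∂ω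
        + 2 / (s : ℝ) ^ 2 * ∫ w, f2 (stat ν s w + sqMoment ν / s) * dirVar ν w ∂ω)|
      ≤ M * (τ / s + (1 / τ + 1 / 2) * (∫ y, (‖y‖ ^ 2 - sqMoment ν) ^ 2 ∂ρ) / (s : ℝ) ^ 2
        + (32 * ∫ y, ∫ w, |inner ℝ y w| ^ (2 + δ) ∂ω ∂ρ
          + 4 * ∫ y, |‖y‖ ^ 2 - sqMoment ν| ^ (2 + δ) ∂ρ) / (s : ℝ) ^ (2 + δ)) := by
  have := hω.prob
  have := hρ.prob
  have := hν.prob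
  have hM : 0 ≤ M := (abs_nonneg _).trans (H.bound1 0)
  have hs0 : (0 : ℝ) < s := by exact_mod_cast hs
  set a := sqMoment ν with ha
  -- The expansion point includes the mean `a/s` of the contribution `|y|²/s`, so that the increment
  -- `(2⟨w,y⟩ + |y|² - a)/s` is centred given `w`.
  set Q : E → ℝ := fun w => stat ν s w + a / s with hQ
  have hQm : Measurable Q := (measurable_stat ν s).add_const _
  have hωL : MemLp (fun z => z) (ENNReal.ofReal (2 + δ)) ω :=
    hω.memLp.mono_exponent (ofReal_two_mul_le h0)
  let A : E × E → ℝ := fun z => inner ℝ z.1 z.2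
  let b : E × E → ℝ := fun z => ‖z.2‖ ^ 2 - a
  have hAm : Measurable A := by fun_prop
  have hbm : Measurable b := by fun_prop
  have hA : MemLp A (ENNReal.ofReal (2 + δ)) (ω.prod ρ) :=
    memLp_inner_prod (by linarith) hωL (hρ.memLp' h0)
  have hb : MemLp b (ENNReal.ofReal (2 + δ)) (ω.prod ρ) :=
    (memLp_normSq_sub hρ.memLp a).comp_measurePreserving measurePreserving_snd
  have iA2 := integrable_sq_of_memLp (by linarith) hA
  have ib2 := integrable_sq_of_memLp (by linarith) hb
  have iAq := integrable_abs_rpow_of_memLp (by linarith) le_rfl hA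
  have ibq := integrable_abs_rpow_of_memLp (by linarith) le_rfl hb
  have iA : Integrable A (ω.prod ρ) :=
    hA.integrable (le_trans (by norm_num) (two_le_ofReal (by linarith)))
  have ib : Integrable b (ω.prod ρ) :=
    hb.integrable (le_trans (by norm_num) (two_le_ofReal (by linarith)))
  have cm : ∀ {g : ℝ → ℝ}, Continuous g →
      AEStronglyMeasurable (fun z : E × E => g (Q z.1)) (ω.prod ρ) := fun hg =>
    (hg.measurable.comp (hQm.comp measurable_fst)).aestronglyMeasurable
  have g0 : Integrable (fun z : E × E => f (Q z.1)) (ω.prod ρ) :=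
    Integrable.of_bound (cm H.cont) 1 (ae_of_all _ fun z => H.bound _)
  have gH : Integrable (fun z : E × E => f (stat ν s (z.1 + z.2))) (ω.prod ρ) :=
    Integrable.of_bound (H.cont.measurable.comp ((measurable_stat ν s).comp
      (measurable_fst.add measurable_snd))).aestronglyMeasurable 1 (ae_of_all _ fun z => H.bound _)
  have gA : Integrable (fun z : E × E => f1 (Q z.1) * A z) (ω.prod ρ) :=
    iA.bdd_mul (cm H.cont1) (ae_of_all _ fun z => H.bound1 _)
  have gb : Integrable (fun z : E × E => f1 (Q z.1) * b z) (ω.prod ρ) :=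
    ib.bdd_mul (cm H.cont1) (ae_of_all _ fun z => H.bound1 _)
  have gA2 : Integrable (fun z : E × E => f2 (Q z.1) * A z ^ 2) (ω.prod ρ) :=
    iA2.bdd_mul (cm H.cont2) (ae_of_all _ fun z => H.bound2 _)
  have zA : ∫ z, f1 (Q z.1) * A z ∂(ω.prod ρ) = 0 := by
    rw [integral_prod _ gA]
    simp_rw [A, integral_const_mul,
      integral_inner_eq_zero (integrable_id_of_memLp h0 hρ.memLp) hρ.mean]
    simp
  have ey : ∫ y, (‖y‖ ^ 2 - a) ∂ρ = 0 := by
    have : Integrable (fun y : E => ‖y‖ ^ 2) ρ :=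
      ((hρ.memLp' h0).mono_exponent (two_le_ofReal (by linarith))).integrable_norm_pow
        (by norm_num)
    rw [integral_sub this (integrable_const _), hρ.trace]
    simp [ha]
  have zb : ∫ z, f1 (Q z.1) * b z ∂(ω.prod ρ) = 0 := by
    rw [integral_prod_mul (fun w => f1 (Q w)) (fun y : E => ‖y‖ ^ 2 - a), ey, mul_zero]
  have zA2 : ∫ z, f2 (Q z.1) * A z ^ 2 ∂(ω.prod ρ) = ∫ w, f2 (Q w) * dirVar ν w ∂ω := by
    rw [integral_prod _ gA2]
    simp_rw [A, integral_const_mul, hρ.var]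
  have z0 : ∫ z : E × E, f (Q z.1) ∂(ω.prod ρ) = ∫ w, f (Q w) ∂ω := by
    rw [integral_fun_fst (fun w => f (Q w))]; simp
  -- The remainder after removing the first order terms, which integrate to zero, and only the `A²`
  -- part of the second order term, whose integral depends on the covariance alone. The part `4 A b
  -- + b²` stays in the error.
  let g : E × E → ℝ := fun z => f (stat ν s (z.1 + z.2)) - f (Q z.1)
    - (2 / s * (f1 (Q z.1) * A z) + 1 / s * (f1 (Q z.1) * b z))
    - 2 / (s : ℝ) ^ 2 * (f2 (Q z.1) * A z ^ 2)
  have hg : ∫ z, g z ∂(ω.prod ρ) = ∫ w, f (stat ν s w) ∂(ω.conv ρ)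
      - (∫ w, f (Q w) ∂ω + 2 / (s : ℝ) ^ 2 * ∫ w, f2 (Q w) * dirVar ν w ∂ω) := by
    have i1 : Integrable (fun z : E × E => f (stat ν s (z.1 + z.2)) - f (Q z.1)) (ω.prod ρ) :=
      gH.sub g0
    have i2 : Integrable (fun z : E × E => 2 / s * (f1 (Q z.1) * A z)
      + 1 / s * (f1 (Q z.1) * b z)) (ω.prod ρ) := (gA.const_mul _).add (gb.const_mul _)
    have i3 : Integrable (fun z : E × E => f (stat ν s (z.1 + z.2)) - f (Q z.1)
      - (2 / s * (f1 (Q z.1) * A z) + 1 / s * (f1 (Q z.1) * b z))) (ω.prod ρ) := i1.sub i2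
    rw [integral_sub i3 (gA2.const_mul _), integral_sub i1 i2, integral_sub gH g0,
      integral_add (gA.const_mul _) (gb.const_mul _), integral_const_mul, integral_const_mul,
      integral_const_mul, zA, zb, zA2, z0,
      integral_conv_eq_integral_prod (f := fun w => f (stat ν s w))
        (H.cont.measurable.comp (measurable_stat ν s))]
    ring
  rw [← hg]
  have hq2 : (2 : ℝ) ^ (2 + δ) ≤ 8 := by
    calc (2 : ℝ) ^ (2 + δ) ≤ 2 ^ (3 : ℝ) :=
          Real.rpow_le_rpow_of_exponent_le (by norm_num) (by linarith)
      _ = 8 := by norm_num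
  have bd : ∀ z, ‖g z‖ ≤ M * ((τ * A z ^ 2 + (1 / τ + 1 / 2) * b z ^ 2) / (s : ℝ) ^ 2
      + (32 * |A z| ^ (2 + δ) + 4 * |b z| ^ (2 + δ)) / (s : ℝ) ^ (2 + δ)) := by
    intro z
    set D := (2 * A z + b z) / s with hD
    have e1 : stat ν s (z.1 + z.2) = Q z.1 + D := by
      simp only [hQ, stat, hD, A, b, norm_add_sq_real]
      field_simp
      ring
    have t1 := H.taylor (Q z.1) D
    have t2 : |D| ^ (2 + δ) ≤ (32 * |A z| ^ (2 + δ) + 4 * |b z| ^ (2 + δ)) / (s : ℝ) ^ (2 + δ) := by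
      rw [hD, abs_div, Real.div_rpow (abs_nonneg _) (abs_nonneg _), abs_of_pos hs0]
      gcongr
      calc |2 * A z + b z| ^ (2 + δ) ≤ (2 * |A z| + |b z|) ^ (2 + δ) := by
            refine Real.rpow_le_rpow (abs_nonneg _) ?_ (by linarith)
            refine (abs_add_le _ _).trans ?_
            rw [abs_mul, abs_two]
        _ ≤ 4 * ((2 * |A z|) ^ (2 + δ) + |b z| ^ (2 + δ)) :=
            add_rpow_le_mul_add_rpow h0 h1 (by positivity) (by positivity)
        _ ≤ _ := by
            rw [Real.mul_rpow (by norm_num) (abs_nonneg _)]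
            have : 0 ≤ |A z| ^ (2 + δ) := by positivity
            nlinarith
    have t3 : |f2 (Q z.1) * ((4 * (A z * b z) + b z ^ 2) / (2 * (s : ℝ) ^ 2))|
        ≤ M * ((τ * A z ^ 2 + (1 / τ + 1 / 2) * b z ^ 2) / (s : ℝ) ^ 2) := by
      rw [abs_mul]
      refine mul_le_mul (H.bound2 _) ?_ (abs_nonneg _) hM
      rw [abs_div, abs_of_pos (by positivity : 0 < 2 * (s : ℝ) ^ 2), div_le_div_iff₀ (by positivity)
        (by positivity)]
      -- Weighted AM-GM. The second moment of `A` is of order `s`, which the hypotheses do not make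
      -- small, so it gets the small weight `τ`; the second moment of `b` is small relative to `s`
      -- and can bear `1/τ`.
      have h3 : 2 * |A z * b z| ≤ τ * A z ^ 2 + 1 / τ * b z ^ 2 := by
        rw [abs_mul]
        have : 0 ≤ (τ * |A z| - |b z|) ^ 2 / τ := by positivity
        have h4 : (τ * |A z| - |b z|) ^ 2 / τ
            = τ * A z ^ 2 + 1 / τ * b z ^ 2 - 2 * (|A z| * |b z|) := by
          rw [← sq_abs (A z), ← sq_abs (b z)]
          field_simp
          ring
        linarith
      have h5 : |4 * (A z * b z) + b z ^ 2| ≤ 2 * (τ * A z ^ 2 + 1 / τ * b z ^ 2) + b z ^ 2 := by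
        refine (abs_add_le _ _).trans ?_
        rw [abs_mul 4, abs_of_nonneg (sq_nonneg (b z)), abs_of_pos (by norm_num : (0 : ℝ) < 4)]
        linarith
      have h6 : (0 : ℝ) < s ^ 2 := by positivity
      nlinarith [mul_le_mul_of_nonneg_right h5 h6.le]
    calc ‖g z‖ = |(f (Q z.1 + D) - f (Q z.1) - f1 (Q z.1) * D - f2 (Q z.1) * D ^ 2 / 2)
          + f2 (Q z.1) * ((4 * (A z * b z) + b z ^ 2) / (2 * (s : ℝ) ^ 2))| := by
          rw [Real.norm_eq_abs]
          simp only [g, e1, hD]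
          congr 1
          field_simp
          ring
      _ ≤ M * |D| ^ (2 + δ) + M * ((τ * A z ^ 2 + (1 / τ + 1 / 2) * b z ^ 2) / (s : ℝ) ^ 2) :=
          (abs_add_le _ _).trans (add_le_add t1 t3)
      _ ≤ _ := by
          have := mul_le_mul_of_nonneg_left t2 hM
          linarith
  have j1 : Integrable (fun z => τ * A z ^ 2 + (1 / τ + 1 / 2) * b z ^ 2) (ω.prod ρ) :=
    (iA2.const_mul _).add (ib2.const_mul _)
  have j2 : Integrable (fun z => 32 * |A z| ^ (2 + δ) + 4 * |b z| ^ (2 + δ)) (ω.prod ρ) :=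
    (iAq.const_mul _).add (ibq.const_mul _)
  have := norm_integral_le_of_norm_le (((j1.div_const _).add (j2.div_const _)).const_mul M)
    (ae_of_all _ bd)
  refine this.trans ?_
  have eb : ∀ φ : ℝ → ℝ, ∫ z, φ (b z) ∂(ω.prod ρ) = ∫ y, φ (‖y‖ ^ 2 - a) ∂ρ := fun φ => by
    rw [integral_fun_snd (fun y : E => φ (‖y‖ ^ 2 - a))]; simp
  have eA2 : ∫ z, A z ^ 2 ∂(ω.prod ρ) = (i + j : ℕ) := by
    rw [integral_prod_symm _ iA2]
    simp_rw [A, real_inner_comm, hω.var]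
    rw [integral_const_mul, integral_dirVar_of_sameCov h0 hν hρ, hunit, mul_one]
  have eAq : ∫ z, |A z| ^ (2 + δ) ∂(ω.prod ρ) = ∫ y, ∫ w, |inner ℝ y w| ^ (2 + δ) ∂ω ∂ρ := by
    rw [integral_prod_symm _ iAq]
    simp_rw [A, real_inner_comm]
  simp only [Pi.add_apply]
  rw [integral_const_mul, integral_add (j1.div_const _) (j2.div_const _), integral_div,
    integral_div, integral_add (iA2.const_mul _) (ib2.const_mul _),
    integral_add (iAq.const_mul _) (ibq.const_mul _), integral_const_mul, integral_const_mul,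
    integral_const_mul, integral_const_mul, eb (fun u => u ^ 2), eb (fun u => |u| ^ (2 + δ)),
    eA2, eAq]
  have hij' : ((i + j : ℕ) : ℝ) ≤ s := by exact_mod_cast hij
  have : τ * ((i + j : ℕ) : ℝ) / (s : ℝ) ^ 2 ≤ τ / s := by
    rw [div_le_div_iff₀ (by positivity) hs0]
    have := mul_le_mul_of_nonneg_left hij' (by positivity : 0 ≤ τ * s)
    nlinarith
  refine mul_le_mul_of_nonneg_left ?_ hM
  rw [add_div]
  linarith

/-! ### The Lindeberg telescoping argument -/

lemma dirVar_rpow_le {δ : ℝ} (h0 : 0 < δ) {ν : Measure E} [IsProbabilityMeasure ν]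
    (hν : MemLp (fun z => z) (ENNReal.ofReal (2 + δ)) ν) (y : E) :
    dirVar ν y ^ ((2 + δ) / 2) ≤ ∫ z, |inner ℝ y z| ^ (2 + δ) ∂ν := by
  have e : ∀ u : ℝ, |u| ^ (2 + δ) = (u ^ 2) ^ ((2 + δ) / 2) := fun u => by
    rw [← sq_abs, ← Real.rpow_two, ← Real.rpow_mul (abs_nonneg _)]; congr 1; ring
  have hX := hν.const_inner (𝕜 := ℝ) y
  have hi := integrable_abs_rpow_of_memLp (by linarith) le_rfl hX
  simp_rw [e] at hi ⊢
  exact (convexOn_rpow (by linarith : 1 ≤ (2 + δ) / 2)).map_integral_le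
    (Real.continuous_rpow_const (by positivity)).continuousOn isClosed_Ici
    (ae_of_all _ fun z => Set.mem_Ici.2 (sq_nonneg _))
    (integrable_sq_of_memLp (by linarith) hX) hi

lemma integrable_cross {δ : ℝ} (h0 : 0 < δ) {ν ρ : Measure E} [IsProbabilityMeasure ν]
    [IsProbabilityMeasure ρ] (hν : MemLp (fun z => z) (ENNReal.ofReal (2 + δ)) ν)
    (hρ : MemLp (fun z => z) (ENNReal.ofReal (2 + δ)) ρ) :
    Integrable (fun y => ∫ z, |inner ℝ y z| ^ (2 + δ) ∂ν) ρ :=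
  (integrable_abs_rpow_of_memLp (by linarith) le_rfl
    (memLp_inner_prod (by linarith : 0 < 2 + δ) hρ hν)).integral_prod_left

lemma integrable_dirVar_rpow {δ : ℝ} (h0 : 0 < δ) {ν ρ : Measure E} [IsProbabilityMeasure ρ]
    (hν : SameCov δ ν ν) (hρ : MemLp (fun z => z) (ENNReal.ofReal (2 + δ)) ρ) :
    Integrable (fun y => dirVar ν y ^ ((2 + δ) / 2)) ρ := by
  have := hν.prob
  refine (integrable_cross h0 (hν.memLp' h0) hρ).mono' ?_ (ae_of_all _ fun y => ?_)
  · exact ((integrable_dirVar h0 hν hρ).1.aemeasurable.pow_const _).aestronglyMeasurable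
  · rw [Real.norm_eq_abs, abs_of_nonneg (Real.rpow_nonneg (dirVar_nonneg ν y) _)]
    exact dirVar_rpow_le h0 (hν.memLp' h0) y

/-- Bounds on the moments of a summand with law `ρ`, relative to the number `s` of summands. -/
structure StepBounds (δ κ : ℝ) (s : ℕ) (ν ρ : Measure E) : Prop where
  quad2 : ∫ y, (‖y‖ ^ 2 - sqMoment ν) ^ 2 ∂ρ ≤ 2 * gaussConst δ * κ * s
  quad : ∫ y, |‖y‖ ^ 2 - sqMoment ν| ^ (2 + δ) ∂ρ ≤ gaussConst δ * κ * (s * ((s : ℝ) ^ (δ / 2)) ^ 2)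
  form : ∫ y, dirVar ν y ^ ((2 + δ) / 2) ∂ρ ≤ gaussConst δ * κ * (s : ℝ) ^ (δ / 2)
  cross : ∫ y, ∫ z, |inner ℝ y z| ^ (2 + δ) ∂ν ∂ρ ≤ gaussConst δ * κ * ((s : ℝ) ^ (δ / 2)) ^ 2

/-- The moment quantity of the theorem, for a normalised law, is at most `κ`. -/
structure SmallMoments (δ κ : ℝ) (s : ℕ) (ν : Measure E) : Prop where
  pos : 1 ≤ s
  size : ((s : ℝ) ^ (δ / 2))⁻¹ ≤ κ
  quad2 : (∫ y, (‖y‖ ^ 2 - sqMoment ν) ^ 2 ∂ν) / s ≤ κ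
  quad : (∫ y, |‖y‖ ^ 2 - sqMoment ν| ^ (2 + δ) ∂ν) / (s : ℝ) ^ (1 + δ) ≤ κ
  form : (∫ y, dirVar ν y ^ ((2 + δ) / 2) ∂ν) / (s : ℝ) ^ (δ / 2) ≤ κ
  cross : (∫ y, ∫ z, |inner ℝ y z| ^ (2 + δ) ∂ν ∂ν) / (s : ℝ) ^ δ ≤ κ

lemma rpow_half_facts {δ : ℝ} (h0 : 0 < δ) (h1 : δ ≤ 1) {s : ℕ} (hs : 1 ≤ s) :
    1 ≤ (s : ℝ) ^ (δ / 2) ∧ (s : ℝ) ^ (δ / 2) ≤ s ∧ (s : ℝ) ^ δ = ((s : ℝ) ^ (δ / 2)) ^ 2 ∧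
      (s : ℝ) ^ (1 + δ) = s * ((s : ℝ) ^ (δ / 2)) ^ 2 ∧
      (s : ℝ) ^ (2 + δ) = s ^ 2 * ((s : ℝ) ^ (δ / 2)) ^ 2 ∧
      (s : ℝ) ^ ((2 + δ) / 2) = s * (s : ℝ) ^ (δ / 2) := by
  have hs1 : (1 : ℝ) ≤ s := by exact_mod_cast hs
  have hs0 : (0 : ℝ) < s := by linarith
  have e : (s : ℝ) ^ δ = ((s : ℝ) ^ (δ / 2)) ^ 2 := by
    rw [← Real.rpow_natCast, ← Real.rpow_mul hs0.le]; congr 1; push_cast; ring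
  refine ⟨Real.one_le_rpow hs1 (by positivity), ?_, e, ?_, ?_, ?_⟩
  · calc (s : ℝ) ^ (δ / 2) ≤ (s : ℝ) ^ (1 : ℝ) :=
          Real.rpow_le_rpow_of_exponent_le hs1 (by linarith)
      _ = s := Real.rpow_one _
  · rw [Real.rpow_add hs0, Real.rpow_one, e]
  · rw [Real.rpow_add hs0, Real.rpow_two, e]
  · rw [show (2 + δ) / 2 = 1 + δ / 2 by ring, Real.rpow_add hs0, Real.rpow_one]

/-- For `ν` these are the hypotheses with denominators cleared. For `γ`, the quadratic and form
moments are bounded by constants, which are absorbed because `size` gives `κ s^(δ/2) ≥ 1`; the mixed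
moment reduces, through the Gaussian bound in each direction, to the form moment of `ν`. -/
lemma SmallMoments.stepBounds {δ κ : ℝ} (h0 : 0 < δ) (h1 : δ ≤ 1) {s : ℕ} {ν γ : Measure E}
    (hν : SameCov δ ν ν) (hγ : GaussianMatch δ ν γ) (h : SmallMoments δ κ s ν) :
    StepBounds δ κ s ν ν ∧ StepBounds δ κ s ν γ := by
  have := hν.prob
  have := hγ.same.prob
  obtain ⟨f1, f2, f3, f4, -, -⟩ := rpow_half_facts h0 h1 h.pos
  obtain ⟨hs, a0, a1, a2, a3, a4⟩ := h
  have hC := one_le_gaussConst (δ := δ)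
  set C := gaussConst δ with hCdef
  set S := (s : ℝ) ^ (δ / 2) with hS
  have hs0 : (0 : ℝ) < s := by linarith
  have hS0 : 0 < S := by linarith
  have hκ0 : 0 < κ := lt_of_lt_of_le (by positivity) a0
  have hκS : 1 ≤ κ * S := by
    rwa [inv_le_iff_one_le_mul₀ hS0] at a0
  rw [f3, div_le_iff₀ (by positivity)] at a4
  rw [f4, div_le_iff₀ (by positivity)] at a2
  rw [div_le_iff₀ hs0] at a1
  rw [div_le_iff₀ hS0] at a3
  have hSS : S ≤ S ^ 2 := by nlinarith
  have hSS' : S ^ 2 ≤ s * S ^ 2 := by nlinarith [sq_nonneg S]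
  refine ⟨⟨?_, ?_, ?_, ?_⟩, ⟨?_, ?_, ?_, ?_⟩⟩
  · nlinarith [mul_pos hκ0 hs0]
  · nlinarith [mul_pos hκ0 (by positivity : 0 < s * S ^ 2)]
  · nlinarith [mul_pos hκ0 hS0]
  · nlinarith [mul_pos hκ0 (by positivity : 0 < S ^ 2)]
  · have hq := memLp_normSq_sub hγ.same.memLp (sqMoment ν)
    have i1 := integrable_sq_of_memLp (by linarith) hq
    have i2 := integrable_abs_rpow_of_memLp (by linarith) le_rfl hq
    have := integral_mono i1 ((integrable_const 1).add i2)
      fun y => sq_le_one_add_abs_rpow h0 (‖y‖ ^ 2 - sqMoment ν)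
    simp only [Pi.add_apply] at this
    rw [integral_add (integrable_const 1) i2] at this
    have h2 := hγ.quad
    simp only [integral_const, probReal_univ, smul_eq_mul, mul_one] at this
    have h3 : 1 ≤ κ * s := hκS.trans (by gcongr)
    nlinarith
  · have h2 := hγ.quad
    have h3 : 1 ≤ κ * (s * S ^ 2) := hκS.trans (by gcongr; linarith)
    rw [← hCdef] at h2
    nlinarith
  · have h2 := hγ.form
    rw [← hCdef] at h2
    nlinarith
  · have hsw := integral_integral_swap (f := fun y z : E => |(inner ℝ y z : ℝ)| ^ (2 + δ))
      (integrable_abs_rpow_of_memLp (by linarith) le_rfl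
        (memLp_inner_prod (by linarith : 0 < 2 + δ) (hγ.same.memLp' h0) (hν.memLp' h0)))
    rw [hsw]
    have hle : ∫ z, ∫ y, |(inner ℝ y z : ℝ)| ^ (2 + δ) ∂γ ∂ν
        ≤ ∫ z, C * dirVar ν z ^ ((2 + δ) / 2) ∂ν := by
      refine integral_mono ?_ ((integrable_dirVar_rpow h0 hν (hν.memLp' h0)).const_mul _)
        fun z => ?_
      · have := integrable_cross h0 (hγ.same.memLp' h0) (hν.memLp' h0)
        simpa only [real_inner_comm] using this
      · have := hγ.lin z
        simpa only [real_inner_comm] using this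
    refine hle.trans ?_
    rw [integral_const_mul]
    have : C * (κ * S) ≤ C * (κ * S ^ 2) := by gcongr
    nlinarith

/-- The error of one replacement carries a factor `1/s`, so that `s` replacements cost a quantity
that is small once `τ` and then `κ/τ` are small. -/
lemma StepBounds.error_le {δ : ℝ} (h0 : 0 < δ) (h1 : δ ≤ 1) {κ : ℝ} {ν γ ω ρ : Measure E}
    {i j s : ℕ} (hs : 1 ≤ s) (hij : i + j ≤ s) (hν : SameCov δ ν ν) (hγ : GaussianMatch δ ν γ)
    (hω : PartialSum δ ν γ i j ω) (hρ : SameCov δ ν ρ)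
    (hb : StepBounds δ κ s ν ρ) {τ : ℝ} (hτ : 0 < τ) :
    τ / s + (1 / τ + 1 / 2) * (∫ y, (‖y‖ ^ 2 - sqMoment ν) ^ 2 ∂ρ) / (s : ℝ) ^ 2
        + (32 * ∫ y, ∫ w, |inner ℝ y w| ^ (2 + δ) ∂ω ∂ρ
          + 4 * ∫ y, |‖y‖ ^ 2 - sqMoment ν| ^ (2 + δ) ∂ρ) / (s : ℝ) ^ (2 + δ)
      ≤ (τ + (1 / τ + 1 / 2) * (2 * gaussConst δ * κ) + 580 * gaussConst δ ^ 2 * κ) / s := by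
  have := hν.prob
  have := hγ.same.prob
  have := hω.prob
  have := hρ.prob
  obtain ⟨f1, f2, f3, f4, f5, f6⟩ := rpow_half_facts h0 h1 hs
  have hC := one_le_gaussConst (δ := δ)
  have hs0 : (0 : ℝ) < s := by linarith
  have iS := integrable_dirVar_rpow h0 hν (hρ.memLp' h0)
  have iX := integrable_cross h0 (hν.memLp' h0) (hρ.memLp' h0)
  have iW := integrable_cross h0 (ν := ω) (hω.memLp.mono_exponent (ofReal_two_mul_le h0))
    (hρ.memLp' h0)
  have hij' : ((i + j : ℕ) : ℝ) ≤ s := by exact_mod_cast hij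
  have hi' : (i : ℝ) ≤ s := by exact_mod_cast (by omega : i ≤ s)
  have hj' : (j : ℝ) ≤ s := by exact_mod_cast (by omega : j ≤ s)
  have hI : ∫ y, ∫ w, |inner ℝ y w| ^ (2 + δ) ∂ω ∂ρ
      ≤ 6 * ((s * (s : ℝ) ^ (δ / 2) + s * gaussConst δ) * ∫ y, dirVar ν y ^ ((2 + δ) / 2) ∂ρ
        + s * ∫ y, ∫ z, |inner ℝ y z| ^ (2 + δ) ∂ν ∂ρ) := by
    have j1 : Integrable (fun y => (s * (s : ℝ) ^ (δ / 2) + s * gaussConst δ)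
        * dirVar ν y ^ ((2 + δ) / 2)) ρ := iS.const_mul _
    have j2 : Integrable (fun y => s * ∫ z, |inner ℝ y z| ^ (2 + δ) ∂ν) ρ := iX.const_mul _
    have j3 : Integrable (fun y => 6 * ((s * (s : ℝ) ^ (δ / 2) + s * gaussConst δ)
        * dirVar ν y ^ ((2 + δ) / 2) + s * ∫ z, |inner ℝ y z| ^ (2 + δ) ∂ν)) ρ :=
      (j1.add j2).const_mul 6
    refine (integral_mono iW j3 fun y => ?_).trans (le_of_eq ?_)
    · refine (hω.mom y).trans ?_
      have hS := dirVar_nonneg ν y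
      have hS' : 0 ≤ dirVar ν y ^ ((2 + δ) / 2) := Real.rpow_nonneg hS _
      have c1 : ((i + j : ℕ) * dirVar ν y) ^ ((2 + δ) / 2)
          ≤ s * (s : ℝ) ^ (δ / 2) * dirVar ν y ^ ((2 + δ) / 2) := by
        rw [← f6, ← Real.mul_rpow hs0.le hS]
        refine Real.rpow_le_rpow (by positivity) ?_ (by positivity)
        gcongr
      have c2 : (i : ℝ) * ∫ z, |inner ℝ y z| ^ (2 + δ) ∂ν
          ≤ s * ∫ z, |inner ℝ y z| ^ (2 + δ) ∂ν := by
        gcongr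
      have c3 : (j : ℝ) * ∫ z, |inner ℝ y z| ^ (2 + δ) ∂γ
          ≤ s * (gaussConst δ * dirVar ν y ^ ((2 + δ) / 2)) :=
        mul_le_mul hj' (hγ.lin y) (integral_nonneg fun z => by positivity) hs0.le
      linarith
    · rw [integral_const_mul, integral_add j1 j2, integral_const_mul, integral_const_mul]
  obtain ⟨b1, b2, b3, b4⟩ := hb
  set C := gaussConst δ with hCdef
  set S := (s : ℝ) ^ (δ / 2) with hSdef
  have hσ0 : 0 ≤ ∫ y, dirVar ν y ^ ((2 + δ) / 2) ∂ρ :=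
    integral_nonneg fun y => Real.rpow_nonneg (dirVar_nonneg ν y) _
  have hS0 : 0 < S := by linarith
  have hCκ : 0 ≤ C * κ := by
    have : 0 ≤ C * κ * S := hσ0.trans b3
    exact nonneg_of_mul_nonneg_left this hS0
  -- Here `18 = 6 · 3`: Rosenthal's constant times three terms, each at most `C² κ s S²`.
  have hI2 : ∫ y, ∫ w, |inner ℝ y w| ^ (2 + δ) ∂ω ∂ρ ≤ 18 * C ^ 2 * κ * (s * S ^ 2) := by
    refine hI.trans ?_
    have d1 : (s * S + s * C) * ∫ y, dirVar ν y ^ ((2 + δ) / 2) ∂ρ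
        ≤ (s * S + s * C) * (C * κ * S) := by gcongr
    have d2 : s * ∫ y, ∫ z, |inner ℝ y z| ^ (2 + δ) ∂ν ∂ρ ≤ s * (C * κ * S ^ 2) := by gcongr
    have d3 : s * (C * κ * S ^ 2) ≤ s * (C * κ * S ^ 2) * C :=
      le_mul_of_one_le_right (by positivity) hC
    have d4 : s * C * (C * κ * S) ≤ s * (C * κ * S ^ 2) * C := by
      have : S ≤ S ^ 2 := by nlinarith
      calc s * C * (C * κ * S) = s * C * (C * κ) * S := by ring
        _ ≤ s * C * (C * κ) * S ^ 2 := by gcongr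
        _ = _ := by ring
    nlinarith
  have t1 : (1 / τ + 1 / 2) * (∫ y, (‖y‖ ^ 2 - sqMoment ν) ^ 2 ∂ρ) / (s : ℝ) ^ 2
      ≤ (1 / τ + 1 / 2) * (2 * C * κ) / s := by
    calc _ ≤ (1 / τ + 1 / 2) * (2 * C * κ * s) / (s : ℝ) ^ 2 := by gcongr
      _ = _ := by field_simp
  -- The constant is `580 = 32 · 18 + 4`.
  have t2 : (32 * ∫ y, ∫ w, |inner ℝ y w| ^ (2 + δ) ∂ω ∂ρ
          + 4 * ∫ y, |‖y‖ ^ 2 - sqMoment ν| ^ (2 + δ) ∂ρ) / (s : ℝ) ^ (2 + δ)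
      ≤ 580 * C ^ 2 * κ / s := by
    rw [f5]
    have : C * κ * (s * S ^ 2) ≤ C * κ * (s * S ^ 2) * C :=
      le_mul_of_one_le_right (by positivity) hC
    calc _ ≤ (580 * C ^ 2 * κ * (s * S ^ 2)) / (s ^ 2 * S ^ 2) := by
          gcongr
          linarith
      _ = _ := by field_simp
  rw [add_div _ (580 * C ^ 2 * κ), add_div τ]
  linarith

/-- Quantitative comparison of smooth functionals of the sum with the Gaussian analogue. -/
lemma lindeberg {δ : ℝ} (h0 : 0 < δ) (h1 : δ ≤ 1) {κ : ℝ} {ν γ : Measure E} {s : ℕ}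
    (hν : SameCov δ ν ν) (hunit : ∫ y, dirVar ν y ∂ν = 1) (hγ : GaussianMatch δ ν γ)
    (hsm : SmallMoments δ κ s ν) {M : ℝ} {f f1 f2 : ℝ → ℝ}
    (H : SecondOrder δ M f f1 f2) {τ : ℝ} (hτ : 0 < τ) :
    |∫ w, f (stat ν s w) ∂(convPow ν s) - ∫ z, f (‖z‖ ^ 2 - sqMoment ν) ∂γ|
      ≤ 2 * M * (τ + (1 / τ + 1 / 2) * (2 * gaussConst δ * κ) + 580 * gaussConst δ ^ 2 * κ) := by
  have := hν.prob
  have := hγ.same.prob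
  have hM : 0 ≤ M := (abs_nonneg _).trans (H.bound1 0)
  have hs0 : (0 : ℝ) < s := by exact_mod_cast hsm.pos
  obtain ⟨bν, bγ⟩ := hsm.stepBounds h0 h1 hν hγ
  set e := τ + (1 / τ + 1 / 2) * (2 * gaussConst δ * κ) + 580 * gaussConst δ ^ 2 * κ with he
  -- By stability the sum of `s` Gaussian vectors is `√s Z`, so the fully replaced statistic is
  -- exactly `|Z|² - a`, whatever `s` is.
  have hlast : ∫ w, f (stat ν s w) ∂(convPow γ s) = ∫ z, f (‖z‖ ^ 2 - sqMoment ν) ∂γ := by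
    rw [hγ.stable, integral_map (φ := fun z : E => √(s : ℝ) • z) (f := fun w => f (stat ν s w))
      (by fun_prop) (H.cont.measurable.comp (measurable_stat ν s)).aestronglyMeasurable]
    congr 1; ext z
    rw [stat, norm_smul, mul_pow, Real.norm_eq_abs, sq_abs, Real.sq_sqrt hs0.le,
      mul_div_cancel_left₀ _ hs0.ne']
  have step : ∀ i j, i + j + 1 = s →
      |∫ w, f (stat ν s w) ∂((convPow ν (i + 1)).conv (convPow γ j))
        - ∫ w, f (stat ν s w) ∂((convPow ν i).conv (convPow γ (j + 1)))| ≤ 2 * (M * (e / s)) := by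
    intro i j hij
    have hω := partialSum_convPow h0 h1 hν hγ.same i j
    have a := (swap_bound h0 h1 hsm.pos (by omega) hν hunit hω hν H hτ).trans
      (mul_le_mul_of_nonneg_left (bν.error_le h0 h1 hsm.pos (by omega) hν hγ hω hν hτ) hM)
    have b := (swap_bound h0 h1 hsm.pos (by omega) hν hunit hω hγ.same H hτ).trans
      (mul_le_mul_of_nonneg_left
        (bγ.error_le h0 h1 hsm.pos (by omega) hν hγ hω hγ.same hτ) hM)
    rw [convPow_succ_conv, convPow_conv_succ]
    rw [abs_le] at a b ⊢
    constructor <;> linarith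
  have tele : ∀ i j, i + j = s →
      |∫ w, f (stat ν s w) ∂((convPow ν i).conv (convPow γ j))
        - ∫ w, f (stat ν s w) ∂(convPow γ s)| ≤ i * (2 * (M * (e / s))) := by
    intro i
    induction i with
    | zero =>
      intro j hj
      obtain rfl : j = s := by omega
      rw [convPow, Measure.dirac_zero_conv]
      simp
    | succ i ih =>
      intro j hj
      have a := step i j (by omega)
      have b := ih (j + 1) (by omega)
      push_cast
      rw [abs_le] at a b ⊢
      constructor <;> linarith
  have := tele s 0 (by omega)
  rw [convPow, Measure.conv_dirac_zero, hlast] at this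
  refine this.trans (le_of_eq ?_)
  field_simp

/-! ### From smooth functionals to the Kolmogorov distance. -/

/-- The distribution function of the limiting weighted chi-square variable. -/
def gaussDF (ν γ : Measure E) (u : ℝ) : ℝ := γ.real {z | ‖z‖ ^ 2 - sqMoment ν ≤ u}

lemma GaussianMatch.gaussDF_add_le {δ : ℝ} {ν γ : Measure E} (hγ : GaussianMatch δ ν γ) {ε : ℝ}
    (hε : 0 < ε) (v : ℝ) : gaussDF ν γ (v + ε) ≤ gaussDF ν γ v + chiModulus ε := by
  have := hγ.same.prob
  have hsub : {z : E | ‖z‖ ^ 2 - sqMoment ν ≤ v + ε}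
      ⊆ {z | ‖z‖ ^ 2 - sqMoment ν ≤ v} ∪ {z | |‖z‖ ^ 2 - (v + sqMoment ν)| ≤ ε} := by
    intro z hz
    simp only [Set.mem_ofPred_eq, Set.mem_union] at hz ⊢
    rcases le_or_gt (‖z‖ ^ 2 - sqMoment ν) v with h | h
    · exact Or.inl h
    · right
      rw [abs_le]; constructor <;> linarith
  refine (measureReal_mono hsub).trans ((measureReal_union_le _ _).trans ?_)
  gcongr
  · exact le_rfl
  · exact hγ.conc _ ε hε

/-- Kolmogorov distance bound for the normalised squared norm of a sum of independent vectors. -/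
lemma exists_kolmogorov_bound {δ : ℝ} (h0 : 0 < δ) (h1 : δ ≤ 1) {η : ℝ} (hη : 0 < η) :
    ∃ κ > 0, ∀ {p : ℕ} {ν γ : Measure (EuclideanSpace ℝ (Fin p))} {s : ℕ}, SameCov δ ν ν →
      ∫ y, dirVar ν y ∂ν = 1 → GaussianMatch δ ν γ → SmallMoments δ κ s ν → ∀ u : ℝ,
      |(convPow ν s).real {w | stat ν s w ≤ u} - gaussDF ν γ u| ≤ η := by
  -- Order of choices: `ε` from the anti-concentration bound, then `M` from `ε`, `τ` from `M`, and
  -- finally `κ`. None of them sees the dimension, the law or `s`. Half of `η` pays for smoothing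
  -- the indicator, half for the replacement error.
  obtain ⟨ε, hε, hchi⟩ := exists_chiModulus_le (half_pos hη)
  obtain ⟨M, hM, hstep⟩ := exists_smooth_indicator h0 h1 hε
  set C := gaussConst δ with hC
  obtain ⟨τ, hτ, hτ'⟩ : ∃ τ > 0, 2 * M * τ ≤ η / 4 :=
    ⟨η / (8 * M + 1), by positivity, by
      rw [mul_div_assoc', div_le_div_iff₀ (by positivity) (by norm_num)]; nlinarith⟩
  set B := 2 * M * ((1 / τ + 1 / 2) * (2 * C) + 580 * C ^ 2) with hB
  have hC1 : 1 ≤ C := one_le_gaussConst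
  have hB0 : 0 ≤ B := by positivity
  obtain ⟨κ, hκ, hκ'⟩ : ∃ κ > 0, B * κ ≤ η / 4 :=
    ⟨η / (4 * B + 1), by positivity, by
      rw [mul_div_assoc', div_le_div_iff₀ (by positivity) (by norm_num)]; nlinarith⟩
  refine ⟨κ, hκ, fun {p ν γ s} hν hunit hγ hsm u => ?_⟩
  have := hν.prob
  have := hγ.same.prob
  have hms : ∀ v, MeasurableSet {w | stat ν s w ≤ v} := fun v =>
    measurableSet_le (measurable_stat ν s) measurable_const
  have hmg : Measurable fun z : EuclideanSpace ℝ (Fin p) => ‖z‖ ^ 2 - sqMoment ν := by fun_prop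
  have hmz : ∀ v, MeasurableSet {z : EuclideanSpace ℝ (Fin p) | ‖z‖ ^ 2 - sqMoment ν ≤ v} :=
    fun v => measurableSet_le hmg measurable_const
  have hind : ∀ {μ : Measure (EuclideanSpace ℝ (Fin p))} [IsProbabilityMeasure μ]
      {T : EuclideanSpace ℝ (Fin p) → ℝ} (_ : Measurable T) {v : ℝ} {f f1 f2 : ℝ → ℝ},
      SecondOrder δ M f f1 f2 → (∀ x, 0 ≤ f x) → (∀ x ≤ v, f x = 1) →
      (∀ x, v + ε ≤ x → f x = 0) →
      μ.real {w | T w ≤ v} ≤ ∫ w, f (T w) ∂μ ∧ ∫ w, f (T w) ∂μ ≤ μ.real {w | T w ≤ v + ε} := by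
    intro μ _ T hT v f f1 f2 H hn hl hr
    have hi : Integrable (fun w => f (T w)) μ :=
      Integrable.of_bound (H.cont.measurable.comp hT).aestronglyMeasurable 1
        (ae_of_all _ fun w => H.bound _)
    have m1 : MeasurableSet {w | T w ≤ v} := measurableSet_le hT measurable_const
    have m2 : MeasurableSet {w | T w ≤ v + ε} := measurableSet_le hT measurable_const
    rw [← integral_indicator_one m1, ← integral_indicator_one m2]
    refine ⟨integral_mono ((integrable_const _).indicator m1) hi fun w => ?_,
      integral_mono hi ((integrable_const _).indicator m2) fun w => ?_⟩
    · by_cases hw : T w ≤ v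
      · rw [Set.indicator_of_mem (by exact hw), hl _ hw]; rfl
      · rw [Set.indicator_of_notMem (by exact hw)]; exact hn _
    · by_cases hw : T w ≤ v + ε
      · rw [Set.indicator_of_mem (by exact hw)]
        exact (le_abs_self _).trans (H.bound _)
      · rw [Set.indicator_of_notMem (by exact hw)]
        exact (hr _ (le_of_not_ge hw)).le
  have hmod : ∀ v, gaussDF ν γ (v + ε) ≤ gaussDF ν γ v + η / 2 := fun v =>
    (hγ.gaussDF_add_le hε v).trans (by gcongr)
  have herr : 2 * M * (τ + (1 / τ + 1 / 2) * (2 * C * κ) + 580 * C ^ 2 * κ) ≤ η / 2 := by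
    have : 2 * M * (τ + (1 / τ + 1 / 2) * (2 * C * κ) + 580 * C ^ 2 * κ)
        = 2 * M * τ + B * κ := by rw [hB]; ring
    linarith
  rw [abs_le]
  constructor
  -- The lower bound uses the smooth step that descends on `[u - ε, u]`, the upper bound the one
  -- that descends on `[u, u + ε]`.
  · obtain ⟨f, f1, f2, H, hn, hl, hr⟩ := hstep (u - ε)
    have a := (hind (μ := convPow ν s) (measurable_stat ν s) H hn hl hr).2
    have b := (hind (μ := γ) hmg H hn hl hr).1
    have c := lindeberg h0 h1 hν hunit hγ hsm H hτ
    have d := hmod (u - ε)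
    rw [sub_add_cancel] at a d
    unfold gaussDF at d ⊢
    rw [abs_le] at c
    linarith [c.1]
  · obtain ⟨f, f1, f2, H, hn, hl, hr⟩ := hstep u
    have a := (hind (μ := convPow ν s) (measurable_stat ν s) H hn hl hr).1
    have b := (hind (μ := γ) hmg H hn hl hr).2
    have c := lindeberg h0 h1 hν hunit hγ hsm H hτ
    have d := hmod u
    rw [abs_le] at c
    unfold gaussDF at d ⊢
    linarith [c.2]

/-! ### Sums over index sets of an i.i.d. sample -/

/-- The law of an i.i.d. sample of size `n`. -/
def sampleLaw (n : ℕ) (ν : Measure E) : Measure (Fin n → E) := Measure.pi fun _ => ν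

instance (n : ℕ) (ν : Measure E) [IsProbabilityMeasure ν] :
    IsProbabilityMeasure (sampleLaw n ν) := by unfold sampleLaw; infer_instance

variable {n : ℕ} {ν : Measure (EuclideanSpace ℝ (Fin p))}

lemma iIndepFun_sampleLaw [IsProbabilityMeasure ν] :
    iIndepFun (fun i (x : Fin n → E) => x i) (sampleLaw n ν) :=
  iIndepFun_pi (X := fun _ z => z) fun _ => aemeasurable_id

lemma hasLaw_sum_sampleLaw [IsProbabilityMeasure ν] (B : Finset (Fin n)) :
    HasLaw (fun x : Fin n → E => ∑ b ∈ B, x b) (convPow ν B.card) (sampleLaw n ν) := by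
  induction B using Finset.induction_on with
  | empty =>
    simp only [Finset.sum_empty, Finset.card_empty, convPow]
    exact hasLaw_dirac_of_ae_eq (ae_of_all _ fun _ => rfl)
  | insert k s hk ih =>
    have hind : IndepFun (fun x : Fin n → E => ∑ b ∈ s, x b) (fun x => x k) (sampleLaw n ν) := by
      have := (iIndepFun_sampleLaw (n := n) (ν := ν)).indepFun_finsetSum_of_notMem
        (fun i => measurable_pi_apply i) hk
      convert this using 1
      ext x; simp
    have hk' : HasLaw (fun x : Fin n → E => x k) ν (sampleLaw n ν) :=
      (measurePreserving_eval (fun _ : Fin n => ν) k).hasLaw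
    have := IndepFun.hasLaw_fun_add ih hk' hind
    rw [Finset.card_insert_of_notMem hk, convPow]
    simpa only [Finset.sum_insert hk, add_comm] using this

lemma indepFun_sum_sampleLaw [IsProbabilityMeasure ν] {B C : Finset (Fin n)} (h : Disjoint B C) :
    IndepFun (fun x : Fin n → E => ∑ b ∈ B, x b) (fun x => ∑ c ∈ C, x c) (sampleLaw n ν) := by
  have := (iIndepFun_sampleLaw (n := n) (ν := ν)).indepFun_finset B C h
    (fun i => measurable_pi_apply i)
  have h2 := this.comp (φ := fun z : B → E => ∑ b, z b) (ψ := fun z : C → E => ∑ c, z c)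
    (by fun_prop) (by fun_prop)
  convert h2 using 1 <;> ext x : 1 <;> simp only [Function.comp]
  · exact (Finset.sum_coe_sort B (fun b => x b)).symm
  · exact (Finset.sum_coe_sort C (fun b => x b)).symm

lemma partialSum_convPow_self {δ : ℝ} (h0 : 0 < δ) (h1 : δ ≤ 1) (hν : SameCov δ ν ν) (k : ℕ) :
    PartialSum δ ν ν k 0 (convPow ν k) := by
  have := hν.prob
  have := partialSum_convPow h0 h1 hν hν k 0
  rwa [convPow, Measure.conv_dirac_zero] at this

/-- The second moment of the centred squared norm of a sum. -/
lemma integral_normSq_sub_sq_le {δ : ℝ} (h0 : 0 < δ) (h1 : δ ≤ 1) (hν : SameCov δ ν ν)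
    (hunit : ∫ y, dirVar ν y ∂ν = 1) (k : ℕ) :
    ∫ w, (‖w‖ ^ 2 - k * sqMoment ν) ^ 2 ∂(convPow ν k)
      ≤ 4 * (k : ℝ) ^ 2 + 2 * k * ∫ y, (‖y‖ ^ 2 - sqMoment ν) ^ 2 ∂ν := by
  have := hν.prob
  induction k with
  | zero => simp [convPow]
  | succ k ih =>
    have hω := partialSum_convPow_self h0 h1 hν k
    set a := sqMoment ν with ha
    set ω := convPow ν k
    have hωL : MemLp (fun z => z) (ENNReal.ofReal (2 + δ)) ω :=
      hω.memLp.mono_exponent (ofReal_two_mul_le h0)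
    have le2 : (2 : ENNReal) ≤ ENNReal.ofReal (2 + δ) := two_le_ofReal (by linarith)
    let U : E → ℝ := fun w => ‖w‖ ^ 2 - k * a
    let A : E × E → ℝ := fun z => inner ℝ z.1 z.2
    let b : E → ℝ := fun y => ‖y‖ ^ 2 - a
    have hU : MemLp U 2 ω := (memLp_normSq_sub hω.memLp _).mono_exponent le2
    have hb : MemLp b 2 ν := (memLp_normSq_sub hν.memLp _).mono_exponent le2
    have hA : MemLp A 2 (ω.prod ν) :=
      (memLp_inner_prod (by linarith) hωL (hν.memLp' h0)).mono_exponent le2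
    have hU' : MemLp (fun z : E × E => U z.1) 2 (ω.prod ν) :=
      hU.comp_measurePreserving measurePreserving_fst
    have hb' : MemLp (fun z : E × E => b z.2) 2 (ω.prod ν) :=
      hb.comp_measurePreserving measurePreserving_snd
    have iUA : Integrable (fun z : E × E => U z.1 * A z) (ω.prod ν) := hU'.integrable_mul hA
    have iUb : Integrable (fun z : E × E => U z.1 * b z.2) (ω.prod ν) := hU'.integrable_mul hb'
    have zUA : ∫ z : E × E, U z.1 * A z ∂(ω.prod ν) = 0 := by
      rw [integral_prod _ iUA]
      simp_rw [A, integral_const_mul,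
        integral_inner_eq_zero (integrable_id_of_memLp h0 hν.memLp) hν.mean]
      simp
    have ey : ∫ y, b y ∂ν = 0 := by
      have : Integrable (fun y : E => ‖y‖ ^ 2) ν :=
        ((hν.memLp' h0).mono_exponent le2).integrable_norm_pow (by norm_num)
      rw [integral_sub this (integrable_const _), hν.trace]
      simp [ha]
    have zUb : ∫ z : E × E, U z.1 * b z.2 ∂(ω.prod ν) = 0 := by
      rw [integral_prod_mul U b, ey, mul_zero]
    have eA2 : ∫ z, A z ^ 2 ∂(ω.prod ν) = k := by
      rw [integral_prod_symm _ hA.integrable_sq]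
      simp_rw [A, real_inner_comm, hω.var]
      rw [integral_const_mul, hunit, mul_one, add_zero]
    have eU2 : ∫ z : E × E, U z.1 ^ 2 ∂(ω.prod ν) = ∫ w, U w ^ 2 ∂ω := by
      rw [integral_fun_fst (fun w => U w ^ 2)]; simp
    have eb2 : ∫ z : E × E, b z.2 ^ 2 ∂(ω.prod ν) = ∫ y, b y ^ 2 ∂ν := by
      rw [integral_fun_snd (fun w => b w ^ 2)]; simp
    -- One more summand adds `2A + b`, which is uncorrelated with `U`. Since `A` has second moment
    -- `k`, the term `8 A²` contributes `8k`, at most the increment of `4 k²`.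
    have pw : ∀ z : E × E, (‖z.1 + z.2‖ ^ 2 - ((k + 1 : ℕ) : ℝ) * a) ^ 2
        ≤ (U z.1 ^ 2 + (4 * (U z.1 * A z) + 2 * (U z.1 * b z.2)))
          + (8 * A z ^ 2 + 2 * b z.2 ^ 2) := by
      intro z
      have : ‖z.1 + z.2‖ ^ 2 - ((k + 1 : ℕ) : ℝ) * a = U z.1 + (2 * A z + b z.2) := by
        simp only [U, A, b, norm_add_sq_real]; push_cast; ring
      rw [this]
      nlinarith [sq_nonneg (2 * A z - b z.2)]
    have j1 : Integrable (fun z : E × E => 4 * (U z.1 * A z) + 2 * (U z.1 * b z.2)) (ω.prod ν) :=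
      (iUA.const_mul _).add (iUb.const_mul _)
    have j2 : Integrable (fun z : E × E => U z.1 ^ 2 + (4 * (U z.1 * A z) + 2 * (U z.1 * b z.2)))
      (ω.prod ν) := hU'.integrable_sq.add j1
    have j3 : Integrable (fun z : E × E => 8 * A z ^ 2 + 2 * b z.2 ^ 2) (ω.prod ν) :=
      (hA.integrable_sq.const_mul _).add (hb'.integrable_sq.const_mul _)
    rw [convPow, integral_conv_eq_integral_prod (by fun_prop)]
    refine (integral_mono_of_nonneg (ae_of_all _ fun z => sq_nonneg _) (j2.add j3)
      (ae_of_all _ pw)).trans ?_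
    simp only [Pi.add_apply]
    rw [integral_add j2 j3, integral_add hU'.integrable_sq j1,
      integral_add (iUA.const_mul _) (iUb.const_mul _),
      integral_add (hA.integrable_sq.const_mul _) (hb'.integrable_sq.const_mul _)]
    simp_rw [integral_const_mul]
    rw [zUA, zUb, eA2, eU2, eb2]
    push_cast
    linarith

lemma memLp_stat {δ : ℝ} {ω : Measure E} [IsProbabilityMeasure ω]
    (h : MemLp (fun z => z) (ENNReal.ofReal (2 * (2 + δ))) ω) (s : ℕ) :
    MemLp (stat ν s) (ENNReal.ofReal (2 + δ)) ω := by
  have := (memLp_normSq_sub h 0).const_mul ((s : ℝ)⁻¹)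
  have h2 := this.sub (memLp_const (sqMoment ν))
  refine (memLp_congr_ae (ae_of_all _ fun w => ?_)).1 h2
  simp only [stat, Pi.sub_apply]; ring

lemma integral_stat_sq_le {δ : ℝ} (h0 : 0 < δ) (h1 : δ ≤ 1) (hν : SameCov δ ν ν)
    (hunit : ∫ y, dirVar ν y ∂ν = 1) {k : ℕ} (hk : 1 ≤ k) :
    ∫ w, stat ν k w ^ 2 ∂(convPow ν k)
      ≤ 4 + 2 * ((∫ y, (‖y‖ ^ 2 - sqMoment ν) ^ 2 ∂ν) / k) := by
  have hk0 : (0 : ℝ) < k := by exact_mod_cast hk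
  have h := integral_normSq_sub_sq_le h0 h1 hν hunit k
  have e : ∀ w, stat ν k w ^ 2 = (‖w‖ ^ 2 - k * sqMoment ν) ^ 2 / (k : ℝ) ^ 2 := fun w => by
    rw [stat, ← div_pow]; congr 1; field_simp
  simp_rw [e]
  rw [integral_div, div_le_iff₀ (by positivity)]
  refine h.trans (le_of_eq ?_)
  field_simp

/-! ### Subsample statistics centred at the sample mean -/

/-- The normalised statistic of the subsample `B`, centred at the sample mean. -/
def hatStat (ν : Measure E) (m : ℕ) (B : Finset (Fin n)) (x : Fin n → E) : ℝ :=
  m * ‖subMean x B - sampleMean x‖ ^ 2 / (1 - (m : ℝ) / n) - sqMoment ν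

lemma measurable_hatStat (m : ℕ) (B : Finset (Fin n)) : Measurable (hatStat ν m B) := by
  unfold hatStat sampleMean subMean; fun_prop

/-- The reason for the factor `1 - m/n`: with `S`, `T` the sums over `B` and its complement and `θ =
m/n`, the corrected squared norm is `(1-θ)|S|²/m + θ|T|²/(n-m) - (2/n)⟨S,T⟩`. The first two weights
add to one, so the traces cancel and no bias is left. -/
lemma hatStat_eq {m : ℕ} (hm : 1 ≤ m) (hmn : 2 * m ≤ n) {B : Finset (Fin n)} (hB : B.card = m)
    (x : Fin n → E) :
    hatStat ν m B x = stat ν m (∑ b ∈ B, x b)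
      + ((m : ℝ) / n * (stat ν (n - m) (∑ b ∈ Bᶜ, x b) - stat ν m (∑ b ∈ B, x b))
      - 2 / n * inner ℝ (∑ b ∈ B, x b) (∑ b ∈ Bᶜ, x b)) := by
  have hm0 : (0 : ℝ) < m := by exact_mod_cast hm
  have hn0 : (0 : ℝ) < n := by exact_mod_cast (by omega : 0 < n)
  have hnm : (0 : ℝ) < n - m := by
    have : (2 : ℝ) * m ≤ n := by exact_mod_cast hmn
    linarith
  set S := ∑ b ∈ B, x b with hS
  set T := ∑ b ∈ Bᶜ, x b with hT
  have hsum : ∑ b, x b = S + T := (Finset.sum_add_sum_compl B x).symm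
  have e : subMean x B - sampleMean x = ((m : ℝ)⁻¹ - (n : ℝ)⁻¹) • S - (n : ℝ)⁻¹ • T := by
    simp only [sampleMean, subMean, hB, Finset.card_univ, Fintype.card_fin, hsum, ← hS]
    module
  rw [hatStat, e, norm_sub_sq_real, norm_smul, norm_smul, inner_smul_left, inner_smul_right, stat,
    stat, Nat.cast_sub (by omega), mul_pow, mul_pow, Real.norm_eq_abs, Real.norm_eq_abs, sq_abs,
    sq_abs, conj_trivial]
  have h1 : (1 : ℝ) - m / n = (n - m) / n := by field_simp
  rw [h1]
  field_simp
  ring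

/-- The sums over `B` and its complement are independent. Both statistics have second moment at most
`6`, and `⟨S,T⟩` has second moment `m(n-m)`; splitting the square into three terms gives `48 = 3 ·
12 + 12`. -/
lemma integral_hatStat_sub_sq_le {δ : ℝ} (h0 : 0 < δ) (h1 : δ ≤ 1) (hν : SameCov δ ν ν)
    (hunit : ∫ y, dirVar ν y ∂ν = 1) {m : ℕ} (hm : 1 ≤ m) (hmn : 2 * m ≤ n)
    (hk : (∫ y, (‖y‖ ^ 2 - sqMoment ν) ^ 2 ∂ν) / m ≤ 1) {B : Finset (Fin n)} (hB : B.card = m) :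
    Integrable (fun x => (hatStat ν m B x - stat ν m (∑ b ∈ B, x b)) ^ 2) (sampleLaw n ν) ∧
    ∫ x, (hatStat ν m B x - stat ν m (∑ b ∈ B, x b)) ^ 2 ∂(sampleLaw n ν)
      ≤ 48 * ((m : ℝ) / n) := by
  have := hν.prob
  have hm0 : (0 : ℝ) < m := by exact_mod_cast hm
  have hn0 : (0 : ℝ) < n := by exact_mod_cast (by omega : 0 < n)
  have hmn' : (2 : ℝ) * m ≤ n := by exact_mod_cast hmn
  have hC : Bᶜ.card = n - m := by rw [Finset.card_compl, hB, Fintype.card_fin]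
  have lB := hasLaw_sum_sampleLaw (ν := ν) B
  have lC := hasLaw_sum_sampleLaw (ν := ν) Bᶜ
  have lBC := (indepFun_sum_sampleLaw (ν := ν) (disjoint_compl_right (a := B))).hasLaw_prod lB lC
  rw [hB] at lB lBC
  rw [hC] at lC lBC
  have pB := partialSum_convPow_self h0 h1 hν m
  have pC := partialSum_convPow_self h0 h1 hν (n - m)
  have le2 : (2 : ENNReal) ≤ ENNReal.ofReal (2 + δ) := two_le_ofReal (by linarith)
  let f : E × E → ℝ := fun z => (m : ℝ) / n * (stat ν (n - m) z.2 - stat ν m z.1)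
      - 2 / n * inner ℝ z.1 z.2
  have hfm : Measurable f := by
    have := measurable_stat ν m
    have := measurable_stat ν (n - m)
    fun_prop
  have e : ∀ x : Fin n → E, (hatStat ν m B x - stat ν m (∑ b ∈ B, x b)) ^ 2
      = (f (∑ b ∈ B, x b, ∑ b ∈ Bᶜ, x b)) ^ 2 := fun x => by
    rw [hatStat_eq hm hmn hB]; congr 1; simp only [f]; ring
  set ω := convPow ν m
  set ω' := convPow ν (n - m)
  have hA : MemLp (fun z : E × E => (inner ℝ z.1 z.2 : ℝ)) 2 (ω.prod ω') :=
    (memLp_inner_prod (by linarith) (pB.memLp.mono_exponent (ofReal_two_mul_le h0))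
      (pC.memLp.mono_exponent (ofReal_two_mul_le h0))).mono_exponent le2
  have hB2 : MemLp (fun z : E × E => stat ν m z.1) 2 (ω.prod ω') :=
    ((memLp_stat pB.memLp m).mono_exponent le2).comp_measurePreserving measurePreserving_fst
  have hC2 : MemLp (fun z : E × E => stat ν (n - m) z.2) 2 (ω.prod ω') :=
    ((memLp_stat pC.memLp (n - m)).mono_exponent le2).comp_measurePreserving measurePreserving_snd
  have hf : MemLp f 2 (ω.prod ω') := ((hC2.sub hB2).const_mul _).sub (hA.const_mul _)
  simp_rw [e]
  have hl := lBC.integral_comp (f := fun z => f z ^ 2) (hfm.pow_const 2).aestronglyMeasurable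
  simp only [Function.comp_def] at hl
  refine ⟨?_, ?_⟩
  · have := hf.integrable_sq
    rw [← lBC.map_eq] at this
    exact this.comp_aemeasurable lBC.aemeasurable
  rw [hl]
  have pw : ∀ z, f z ^ 2 ≤ 3 * ((m : ℝ) / n) ^ 2 * (stat ν (n - m) z.2 ^ 2 + stat ν m z.1 ^ 2)
      + 12 / (n : ℝ) ^ 2 * (inner ℝ z.1 z.2) ^ 2 := by
    intro z
    simp only [f]
    set θ := (m : ℝ) / n
    set u := stat ν (n - m) z.2
    set v := stat ν m z.1
    have : 12 / (n : ℝ) ^ 2 * (inner ℝ z.1 z.2) ^ 2 = 3 * (2 / n * inner ℝ z.1 z.2) ^ 2 := by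
      ring
    rw [this]
    set w := 2 / (n : ℝ) * inner ℝ z.1 z.2
    nlinarith [sq_nonneg (θ * u + θ * v), sq_nonneg (θ * u + w), sq_nonneg (θ * v - w)]
  have j1 : Integrable (fun z : E × E => stat ν (n - m) z.2 ^ 2 + stat ν m z.1 ^ 2) (ω.prod ω') :=
    hC2.integrable_sq.add hB2.integrable_sq
  refine (integral_mono_of_nonneg (ae_of_all _ fun z => sq_nonneg _)
    ((j1.const_mul _).add (hA.integrable_sq.const_mul _)) (ae_of_all _ pw)).trans ?_
  simp only [Pi.add_apply]
  rw [integral_add (j1.const_mul _) (hA.integrable_sq.const_mul _), integral_const_mul,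
    integral_const_mul, integral_add hC2.integrable_sq hB2.integrable_sq,
    integral_fun_snd (fun z => stat ν (n - m) z ^ 2), integral_fun_fst (fun z => stat ν m z ^ 2)]
  simp only [probReal_univ, smul_eq_mul, one_mul]
  have eA : ∫ z : E × E, (inner ℝ z.1 z.2 : ℝ) ^ 2 ∂(ω.prod ω') = m * ((n - m : ℕ) : ℝ) := by
    rw [integral_prod _ hA.integrable_sq]
    simp_rw [pC.var, add_zero]
    rw [integral_const_mul]
    have : ∫ y, dirVar ν y ∂ω = m := by
      have hi := (memLp_inner_prod (by linarith : 0 < 2 + δ)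
        (pB.memLp.mono_exponent (ofReal_two_mul_le h0)) (hν.memLp' h0)).mono_exponent le2
      unfold dirVar
      rw [integral_integral_swap (f := fun y z : E => (inner ℝ y z : ℝ) ^ 2) hi.integrable_sq]
      simp_rw [real_inner_comm, pB.var, add_zero]
      rw [integral_const_mul, hunit, mul_one]
    rw [this, mul_comm]
  have s1 := integral_stat_sq_le h0 h1 hν hunit hm
  have s2 := integral_stat_sq_le h0 h1 hν hunit (by omega : 1 ≤ n - m)
  have hk0 : 0 ≤ ∫ y, (‖y‖ ^ 2 - sqMoment ν) ^ 2 ∂ν := integral_nonneg fun _ => sq_nonneg _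
  have hk' : (∫ y, (‖y‖ ^ 2 - sqMoment ν) ^ 2 ∂ν) / ((n - m : ℕ) : ℝ) ≤ 1 := by
    refine le_trans ?_ hk
    gcongr
    omega
  rw [eA, Nat.cast_sub (by omega)]
  set θ := (m : ℝ) / n with hθ
  have hθ0 : 0 ≤ θ := by positivity
  have hθ1 : θ ≤ 1 := by rw [hθ, div_le_one hn0]; linarith
  have t : 12 / (n : ℝ) ^ 2 * (m * (n - m)) ≤ 12 * θ := by
    rw [hθ, div_mul_eq_mul_div, mul_div_assoc', div_le_div_iff₀ (by positivity) hn0]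
    nlinarith [mul_pos hm0 hn0, mul_pos (mul_pos hm0 hm0) hn0]
  have t2 : 3 * θ ^ 2 * (∫ z, stat ν (n - m) z ^ 2 ∂ω' + ∫ z, stat ν m z ^ 2 ∂ω)
      ≤ 3 * θ ^ 2 * 12 := by
    refine mul_le_mul_of_nonneg_left ?_ (by positivity)
    linarith
  nlinarith

end Vector

/-! ### Averages of pairwise independent bounded variables -/

section Average

variable {Ω : Type*} [MeasurableSpace Ω] {P : Measure Ω} [IsProbabilityMeasure P]

lemma integral_average_sub_sq_le {L : ℕ} (hL : 1 ≤ L) {ξ : Fin L → Ω → ℝ}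
    (hm : ∀ j, AEStronglyMeasurable (ξ j) P) (h0 : ∀ j ω, 0 ≤ ξ j ω) (h1 : ∀ j ω, ξ j ω ≤ 1)
    (hi : Pairwise fun i j => IndepFun (ξ i) (ξ j) P) {c : ℝ} (hc : ∀ j, ∫ ω, ξ j ω ∂P = c) :
    ∫ ω, ((L : ℝ)⁻¹ * ∑ j, ξ j ω - c) ^ 2 ∂P ≤ (L : ℝ)⁻¹ := by
  have hL0 : (0 : ℝ) < L := by exact_mod_cast hL
  have hLp : ∀ j, MemLp (ξ j) 2 P := fun j =>
    MemLp.of_bound (hm j) 1 (ae_of_all _ fun ω => by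
      rw [Real.norm_eq_abs, abs_of_nonneg (h0 j ω)]; exact h1 j ω)
  have hv : ∀ j, Var[ξ j; P] ≤ 1 := fun j => by
    rw [variance_eq_sub (hLp j)]
    have : ∫ ω, (ξ j ^ 2) ω ∂P ≤ ∫ _, (1 : ℝ) ∂P :=
      integral_mono (hLp j).integrable_sq (integrable_const _) fun ω =>
        pow_le_one₀ (h0 j ω) (h1 j ω)
    simp only [integral_const, probReal_univ, smul_eq_mul, mul_one] at this
    have := sq_nonneg (∫ ω, ξ j ω ∂P)
    linarith
  have hsum : MemLp (fun ω => ∑ j, ξ j ω) 2 P := memLp_finsetSum _ fun j _ => hLp j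
  have hvar : Var[∑ j, ξ j; P] ≤ L := by
    rw [IndepFun.variance_sum (fun j _ => hLp j) (fun i _ j _ hij => hi hij)]
    refine (Finset.sum_le_sum fun j _ => hv j).trans (le_of_eq ?_)
    simp
  have hmean : ∫ ω, (∑ j, ξ j) ω ∂P = L * c := by
    simp only [Finset.sum_apply]
    rw [integral_finsetSum _ fun j _ => (hLp j).integrable (by norm_num)]
    simp [hc]
  have e : ∀ ω, ((L : ℝ)⁻¹ * ∑ j, ξ j ω - c) ^ 2 = ((L : ℝ)⁻¹) ^ 2 * ((∑ j, ξ j) ω - L * c) ^ 2 :=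
    fun ω => by
      rw [← mul_pow, Finset.sum_apply]; congr 1; field_simp
  simp_rw [e]
  rw [integral_const_mul]
  have := variance_eq_integral (X := ∑ j, ξ j) (μ := P) (by
    exact (Finset.aestronglyMeasurable_sum _ fun j _ => hm j).aemeasurable)
  rw [hmean] at this
  rw [← this]
  calc ((L : ℝ)⁻¹) ^ 2 * Var[∑ j, ξ j; P] ≤ ((L : ℝ)⁻¹) ^ 2 * L := by gcongr
    _ = _ := by field_simp

lemma integral_abs_le_sqrt {X : Ω → ℝ} (hX : MemLp X 2 P) {v : ℝ}
    (h : ∫ ω, X ω ^ 2 ∂P ≤ v) : ∫ ω, |X ω| ∂P ≤ √v := by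
  have hX' : MemLp (fun ω => |X ω|) 2 P := hX.abs
  have hv := variance_nonneg (fun ω => |X ω|) P
  rw [variance_eq_sub hX'] at hv
  have : ∫ ω, ((fun ω => |X ω|) ^ 2) ω ∂P = ∫ ω, X ω ^ 2 ∂P := by
    congr 1; ext ω; simp
  rw [this] at hv
  exact Real.le_sqrt_of_sq_le (by linarith)

end Average

/-! ### From pointwise to uniform bounds for distribution functions -/

/-- The uniform distance between two distribution functions is controlled on a finite grid. -/
lemma abs_sub_le_of_grid {F G : ℝ → ℝ} (hF : Monotone F) (hG : Monotone G)
    (hF0 : ∀ u, 0 ≤ F u) (hF1 : ∀ u, F u ≤ 1) (hG0 : ∀ u, 0 ≤ G u) (hG1 : ∀ u, G u ≤ 1)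
    {η ε T : ℝ} (hε : 0 < ε) (hη : 0 ≤ η) (hmod : ∀ u, G (u + ε) ≤ G u + η)
    (hl : G (-T) ≤ η) (hr : 1 - η ≤ G T) {N : ℕ} (hN : 2 * T ≤ N * ε)
    (h : ∀ k ∈ Finset.range (N + 1), |F (-T + k * ε) - G (-T + k * ε)| ≤ η) (u : ℝ) :
    |F u - G u| ≤ 2 * η := by
  have h' : ∀ k ≤ N, |F (-T + k * ε) - G (-T + k * ε)| ≤ η := fun k hk =>
    h k (Finset.mem_range.2 (by omega))
  rcases lt_or_ge u (-T) with hu | hu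
  · have a := h' 0 (by omega)
    simp only [Nat.cast_zero, zero_mul, add_zero] at a
    have b := hF hu.le
    have c := hG hu.le
    have d := hF0 u
    have e := hG0 u
    rw [abs_le] at a ⊢
    constructor <;> linarith [a.1, a.2]
  rcases lt_or_ge u (-T + N * ε) with hu' | hu'
  -- Inside the grid, `u` lies between two neighbouring points. Monotonicity of both functions and
  -- the modulus of `G` over one step cost one further `η`.
  · set k := ⌊(u + T) / ε⌋₊ with hk
    have hk0 : 0 ≤ (u + T) / ε := div_nonneg (by linarith) hε.le
    have k1 : (k : ℝ) * ε ≤ u + T := (le_div_iff₀ hε).1 (Nat.floor_le hk0)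
    have k2 : u + T < (k + 1) * ε := (div_lt_iff₀ hε).1 (Nat.lt_floor_add_one _)
    have kN : k < N := by
      have : (k : ℝ) * ε < N * ε := by linarith
      exact_mod_cast lt_of_mul_lt_mul_right this hε.le
    have a := h' k kN.le
    have b := h' (k + 1) kN
    push_cast at b
    have c := hmod (-T + k * ε)
    rw [show -T + k * ε + ε = -T + ((k : ℝ) + 1) * ε by ring] at c
    have m1 := hF (by linarith : -T + k * ε ≤ u)
    have m2 := hF (by linarith : u ≤ -T + ((k : ℝ) + 1) * ε)
    have m3 := hG (by linarith : -T + k * ε ≤ u)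
    have m4 := hG (by linarith : u ≤ -T + ((k : ℝ) + 1) * ε)
    rw [abs_le] at a b ⊢
    constructor <;> linarith [a.1, a.2, b.1, b.2]
  · have a := h' N le_rfl
    have b := hF hu'
    have c := hG hu'
    have d := hF1 u
    have e := hG1 u
    have f := hG (by linarith : T ≤ -T + N * ε)
    rw [abs_le] at a ⊢
    constructor <;> linarith [a.1, a.2]

/-- Markov's inequality at the `N + 1` grid points and a union bound. The event is stated with `∃ u`
and bounded by monotonicity of the outer measure, so no measurability of a supremum is needed. -/
lemma measure_exists_abs_sub_gt_le {Ω : Type*} [MeasurableSpace Ω] {P : Measure Ω}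
    [IsProbabilityMeasure P] {Φ : Ω → ℝ → ℝ} {G : ℝ → ℝ} (hm : ∀ u, Measurable fun ω => Φ ω u)
    (hF : ∀ ω, Monotone (Φ ω)) (hG : Monotone G)
    (hF0 : ∀ ω u, 0 ≤ Φ ω u) (hF1 : ∀ ω u, Φ ω u ≤ 1) (hG0 : ∀ u, 0 ≤ G u) (hG1 : ∀ u, G u ≤ 1)
    {η ε T η' : ℝ} (hε : 0 < ε) (hη : 0 < η) (hmod : ∀ u, G (u + ε) ≤ G u + η)
    (hl : G (-T) ≤ η) (hr : 1 - η ≤ G T) {N : ℕ} (hN : 2 * T ≤ N * ε)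
    (h : ∀ u, ∫ ω, |Φ ω u - G u| ∂P ≤ η') :
    P {ω | ∃ u, 2 * η < |Φ ω u - G u|} ≤ ENNReal.ofReal ((N + 1) * (η' / η)) := by
  have hsub : {ω | ∃ u, 2 * η < |Φ ω u - G u|} ⊆
      ⋃ k ∈ Finset.range (N + 1), {ω | η ≤ |Φ ω (-T + k * ε) - G (-T + k * ε)|} := by
    intro ω hω
    obtain ⟨u, hu⟩ := hω
    by_contra hcon
    simp only [Set.mem_iUnion, not_exists] at hcon
    refine absurd (abs_sub_le_of_grid (hF ω) hG (hF0 ω) (hF1 ω) hG0 hG1 hε hη.le hmod hl hr hN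
      (fun k hk => ?_) u) (not_le.2 hu)
    exact (lt_of_not_ge (hcon k hk)).le
  have hone : ∀ u, P {ω | η ≤ |Φ ω u - G u|} ≤ ENNReal.ofReal (η' / η) := by
    intro u
    have hi : Integrable (fun ω => |Φ ω u - G u|) P := by
      refine (Integrable.of_bound (C := 1) ((hm u).sub_const _).aestronglyMeasurable
        (ae_of_all _ fun ω => ?_)).abs
      rw [Real.norm_eq_abs, abs_le]
      have := hF0 ω u
      have := hF1 ω u
      have := hG0 u
      have := hG1 u
      constructor <;> linarith
    have := mul_meas_ge_le_integral_of_nonneg (ae_of_all _ fun ω => abs_nonneg (Φ ω u - G u)) hi η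
    rw [← ofReal_measureReal (by finiteness)]
    refine ENNReal.ofReal_le_ofReal ?_
    rw [le_div_iff₀ hη, mul_comm]
    exact this.trans (h u)
  calc P {ω | ∃ u, 2 * η < |Φ ω u - G u|}
      ≤ P (⋃ k ∈ Finset.range (N + 1), {ω | η ≤ |Φ ω (-T + k * ε) - G (-T + k * ε)|}) :=
        measure_mono hsub
    _ ≤ ∑ k ∈ Finset.range (N + 1), P {ω | η ≤ |Φ ω (-T + k * ε) - G (-T + k * ε)|} :=
        measure_biUnion_finset_le _ _
    _ ≤ ∑ k ∈ Finset.range (N + 1), ENNReal.ofReal (η' / η) :=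
        Finset.sum_le_sum fun k _ => hone _
    _ = _ := by
        rw [Finset.sum_const, Finset.card_range, nsmul_eq_mul,
          ENNReal.ofReal_mul (by positivity)]
        congr 1
        rw [show (N : ℝ) + 1 = ((N + 1 : ℕ) : ℝ) by push_cast; rfl, ENNReal.ofReal_natCast]

/-! ### The subsampling distribution function of the normalised statistic -/

/-- The indicator of `v ≤ u`. -/
def below (u v : ℝ) : ℝ := if v ≤ u then 1 else 0

lemma below_nonneg (u v : ℝ) : 0 ≤ below u v := by unfold below; split_ifs <;> norm_num

lemma below_le_one (u v : ℝ) : below u v ≤ 1 := by unfold below; split_ifs <;> norm_num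

lemma monotone_below (v : ℝ) : Monotone fun u => below u v := by
  intro a b hab
  simp only [below]
  split_ifs with h1 h2
  · exact le_rfl
  · exact absurd (h1.trans hab) h2
  · exact zero_le_one
  · exact le_rfl

lemma measurable_below (u : ℝ) : Measurable (below u) :=
  Measurable.ite measurableSet_Iic measurable_const measurable_const

lemma integral_below {Ω : Type*} [MeasurableSpace Ω] {P : Measure Ω} {f : Ω → ℝ}
    (hf : Measurable f) (u : ℝ) : ∫ ω, below u (f ω) ∂P = P.real {ω | f ω ≤ u} := by
  rw [← integral_indicator_one (measurableSet_le hf measurable_const)]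
  rfl

/-- A pointwise Chebyshev inequality: if `r' ≤ u` but `r > u + ε`, then `(r' - r)²/ε²` exceeds one.
It transfers mean square closeness of statistics to averages of indicators, without any
independence. -/
lemma below_le_below_add {ε : ℝ} (hε : 0 < ε) (u r r' : ℝ) :
    below u r' ≤ below (u + ε) r + (r' - r) ^ 2 / ε ^ 2 := by
  have h0 : 0 ≤ (r' - r) ^ 2 / ε ^ 2 := by positivity
  rcases le_or_gt r (u + ε) with h | h
  · have := below_le_one u r'
    rw [show below (u + ε) r = 1 from if_pos h]
    linarith
  · have h1 := below_nonneg (u + ε) r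
    rcases le_or_gt r' u with h' | h'
    · have : 1 ≤ (r' - r) ^ 2 / ε ^ 2 := by
        rw [one_le_div (by positivity)]
        nlinarith
      linarith [below_le_one u r']
    · rw [show below u r' = 0 from if_neg (not_le.2 h')]
      linarith

section Vector

variable {p : ℕ}

local notation "E" => EuclideanSpace ℝ (Fin p)

variable {n : ℕ} {ν γ : Measure (EuclideanSpace ℝ (Fin p))}

/-- The empirical distribution function of the normalised statistic over the index sets `B j`. -/
def subDF (ν : Measure E) (m : ℕ) {N : ℕ} (B : Fin N → Finset (Fin n)) (x : Fin n → E) (u : ℝ) :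
    ℝ := (N : ℝ)⁻¹ * ∑ j, below u (hatStat ν m (B j) x)

lemma average_nonneg {N : ℕ} {f : Fin N → ℝ} (h : ∀ j, 0 ≤ f j) : 0 ≤ (N : ℝ)⁻¹ * ∑ j, f j :=
  mul_nonneg (by positivity) (Finset.sum_nonneg fun j _ => h j)

lemma average_le {N : ℕ} {f : Fin N → ℝ} {c : ℝ} (hc : 0 ≤ c) (h : ∀ j, f j ≤ c) :
    (N : ℝ)⁻¹ * ∑ j, f j ≤ c := by
  rcases Nat.eq_zero_or_pos N with rfl | hN
  · simpa using hc
  have hN0 : (0 : ℝ) < N := by exact_mod_cast hN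
  calc (N : ℝ)⁻¹ * ∑ j, f j ≤ (N : ℝ)⁻¹ * ∑ _j : Fin N, c := by gcongr with j; exact h j
    _ = c := by simp; field_simp

lemma subDF_nonneg (m : ℕ) {N : ℕ} (B : Fin N → Finset (Fin n)) (x : Fin n → E) (u : ℝ) :
    0 ≤ subDF ν m B x u := average_nonneg fun _ => below_nonneg _ _

lemma subDF_le_one (m : ℕ) {N : ℕ} (B : Fin N → Finset (Fin n)) (x : Fin n → E) (u : ℝ) :
    subDF ν m B x u ≤ 1 := average_le zero_le_one fun _ => below_le_one _ _

lemma monotone_subDF (m : ℕ) {N : ℕ} (B : Fin N → Finset (Fin n)) (x : Fin n → E) :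
    Monotone (subDF ν m B x) := fun a b hab => by
  unfold subDF
  gcongr with j
  exact monotone_below _ hab

lemma measurable_subDF (m : ℕ) {N : ℕ} (B : Fin N → Finset (Fin n)) (u : ℝ) :
    Measurable fun x => subDF ν m B x u :=
  (Finset.measurable_sum _ fun j _ =>
    (measurable_below u).comp (measurable_hatStat m (B j))).const_mul _

/-- The function is sandwiched between the empirical functions `A` of the independent uncentred
statistics at `u ± ε`. The three error terms are the fluctuations of `A` at these two points, the
effect of centring at the sample mean, and `F` against `G` together with the shift of `G` by `ε`. -/
lemma integral_subDF_sub_le {δ : ℝ} (h0 : 0 < δ) (h1 : δ ≤ 1) (hν : SameCov δ ν ν)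
    (hunit : ∫ y, dirVar ν y ∂ν = 1) {m : ℕ} (hm : 1 ≤ m) (hmn : 2 * m ≤ n)
    (hk : (∫ y, (‖y‖ ^ 2 - sqMoment ν) ^ 2 ∂ν) / m ≤ 1) {L : ℕ} (hL : 1 ≤ L)
    {B : Fin L → Finset (Fin n)} (hB : ∀ j, (B j).card = m)
    (hd : Pairwise fun i j => Disjoint (B i) (B j)) {G : ℝ → ℝ} {ε η : ℝ} (hε : 0 < ε)
    (hG : ∀ v, G (v + ε) ≤ G v + η)
    (hF : ∀ v, |(convPow ν m).real {w | stat ν m w ≤ v} - G v| ≤ η) (u : ℝ) :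
    ∫ x, |subDF ν m B x u - G u| ∂(sampleLaw n ν)
      ≤ 2 * √((L : ℝ)⁻¹) + 48 * ((m : ℝ) / n) / ε ^ 2 + 2 * η := by
  have := hν.prob
  set F : ℝ → ℝ := fun v => (convPow ν m).real {w | stat ν m w ≤ v} with hFdef
  let R : Fin L → (Fin n → E) → ℝ := fun j x => stat ν m (∑ b ∈ B j, x b)
  have hR : ∀ j, Measurable (R j) := fun j => (measurable_stat ν m).comp (by fun_prop)
  let A : ℝ → (Fin n → E) → ℝ := fun v x => (L : ℝ)⁻¹ * ∑ j, below v (R j x)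
  have hAm : ∀ v, Measurable (A v) := fun v =>
    (Finset.measurable_sum _ fun j _ => (measurable_below v).comp (hR j)).const_mul _
  have hF0 : ∀ v, 0 ≤ F v := fun v => measureReal_nonneg
  have hF1 : ∀ v, F v ≤ 1 := fun v => measureReal_le_one
  have hAF : ∀ v x, |A v x - F v| ≤ 1 := fun v x => by
    have a0 : 0 ≤ A v x := average_nonneg fun _ => below_nonneg _ _
    have a1 : A v x ≤ 1 := average_le zero_le_one fun _ => below_le_one _ _
    rw [abs_le]
    constructor <;> linarith [hF0 v, hF1 v]
  have hAL : ∀ v, MemLp (fun x => A v x - F v) 2 (sampleLaw n ν) := fun v =>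
    MemLp.of_bound ((hAm v).sub_const _).aestronglyMeasurable 1 (ae_of_all _ fun x => hAF v x)
  have hA : ∀ v, ∫ x, |A v x - F v| ∂(sampleLaw n ν) ≤ √((L : ℝ)⁻¹) := by
    intro v
    refine integral_abs_le_sqrt (hAL v) ?_
    refine integral_average_sub_sq_le hL
      (fun j => ((measurable_below v).comp (hR j)).aestronglyMeasurable)
      (fun j x => below_nonneg _ _) (fun j x => below_le_one _ _) (fun i j hij => ?_) (fun j => ?_)
    · have hg : Measurable fun w : E => below v (stat ν m w) :=
        (measurable_below v).comp (measurable_stat ν m)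
      exact (indepFun_sum_sampleLaw (hd hij)).comp hg hg
    · have hl := hasLaw_sum_sampleLaw (ν := ν) (B j)
      rw [hB j] at hl
      have := hl.integral_comp (f := fun w => below v (stat ν m w))
        ((measurable_below v).comp (measurable_stat ν m)).aestronglyMeasurable
      simp only [Function.comp_def] at this
      simp only [R, Function.comp_def]
      rw [this, integral_below (measurable_stat ν m)]
  let q : (Fin n → E) → ℝ := fun x =>
    (L : ℝ)⁻¹ * ∑ j, (hatStat ν m (B j) x - R j x) ^ 2 / ε ^ 2
  have hqj : ∀ j, Integrable (fun x => (hatStat ν m (B j) x - R j x) ^ 2 / ε ^ 2) (sampleLaw n ν) :=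
    fun j => (integral_hatStat_sub_sq_le h0 h1 hν hunit hm hmn hk (hB j)).1.div_const _
  have hqi : Integrable q (sampleLaw n ν) :=
    (integrable_finsetSum _ fun j _ => hqj j).const_mul _
  have hq : ∫ x, q x ∂(sampleLaw n ν) ≤ 48 * ((m : ℝ) / n) / ε ^ 2 := by
    simp only [q]
    rw [integral_const_mul, integral_finsetSum _ fun j _ => hqj j]
    refine average_le (by positivity) fun j => ?_
    rw [integral_div]
    gcongr
    exact (integral_hatStat_sub_sq_le h0 h1 hν hunit hm hmn hk (hB j)).2
  have hup : ∀ x, subDF ν m B x u ≤ A (u + ε) x + q x := fun x => by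
    simp only [subDF, A, q, ← mul_add, ← Finset.sum_add_distrib]
    gcongr with j
    exact below_le_below_add hε _ _ _
  have hlo : ∀ x, A (u - ε) x ≤ subDF ν m B x u + q x := fun x => by
    simp only [subDF, A, q, ← mul_add, ← Finset.sum_add_distrib]
    gcongr with j
    have := below_le_below_add hε (u - ε) (hatStat ν m (B j) x) (R j x)
    rwa [sub_add_cancel, ← neg_sub (hatStat ν m (B j) x), neg_sq] at this
  have i1 : Integrable (fun x => |A (u + ε) x - F (u + ε)|) (sampleLaw n ν) :=
    ((hAL _).integrable (by norm_num)).abs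
  have i2 : Integrable (fun x => |A (u - ε) x - F (u - ε)|) (sampleLaw n ν) :=
    ((hAL _).integrable (by norm_num)).abs
  have i12 : Integrable (fun x => |A (u + ε) x - F (u + ε)| + |A (u - ε) x - F (u - ε)|)
    (sampleLaw n ν) := i1.add i2
  have i3 : Integrable (fun x => q x + 2 * η) (sampleLaw n ν) := hqi.add (integrable_const _)
  have pw : ∀ x, |subDF ν m B x u - G u| ≤ (|A (u + ε) x - F (u + ε)| + |A (u - ε) x - F (u - ε)|)
      + (q x + 2 * η) := fun x => by
    have a1 := (abs_le.1 (hF (u + ε))).2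
    have a2 := (abs_le.1 (hF (u - ε))).1
    have b1 := hG u
    have b2 := hG (u - ε)
    rw [sub_add_cancel] at b2
    have c1 := le_abs_self (A (u + ε) x - F (u + ε))
    have c2 := neg_abs_le (A (u - ε) x - F (u - ε))
    have d1 := abs_nonneg (A (u + ε) x - F (u + ε))
    have d2 := abs_nonneg (A (u - ε) x - F (u - ε))
    have e1 := hup x
    have e2 := hlo x
    have f : 0 ≤ q x := average_nonneg fun _ => by positivity
    change F (u + ε) - G (u + ε) ≤ η at a1
    change -η ≤ F (u - ε) - G (u - ε) at a2
    rw [abs_le]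
    constructor <;> linarith
  refine (integral_mono_of_nonneg (ae_of_all _ fun x => abs_nonneg _) (i12.add i3)
    (ae_of_all _ pw)).trans ?_
  simp only [Pi.add_apply]
  rw [integral_add i12 i3, integral_add i1 i2, integral_add hqi (integrable_const _)]
  simp only [integral_const, probReal_univ, smul_eq_mul, one_mul]
  have := hA (u + ε)
  have := hA (u - ε)
  linarith

lemma monotone_gaussDF [IsProbabilityMeasure γ] : Monotone (gaussDF ν γ) := fun _ _ hab =>
  measureReal_mono (fun _ hz => le_trans hz hab)

end Vector

/-! ### Bounds with thresholds independent of the dimension and the law. -/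

lemma SmallMoments.mono {δ κ κ' : ℝ} {p s : ℕ} {ν : Measure (EuclideanSpace ℝ (Fin p))}
    (h : SmallMoments δ κ s ν) (hκ : κ ≤ κ') : SmallMoments δ κ' s ν :=
  ⟨h.pos, h.size.trans hκ, h.quad2.trans hκ, h.quad.trans hκ, h.form.trans hκ, h.cross.trans hκ⟩

/-- The distribution function over disjoint index sets is pointwise close to that of the Gaussian
quadratic form. -/
lemma exists_integral_subDF_le {δ : ℝ} (h0 : 0 < δ) (h1 : δ ≤ 1) {η : ℝ} (hη : 0 < η) :
    ∃ κ > 0, ∀ {p n m : ℕ} {ν γ : Measure (EuclideanSpace ℝ (Fin p))}, SameCov δ ν ν →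
      ∫ y, dirVar ν y ∂ν = 1 → GaussianMatch δ ν γ → SmallMoments δ κ m ν → 2 * m ≤ n →
      (m : ℝ) / n ≤ κ → ∀ {L : ℕ}, 1 ≤ L → (L : ℝ)⁻¹ ≤ κ → ∀ {B : Fin L → Finset (Fin n)},
      (∀ j, (B j).card = m) → (Pairwise fun i j => Disjoint (B i) (B j)) → ∀ u,
      ∫ x, |subDF ν m B x u - gaussDF ν γ u| ∂(sampleLaw n ν) ≤ η := by
  have hη8 : 0 < η / 8 := by positivity
  obtain ⟨κ₀, hκ₀, hkol⟩ := exists_kolmogorov_bound h0 h1 hη8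
  obtain ⟨ε, hε, hchi⟩ := exists_chiModulus_le hη8
  refine ⟨min (min 1 κ₀) (min ((η / 8) ^ 2) (η / 8 * ε ^ 2 / 48)), by positivity, ?_⟩
  intro p n m ν γ hν hunit hγ hsm hmn hr L hL hL' B hB hd u
  set κ := min (min 1 κ₀) (min ((η / 8) ^ 2) (η / 8 * ε ^ 2 / 48))
  have k1 : κ ≤ 1 := (min_le_left _ _).trans (min_le_left _ _)
  have k2 : κ ≤ κ₀ := (min_le_left _ _).trans (min_le_right _ _)
  have k3 : κ ≤ (η / 8) ^ 2 := (min_le_right _ _).trans (min_le_left _ _)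
  have k4 : κ ≤ η / 8 * ε ^ 2 / 48 := (min_le_right _ _).trans (min_le_right _ _)
  refine (integral_subDF_sub_le h0 h1 hν hunit hsm.pos hmn (hsm.quad2.trans k1) hL hB hd hε
    (fun v => (hγ.gaussDF_add_le hε v).trans (by linarith))
    (hkol hν hunit hγ (hsm.mono k2)) u).trans ?_
  have a1 : √((L : ℝ)⁻¹) ≤ η / 8 := Real.sqrt_le_iff.2 ⟨by positivity, hL'.trans k3⟩
  have a2 : 48 * ((m : ℝ) / n) / ε ^ 2 ≤ η / 8 := by
    rw [div_le_iff₀ (by positivity)]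
    have := hr.trans k4
    linarith
  linarith

/-- A random distribution function that is pointwise close to that of the Gaussian quadratic form
is uniformly close to it. -/
lemma exists_measure_sup_le {δ : ℝ} (h0 : 0 < δ) (h1 : δ ≤ 1) {η : ℝ} (hη : 0 < η) :
    ∃ κ > 0, ∀ {p m : ℕ} {ν γ : Measure (EuclideanSpace ℝ (Fin p))}, SameCov δ ν ν →
      ∫ y, dirVar ν y ∂ν = 1 → GaussianMatch δ ν γ → SmallMoments δ κ m ν →
      ∀ {Ω : Type} [MeasurableSpace Ω] {P : Measure Ω} [IsProbabilityMeasure P] {Φ : Ω → ℝ → ℝ},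
      (∀ u, Measurable fun ω => Φ ω u) → (∀ ω, Monotone (Φ ω)) → (∀ ω u, 0 ≤ Φ ω u) →
      (∀ ω u, Φ ω u ≤ 1) → (∀ u, ∫ ω, |Φ ω u - gaussDF ν γ u| ∂P ≤ κ) →
      P {ω | ∃ u, 2 * η < |Φ ω u - gaussDF ν γ u|} ≤ ENNReal.ofReal η := by
  have hη2 : 0 < η / 2 := by positivity
  obtain ⟨κ₀, hκ₀, hkol⟩ := exists_kolmogorov_bound h0 h1 hη2
  obtain ⟨ε, hε, hchi⟩ := exists_chiModulus_le hη
  set T := √(12 / η) with hT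
  have hT0 : 0 < T := Real.sqrt_pos.2 (by positivity)
  -- The statistic has second moment at most `6`, so by Chebyshev it exceeds `T` in modulus with
  -- probability at most `6/T² = η/2`. The Kolmogorov bound passes this tail to the Gaussian
  -- function at the cost of another `η/2`.
  have hT2 : T ^ 2 = 12 / η := Real.sq_sqrt (by positivity)
  obtain ⟨N, hN⟩ := exists_nat_ge (2 * T / ε)
  rw [div_le_iff₀ hε] at hN
  -- The last entry makes the union bound `(N + 1) κ / η` at most `η`; `N` is fixed before the law
  -- and the dimension are introduced.
  refine ⟨min (min 1 κ₀) (η ^ 2 / (N + 1)), by positivity, ?_⟩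
  intro p m ν γ hν hunit hγ hsm Ω _ P _ Φ hm hmono hΦ0 hΦ1 hΦ
  have := hν.prob
  have := hγ.same.prob
  set κ := min (min 1 κ₀) (η ^ 2 / (N + 1))
  have k1 : κ ≤ 1 := (min_le_left _ _).trans (min_le_left _ _)
  have k2 : κ ≤ κ₀ := (min_le_left _ _).trans (min_le_right _ _)
  have k3 : κ ≤ η ^ 2 / (N + 1) := min_le_right _ _
  have hF := hkol hν hunit hγ (hsm.mono k2)
  have hpart := partialSum_convPow_self h0 h1 hν m
  have hs2 : ∫ w, stat ν m w ^ 2 ∂(convPow ν m) ≤ 6 :=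
    (integral_stat_sq_le h0 h1 hν hunit hsm.pos).trans (by linarith [hsm.quad2.trans k1])
  have hcheb : (convPow ν m).real {w | T ^ 2 ≤ stat ν m w ^ 2} ≤ η / 2 := by
    have hi : Integrable (fun w => stat ν m w ^ 2) (convPow ν m) :=
      ((memLp_stat hpart.memLp m).mono_exponent (two_le_ofReal (by linarith))).integrable_sq
    have := mul_meas_ge_le_integral_of_nonneg (ae_of_all _ fun w => sq_nonneg (stat ν m w)) hi
      (T ^ 2)
    have h3 := this.trans hs2
    rw [hT2] at h3 ⊢
    rw [div_mul_eq_mul_div, div_le_iff₀ hη] at h3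
    linarith
  have hl : gaussDF ν γ (-T) ≤ η := by
    have a := (abs_le.1 (hF (-T))).1
    have b : (convPow ν m).real {w | stat ν m w ≤ -T} ≤ η / 2 := by
      refine le_trans (measureReal_mono fun w hw => ?_) hcheb
      simp only [Set.mem_ofPred_eq] at hw ⊢
      nlinarith
    linarith
  have hr : 1 - η ≤ gaussDF ν γ T := by
    have a := (abs_le.1 (hF T)).2
    have b : 1 - (convPow ν m).real {w | stat ν m w ≤ T} ≤ η / 2 := by
      rw [← probReal_compl_eq_one_sub (measurableSet_le (measurable_stat ν m) measurable_const)]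
      refine le_trans (measureReal_mono fun w hw => ?_) hcheb
      simp only [Set.mem_ofPred_eq, Set.mem_compl_iff, not_le] at hw ⊢
      nlinarith
    linarith
  refine (measure_exists_abs_sub_gt_le hm hmono monotone_gaussDF hΦ0 hΦ1
    (fun u => measureReal_nonneg) (fun u => measureReal_le_one) hε hη
    (fun u => (hγ.gaussDF_add_le hε u).trans (by linarith)) hl hr hN hΦ).trans ?_
  refine ENNReal.ofReal_le_ofReal ?_
  rw [le_div_iff₀ (by positivity)] at k3
  rw [mul_div_assoc', div_le_iff₀ hη]
  linarith

/-! ### Averages over all subsets of a given size -/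

lemma exists_perm_map_eq {α : Type*} [Fintype α] [DecidableEq α] {B S : Finset α}
    (h : B.card = S.card) : ∃ τ : Equiv.Perm α, B.map τ.toEmbedding = S := by
  let e : {x // x ∈ B} ≃ {x // x ∈ S} := Finset.equivOfCardEq h
  refine ⟨e.extendSubtype, Finset.eq_of_subset_of_card_le (fun y hy => ?_) (by simp [h])⟩
  obtain ⟨x, hx, rfl⟩ := Finset.mem_map.1 hy
  exact e.extendSubtype_mem x hx

/-- Evaluate `∑_S ∑_σ g(σ S)` in two ways: the sum over `σ` does not depend on `S`, since
permutations act transitively on subsets of a given size, and the sum over `S` does not depend on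
`σ`. -/
lemma perm_average_eq {α : Type*} [Fintype α] [DecidableEq α] (g : Finset α → ℝ) (B : Finset α) :
    ((Fintype.card (Equiv.Perm α) : ℝ))⁻¹ * ∑ σ : Equiv.Perm α, g (B.map σ.toEmbedding)
      = (((Finset.powersetCard B.card (Finset.univ : Finset α)).card : ℝ))⁻¹
        * ∑ S ∈ Finset.powersetCard B.card Finset.univ, g S := by
  set s : Finset (Finset α) := Finset.powersetCard B.card Finset.univ with hs
  have hBs : B ∈ s := Finset.mem_powersetCard.2 ⟨Finset.subset_univ _, rfl⟩
  have hs0 : (s.card : ℝ) ≠ 0 := by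
    exact_mod_cast (Finset.card_pos.2 ⟨B, hBs⟩).ne'
  have hp0 : (Fintype.card (Equiv.Perm α) : ℝ) ≠ 0 := by exact_mod_cast Fintype.card_ne_zero
  have hT : ∀ S ∈ s, ∑ σ : Equiv.Perm α, g (S.map σ.toEmbedding)
      = ∑ σ : Equiv.Perm α, g (B.map σ.toEmbedding) := by
    intro S hS
    obtain ⟨τ, rfl⟩ := exists_perm_map_eq (Finset.mem_powersetCard.1 hS).2.symm
    refine Fintype.sum_equiv (Equiv.mulRight τ) _ _ fun σ => ?_
    rw [Finset.map_map]
    rfl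
  have hS : ∀ σ : Equiv.Perm α, ∑ S ∈ s, g (S.map σ.toEmbedding) = ∑ S ∈ s, g S := fun σ =>
    Finset.sum_equiv σ.finsetCongr (fun S => by simp [hs, Finset.mem_powersetCard])
      fun S _ => rfl
  have key := Finset.sum_congr rfl hT
  rw [Finset.sum_comm, Finset.sum_congr rfl fun σ _ => hS σ] at key
  simp only [Finset.sum_const, Finset.card_univ, nsmul_eq_mul] at key
  field_simp
  linarith

/-- The uniform distribution on the subsets of size `m`. -/
def subsetLaw (n m : ℕ) : Measure (Finset (Fin n)) :=
  uniformOn {S : Finset (Fin n) | S.card = m}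

lemma subsetLaw_eq (n m : ℕ) :
    subsetLaw n m = uniformOn ↑(Finset.powersetCard m (Finset.univ : Finset (Fin n))) := by
  rw [subsetLaw]
  congr 1
  ext S
  simp [Finset.mem_powersetCard]

lemma isProbabilityMeasure_subsetLaw {n m : ℕ} (h : m ≤ n) :
    IsProbabilityMeasure (subsetLaw n m) := by
  rw [subsetLaw_eq]
  refine isProbabilityMeasure_uniformOn (Finset.finite_toSet _) ?_
  rw [Finset.coe_nonempty, Finset.powersetCard_nonempty]
  simpa using h

lemma ae_card_subsetLaw (n m : ℕ) : ∀ᵐ S ∂(subsetLaw n m), S.card = m := by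
  rw [subsetLaw, uniformOn]
  exact ae_cond_mem (Set.toFinite _).measurableSet

lemma integral_subsetLaw (n m : ℕ) (g : Finset (Fin n) → ℝ) :
    ∫ S, g S ∂(subsetLaw n m)
      = (((Finset.powersetCard m (Finset.univ : Finset (Fin n))).card : ℝ))⁻¹
        * ∑ S ∈ Finset.powersetCard m Finset.univ, g S := by
  rw [subsetLaw_eq, uniformOn, ProbabilityTheory.cond, integral_smul_measure,
    setIntegral_finset _ Integrable.of_finite]
  simp [Measure.real]

section Vector

variable {p : ℕ}

local notation "E" => EuclideanSpace ℝ (Fin p)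

variable {n : ℕ} {ν : Measure (EuclideanSpace ℝ (Fin p))}

/-- Hoeffding's device for U-statistics: under a uniform permutation each block becomes a uniform
subset of size `m`, so a complete average over overlapping subsets is an average of averages over
disjoint ones. -/
lemma integral_subsetLaw_eq_perm_average {m L : ℕ} (hL : 1 ≤ L) {B : Fin L → Finset (Fin n)}
    (hB : ∀ j, (B j).card = m) (x : Fin n → E) (u : ℝ) :
    ∫ S, below u (hatStat ν m S x) ∂(subsetLaw n m)
      = ((Fintype.card (Equiv.Perm (Fin n)) : ℝ))⁻¹ * ∑ σ : Equiv.Perm (Fin n),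
        subDF ν m (fun j => (B j).map σ.toEmbedding) x u := by
  have hL0 : (L : ℝ) ≠ 0 := by exact_mod_cast (by omega : L ≠ 0)
  have h : ∀ j, ((Fintype.card (Equiv.Perm (Fin n)) : ℝ))⁻¹ * ∑ σ : Equiv.Perm (Fin n),
      below u (hatStat ν m ((B j).map σ.toEmbedding) x)
      = ∫ S, below u (hatStat ν m S x) ∂(subsetLaw n m) := fun j => by
    rw [perm_average_eq (fun S => below u (hatStat ν m S x)) (B j), integral_subsetLaw, hB]
  simp only [subDF]
  rw [← Finset.mul_sum, Finset.sum_comm, mul_left_comm, Finset.mul_sum]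
  simp_rw [h]
  simp
  field_simp

/-- The average over all subsets of size `m` is as close to `G` as averages over disjoint
subsets. -/
lemma integral_abs_average_sub_le [IsProbabilityMeasure ν] {m L : ℕ} (hL : 1 ≤ L)
    {B : Fin L → Finset (Fin n)} (hB : ∀ j, (B j).card = m)
    (hd : Pairwise fun i j => Disjoint (B i) (B j)) {c η u : ℝ}
    (h : ∀ {B : Fin L → Finset (Fin n)}, (∀ j, (B j).card = m) →
      (Pairwise fun i j => Disjoint (B i) (B j)) →
      ∫ x, |subDF ν m B x u - c| ∂(sampleLaw n ν) ≤ η) :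
    ∫ x, |∫ S, below u (hatStat ν m S x) ∂(subsetLaw n m) - c| ∂(sampleLaw n ν) ≤ η := by
  set k : ℝ := (Fintype.card (Equiv.Perm (Fin n)) : ℝ) with hk
  have hk0 : 0 < k := by rw [hk]; exact_mod_cast Fintype.card_pos
  let Φ : Equiv.Perm (Fin n) → (Fin n → E) → ℝ := fun σ x =>
    |subDF ν m (fun j => (B j).map σ.toEmbedding) x u - c|
  have hi : ∀ σ, Integrable (Φ σ) (sampleLaw n ν) := fun σ => by
    refine (Integrable.sub (Integrable.of_bound (measurable_subDF m _ u).aestronglyMeasurable 1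
      (ae_of_all _ fun x => ?_)) (integrable_const c)).abs
    rw [Real.norm_eq_abs, abs_of_nonneg (subDF_nonneg _ _ _ _)]
    exact subDF_le_one _ _ _ _
  -- Convexity of the absolute value. The permuted blocks are again disjoint, so `h` bounds every
  -- term of the average.
  have pw : ∀ x, |∫ S, below u (hatStat ν m S x) ∂(subsetLaw n m) - c| ≤ k⁻¹ * ∑ σ, Φ σ x := by
    intro x
    rw [integral_subsetLaw_eq_perm_average hL hB]
    have : k⁻¹ * ∑ σ : Equiv.Perm (Fin n), subDF ν m (fun j => (B j).map σ.toEmbedding) x u - c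
        = k⁻¹ * ∑ σ : Equiv.Perm (Fin n),
          (subDF ν m (fun j => (B j).map σ.toEmbedding) x u - c) := by
      rw [Finset.sum_sub_distrib, Finset.sum_const, Finset.card_univ, nsmul_eq_mul, ← hk]
      field_simp
    rw [this, abs_mul, abs_of_pos (inv_pos.2 hk0)]
    gcongr
    exact Finset.abs_sum_le_sum_abs _ _
  refine (integral_mono_of_nonneg (ae_of_all _ fun x => abs_nonneg _)
    ((integrable_finsetSum _ fun σ _ => hi σ).const_mul _) (ae_of_all _ pw)).trans ?_
  rw [integral_const_mul, integral_finsetSum _ fun σ _ => hi σ]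
  calc k⁻¹ * ∑ σ, ∫ x, Φ σ x ∂(sampleLaw n ν) ≤ k⁻¹ * ∑ _σ : Equiv.Perm (Fin n), η := by
        gcongr with σ
        refine h (fun j => by simp [hB]) fun i j hij => ?_
        exact (Finset.disjoint_map _).2 (hd hij)
    _ = η := by
        rw [Finset.sum_const, Finset.card_univ, nsmul_eq_mul, ← hk]
        field_simp

/-- The joint law of `J` independent uniform subsets of size `m` and an independent sample. -/
def jointLaw (n m J : ℕ) (ν : Measure E) : Measure ((Fin J → Finset (Fin n)) × (Fin n → E)) :=
  (Measure.pi fun _ => subsetLaw n m).prod (sampleLaw n ν)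

lemma measurable_subDF_uncurry (m J : ℕ) (u : ℝ) :
    Measurable fun z : (Fin J → Finset (Fin n)) × (Fin n → E) => subDF ν m z.1 z.2 u :=
  measurable_from_prod_countable_right fun B => measurable_subDF m B u

/-- Given the sample `x`, the indicators over the random subsets are i.i.d. with mean `U x`, which
gives the term `J^{-1/2}`; the distance of `U` from `c` is the hypothesis. -/
lemma integral_jointLaw_le [IsProbabilityMeasure ν] {m J : ℕ} (hmn : m ≤ n) (hJ : 1 ≤ J)
    {c η u : ℝ}
    (h : ∫ x, |∫ S, below u (hatStat ν m S x) ∂(subsetLaw n m) - c| ∂(sampleLaw n ν) ≤ η) :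
    ∫ z, |subDF ν m z.1 z.2 u - c| ∂(jointLaw n m J ν) ≤ √((J : ℝ)⁻¹) + η := by
  have := isProbabilityMeasure_subsetLaw hmn
  set κ : Measure (Fin J → Finset (Fin n)) := Measure.pi fun _ => subsetLaw n m with hκ
  set U : (Fin n → E) → ℝ := fun x => ∫ S, below u (hatStat ν m S x) ∂(subsetLaw n m) with hU
  have hUm : Measurable U := by
    simp only [hU, integral_subsetLaw]
    exact (Finset.measurable_sum _ fun S _ =>
      (measurable_below u).comp (measurable_hatStat m S)).const_mul _
  have hcond : ∀ x, ∫ a, |subDF ν m a x u - U x| ∂κ ≤ √((J : ℝ)⁻¹) := by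
    intro x
    have hb : ∀ j, Measurable fun a : Fin J → Finset (Fin n) => below u (hatStat ν m (a j) x) :=
      fun j => (measurable_of_finite fun S => below u (hatStat ν m S x)).comp
        (measurable_pi_apply j)
    have hL : MemLp (fun a => subDF ν m a x u - U x) 2 κ := by
      refine MemLp.sub (MemLp.of_bound (Measurable.aestronglyMeasurable ?_) 1
        (ae_of_all _ fun a => ?_)) (memLp_const _)
      · exact (Finset.measurable_sum _ fun j _ => hb j).const_mul _
      · rw [Real.norm_eq_abs, abs_of_nonneg (subDF_nonneg _ _ _ _)]
        exact subDF_le_one _ _ _ _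
    refine integral_abs_le_sqrt hL ?_
    refine integral_average_sub_sq_le hJ (fun j => (hb j).aestronglyMeasurable)
      (fun j a => below_nonneg _ _) (fun j a => below_le_one _ _) (fun i j hij => ?_) (fun j => ?_)
    · have hind : iIndepFun (fun j (a : Fin J → Finset (Fin n)) => a j) κ :=
        iIndepFun_pi (X := fun _ S => S) fun _ => aemeasurable_id
      exact (hind.indepFun hij).comp (φ := fun S => below u (hatStat ν m S x))
        (ψ := fun S => below u (hatStat ν m S x)) (measurable_of_finite _) (measurable_of_finite _)
    · have hl : HasLaw (fun a : Fin J → Finset (Fin n) => a j) (subsetLaw n m) κ :=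
        (measurePreserving_eval (fun _ : Fin J => subsetLaw n m) j).hasLaw
      exact hl.integral_comp (f := fun S => below u (hatStat ν m S x))
        (measurable_of_finite _).aestronglyMeasurable
  have hb1 : ∀ z : (Fin J → Finset (Fin n)) × (Fin n → E), ‖subDF ν m z.1 z.2 u‖ ≤ 1 := fun z => by
    rw [Real.norm_eq_abs, abs_of_nonneg (subDF_nonneg _ _ _ _)]
    exact subDF_le_one _ _ _ _
  have hU1 : ∀ x, ‖U x‖ ≤ 1 := fun x => by
    have := norm_integral_le_of_norm_le_const (μ := subsetLaw n m) (C := 1)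
      (f := fun S => below u (hatStat ν m S x)) (ae_of_all _ fun S => by
        rw [Real.norm_eq_abs, abs_of_nonneg (below_nonneg _ _)]; exact below_le_one _ _)
    simpa using this
  have iS : Integrable (fun z : (Fin J → Finset (Fin n)) × (Fin n → E) => subDF ν m z.1 z.2 u)
      (κ.prod (sampleLaw n ν)) :=
    Integrable.of_bound (measurable_subDF_uncurry m J u).aestronglyMeasurable 1 (ae_of_all _ hb1)
  have iU : Integrable (fun z : (Fin J → Finset (Fin n)) × (Fin n → E) => U z.2)
      (κ.prod (sampleLaw n ν)) :=
    Integrable.of_bound (hUm.comp measurable_snd).aestronglyMeasurable 1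
      (ae_of_all _ fun z => hU1 z.2)
  have i1 : Integrable (fun z : (Fin J → Finset (Fin n)) × (Fin n → E) =>
      |subDF ν m z.1 z.2 u - U z.2|) (κ.prod (sampleLaw n ν)) := (iS.sub iU).abs
  have i2 : Integrable (fun z : (Fin J → Finset (Fin n)) × (Fin n → E) => |U z.2 - c|)
      (κ.prod (sampleLaw n ν)) := (iU.sub (integrable_const c)).abs
  have b1 : ∫ z : (Fin J → Finset (Fin n)) × (Fin n → E), |subDF ν m z.1 z.2 u - U z.2|
      ∂(κ.prod (sampleLaw n ν)) ≤ √((J : ℝ)⁻¹) := by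
    rw [integral_prod_symm _ i1]
    refine (integral_mono_of_nonneg (ae_of_all _ fun x => integral_nonneg fun a => abs_nonneg _)
      (integrable_const _) (ae_of_all _ hcond)).trans (le_of_eq ?_)
    simp
  have b2 : ∫ z : (Fin J → Finset (Fin n)) × (Fin n → E), |U z.2 - c|
      ∂(κ.prod (sampleLaw n ν)) ≤ η := by
    rw [integral_fun_snd (fun x => |U x - c|)]
    simpa using h
  rw [jointLaw, ← hκ]
  refine (integral_mono_of_nonneg (ae_of_all _ fun z => abs_nonneg _) (i1.add i2)
    (ae_of_all _ fun z => abs_sub_le _ (U z.2) _)).trans ?_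
  simp only [Pi.add_apply]
  rw [integral_add i1 i2]
  exact add_le_add b1 b2

end Vector

/-! ### Consecutive blocks -/

lemma card_block {n m j : ℕ} (hj : j < n / m) : (block n m j).card = m := by
  have h1 : (j + 1) * m ≤ n := (Nat.mul_le_mul_right m hj).trans (Nat.div_mul_le_self n m)
  have : (block n m j).map Fin.valEmbedding = Finset.Ico (j * m) ((j + 1) * m) := by
    ext l
    simp only [block, Finset.mem_map, Finset.mem_filter, Finset.mem_univ, true_and,
      Fin.valEmbedding_apply, Finset.mem_Ico]
    constructor
    · rintro ⟨a, ha, rfl⟩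
      exact ha
    · exact fun hl => ⟨⟨l, hl.2.trans_le h1⟩, hl, rfl⟩
  rw [← Finset.card_map, this, Nat.card_Ico, add_mul, one_mul, Nat.add_sub_cancel_left]

lemma disjoint_block {n m i j : ℕ} (h : i ≠ j) : Disjoint (block n m i) (block n m j) := by
  rw [Finset.disjoint_left]
  intro l hi hj
  simp only [block, Finset.mem_filter, Finset.mem_univ, true_and] at hi hj
  rcases Nat.lt_or_gt_of_ne h with h | h
  · exact absurd (hi.2.trans_le ((Nat.mul_le_mul_right m h).trans hj.1)) (lt_irrefl _)
  · exact absurd (hj.2.trans_le ((Nat.mul_le_mul_right m h).trans hi.1)) (lt_irrefl _)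

/-- All denominators grow with the size, so smallness at the subsample size `m` passes to the full
size `n`, and the target distribution function is compared with the same Gaussian law. -/
lemma SmallMoments.mono_size {δ κ : ℝ} (h0 : 0 < δ) {p s s' : ℕ}
    {ν : Measure (EuclideanSpace ℝ (Fin p))}
    (h : SmallMoments δ κ s ν) (hs : s ≤ s') : SmallMoments δ κ s' ν := by
  have hs0 : (0 : ℝ) < s := by exact_mod_cast h.pos
  have hss : (s : ℝ) ≤ s' := by exact_mod_cast hs
  refine ⟨h.pos.trans hs, le_trans ?_ h.size, le_trans ?_ h.quad2, le_trans ?_ h.quad,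
    le_trans ?_ h.form, le_trans ?_ h.cross⟩
  · exact inv_anti₀ (by positivity) (Real.rpow_le_rpow hs0.le hss (by positivity))
  · exact div_le_div_of_nonneg_left (integral_nonneg fun _ => sq_nonneg _) hs0 hss
  · exact div_le_div_of_nonneg_left (integral_nonneg fun _ => by positivity) (by positivity)
      (Real.rpow_le_rpow hs0.le hss (by positivity))
  · exact div_le_div_of_nonneg_left (integral_nonneg fun y => Real.rpow_nonneg
      (dirVar_nonneg ν y) _) (by positivity) (Real.rpow_le_rpow hs0.le hss (by positivity))
  · exact div_le_div_of_nonneg_left (integral_nonneg fun y => integral_nonneg fun z => by positivity)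
      (by positivity) (Real.rpow_le_rpow hs0.le hss (by positivity))

lemma inv_div_le_two_mul {n m : ℕ} (hm : 1 ≤ m) (hmn : m ≤ n) :
    ((n / m : ℕ) : ℝ)⁻¹ ≤ 2 * (m / n) := by
  have hn0 : (0 : ℝ) < n := by exact_mod_cast hm.trans hmn
  have hL : 1 ≤ n / m := (Nat.one_le_div_iff hm).2 hmn
  have hL0 : (0 : ℝ) < (n / m : ℕ) := by exact_mod_cast hL
  have a : n ≤ 2 * m * (n / m) := by
    have := Nat.lt_mul_div_succ n hm
    nlinarith
  have a' : (n : ℝ) ≤ 2 * m * (n / m : ℕ) := by exact_mod_cast a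
  rw [inv_le_iff_one_le_mul₀ hL0, ← mul_div_assoc, mul_comm, ← mul_div_assoc, one_le_div hn0]
  linarith

/-- Uniform closeness of the two subsampling distribution functions to the distribution function of
the statistic of the full sample, for a normalised law. -/
lemma exists_subsampling_bound {δ : ℝ} (h0 : 0 < δ) (h1 : δ ≤ 1) {η : ℝ} (hη : 0 < η) :
    ∃ κ > 0, ∀ {p n m : ℕ} {ν : Measure (EuclideanSpace ℝ (Fin p))}, SameCov δ ν ν →
      ∫ y, dirVar ν y ∂ν = 1 → SmallMoments δ κ m ν → 2 * m ≤ n → (m : ℝ) / n ≤ κ →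
      sampleLaw n ν {x | ∃ u, 3 * η < |subDF ν m (fun j : Fin (n / m) => block n m j) x u
        - (convPow ν n).real {w | stat ν n w ≤ u}|} ≤ ENNReal.ofReal η ∧
      ∀ {J : ℕ}, 1 ≤ J → (J : ℝ)⁻¹ ≤ κ →
      jointLaw n m J ν {z | ∃ u, 3 * η < |subDF ν m z.1 z.2 u
        - (convPow ν n).real {w | stat ν n w ≤ u}|} ≤ ENNReal.ofReal η := by
  obtain ⟨κ₁, hκ₁, hkol⟩ := exists_kolmogorov_bound h0 h1 hη
  obtain ⟨κ₂, hκ₂, hsup⟩ := exists_measure_sup_le h0 h1 hη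
  obtain ⟨κ₃, hκ₃, hpt⟩ := exists_integral_subDF_le h0 h1 (half_pos hκ₂)
  refine ⟨min (min κ₁ κ₂) (min (κ₃ / 2) ((κ₂ / 2) ^ 2)), by positivity, ?_⟩
  intro p n m ν hν hunit hsm hmn hr
  set κ := min (min κ₁ κ₂) (min (κ₃ / 2) ((κ₂ / 2) ^ 2))
  have k1 : κ ≤ κ₁ := (min_le_left _ _).trans (min_le_left _ _)
  have k2 : κ ≤ κ₂ := (min_le_left _ _).trans (min_le_right _ _)
  have k3 : κ ≤ κ₃ / 2 := (min_le_right _ _).trans (min_le_left _ _)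
  have k4 : κ ≤ (κ₂ / 2) ^ 2 := (min_le_right _ _).trans (min_le_right _ _)
  clear_value κ
  have := hν.prob
  have hm := hsm.pos
  obtain ⟨γ, hγ⟩ := exists_gaussianMatch h0 h1
    ((hν.memLp' h0).mono_exponent (two_le_ofReal (by linarith))) hunit
  have hkn := hkol hν hunit hγ ((hsm.mono_size h0 (by omega : m ≤ n)).mono k1)
  have hL : 1 ≤ n / m := (Nat.one_le_div_iff hm).2 (by omega)
  have hL' : ((n / m : ℕ) : ℝ)⁻¹ ≤ κ₃ := by
    have := inv_div_le_two_mul hm (by omega : m ≤ n)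
    linarith
  have hsm3 : SmallMoments δ κ₃ m ν := hsm.mono (by linarith)
  have hr3 : (m : ℝ) / n ≤ κ₃ := by linarith
  have hBc : ∀ j : Fin (n / m), (block n m j).card = m := fun j => card_block j.2
  have hBd : Pairwise fun i j : Fin (n / m) => Disjoint (block n m i) (block n m j) :=
    fun i j hij => disjoint_block fun h => hij (Fin.ext h)
  have hsub : ∀ {Ω : Type} [MeasurableSpace Ω] (P : Measure Ω) (Φ : Ω → ℝ → ℝ),
      P {ω | ∃ u, 2 * η < |Φ ω u - gaussDF ν γ u|} ≤ ENNReal.ofReal η →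
      P {ω | ∃ u, 3 * η < |Φ ω u - (convPow ν n).real {w | stat ν n w ≤ u}|}
        ≤ ENNReal.ofReal η := fun P Φ h => by
    refine (measure_mono ?_).trans h
    rintro ω ⟨u, hu⟩
    refine ⟨u, ?_⟩
    have a := abs_sub_le (Φ ω u) (gaussDF ν γ u) ((convPow ν n).real {w | stat ν n w ≤ u})
    have b := hkn u
    rw [abs_sub_comm] at b
    linarith
  refine ⟨hsub (sampleLaw n ν) (subDF ν m fun j : Fin (n / m) => block n m j) ?_,
    fun {J} hJ hJ' => hsub (jointLaw n m J ν) (fun z u => subDF ν m z.1 z.2 u) ?_⟩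
  · exact hsup hν hunit hγ (hsm.mono k2) (fun u => measurable_subDF m _ u)
      (fun x => monotone_subDF m _ x) (fun x u => subDF_nonneg m _ x u)
      (fun x u => subDF_le_one m _ x u) 
      (fun u => (hpt hν hunit hγ hsm3 hmn hr3 hL hL' hBc hBd u).trans (by linarith))
  · have := isProbabilityMeasure_subsetLaw (by omega : m ≤ n)
    have : IsProbabilityMeasure (jointLaw n m J ν) := by unfold jointLaw; infer_instance
    refine hsup hν hunit hγ (hsm.mono k2) (fun u => measurable_subDF_uncurry m J u)
      (fun z => monotone_subDF m _ _) (fun z u => subDF_nonneg m _ _ u)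
      (fun z u => subDF_le_one m _ _ u) (fun u => ?_)
    have a := integral_jointLaw_le (ν := ν) (by omega : m ≤ n) hJ
      (integral_abs_average_sub_le (u := u) hL hBc hBd fun hB hd =>
        hpt hν hunit hγ hsm3 hmn hr3 hL hL' hB hd u)
    have b : √((J : ℝ)⁻¹) ≤ κ₂ / 2 := Real.sqrt_le_iff.2 ⟨by positivity, hJ'.trans k4⟩
    linarith

section Vector

variable {p : ℕ}

local notation "E" => EuclideanSpace ℝ (Fin p)

variable {ν : Measure (EuclideanSpace ℝ (Fin p))}

/-! ### The functionals of the law as integrals -/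

lemma mean_apply (hi : Integrable (fun x => x) ν) (j : Fin p) : mean ν j = ∫ x, x j ∂ν :=
  ((EuclideanSpace.proj (𝕜 := ℝ) j).integral_comp_comm hi).symm

lemma covMat_apply (hi : Integrable (fun x => x) ν) (j k : Fin p) :
    covMat ν j k = ∫ x, (x j - mean ν j) * (x k - mean ν k) ∂ν := by
  rw [mean_apply hi, mean_apply hi]
  rfl

lemma memLp_coord_sub [IsProbabilityMeasure ν] (h : MemLp (fun x => x) 2 ν) (j : Fin p) :
    MemLp (fun x : E => x j - mean ν j) 2 ν := by
  have : MemLp (fun x : E => x j) 2 ν := (EuclideanSpace.proj (𝕜 := ℝ) j).comp_memLp' h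
  exact this.sub (memLp_const _)

lemma fNorm_one [IsProbabilityMeasure ν] (h : MemLp (fun x => x) 2 ν) :
    fNorm ν 1 = ∫ x, ‖x - mean ν‖ ^ 2 ∂ν := by
  simp only [fNorm, pow_one, Nat.cast_one, div_one, Real.rpow_one, Matrix.trace, Matrix.diag,
    covMat_apply (h.integrable (by norm_num)), EuclideanSpace.real_norm_sq_eq, ← sq, PiLp.sub_apply]
  rw [integral_finsetSum _ fun j _ => (memLp_coord_sub h j).integrable_sq]

lemma covMat_comm (j k : Fin p) : covMat ν j k = covMat ν k j := covariance_comm _ _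

lemma trace_covMat_sq : (covMat ν ^ 2).trace = ∑ j, ∑ k, covMat ν j k ^ 2 := by
  simp only [sq, Matrix.trace, Matrix.diag, Matrix.mul_apply]
  exact Finset.sum_congr rfl fun j _ => Finset.sum_congr rfl fun k _ => by rw [covMat_comm k j]

lemma trace_covMat_sq_pos (h : covMat ν ≠ 0) : 0 < (covMat ν ^ 2).trace := by
  obtain ⟨j, k, hjk⟩ : ∃ j k, covMat ν j k ≠ 0 := by
    by_contra! hcon
    exact h (Matrix.ext hcon)
  rw [trace_covMat_sq]
  refine Finset.sum_pos' (fun j _ => Finset.sum_nonneg fun k _ => sq_nonneg _)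
    ⟨j, Finset.mem_univ _, Finset.sum_pos' (fun k _ => sq_nonneg _) ⟨k, Finset.mem_univ _, ?_⟩⟩
  positivity

lemma fNorm_two_pos (h : covMat ν ≠ 0) : 0 < fNorm ν 2 :=
  Real.rpow_pos_of_pos (trace_covMat_sq_pos h) _

lemma fNorm_two_sq (h : covMat ν ≠ 0) : fNorm ν 2 ^ 2 = ∑ j, ∑ k, covMat ν j k ^ 2 := by
  rw [← trace_covMat_sq, fNorm, Nat.cast_ofNat, ← Real.sqrt_eq_rpow,
    Real.sq_sqrt (trace_covMat_sq_pos h).le]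

lemma quadForm_eq_integral [IsProbabilityMeasure ν] (h : MemLp (fun x => x) 2 ν) (x : E) :
    quadForm ν x = ∫ z, (inner ℝ (x - mean ν) (z - mean ν)) ^ 2 ∂ν := by
  have e : ∀ z : E, (inner ℝ (x - mean ν) (z - mean ν) : ℝ) ^ 2 = ∑ j, ∑ k,
      (x j - mean ν j) * (x k - mean ν k) * ((z j - mean ν j) * (z k - mean ν k)) := fun z => by
    simp only [PiLp.inner_apply, RCLike.inner_apply, conj_trivial, PiLp.sub_apply, sq,
      Finset.sum_mul_sum]
    exact Finset.sum_congr rfl fun j _ => Finset.sum_congr rfl fun k _ => by ring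
  have hi : ∀ j k, Integrable (fun z : E => (x j - mean ν j) * (x k - mean ν k) *
      ((z j - mean ν j) * (z k - mean ν k))) ν := fun j k =>
    ((memLp_coord_sub h j).integrable_mul (memLp_coord_sub h k)).const_mul _
  simp_rw [e]
  rw [integral_finsetSum _ fun j _ => integrable_finsetSum _ fun k _ => hi j k]
  refine Finset.sum_congr rfl fun j _ => ?_
  rw [integral_finsetSum _ fun k _ => hi j k]
  refine Finset.sum_congr rfl fun k _ => ?_
  rw [integral_const_mul, ← covMat_apply (h.integrable (by norm_num))]
  ring

/-- This is `tr Σ²`; dividing by `f²` turns it into the unit normalisation assumed throughout the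
comparison. -/
lemma integral_quadForm [IsProbabilityMeasure ν] (h : MemLp (fun x => x) 2 ν) :
    ∫ x, quadForm ν x ∂ν = ∑ j, ∑ k, covMat ν j k ^ 2 := by
  have hi : ∀ j k, Integrable (fun x : E => (x j - mean ν j) * covMat ν j k *
      (x k - mean ν k)) ν := fun j k => by
    refine (((memLp_coord_sub h j).integrable_mul (memLp_coord_sub h k)).const_mul
      (covMat ν j k)).congr (ae_of_all _ fun x => ?_)
    simp only [Pi.mul_apply]
    ring
  unfold quadForm
  rw [integral_finsetSum _ fun j _ => integrable_finsetSum _ fun k _ => hi j k]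
  refine Finset.sum_congr rfl fun j _ => ?_
  rw [integral_finsetSum _ fun k _ => hi j k]
  refine Finset.sum_congr rfl fun k _ => ?_
  rw [sq]
  nth_rw 3 [covMat_apply (h.integrable (by norm_num))]
  rw [← integral_const_mul]
  exact integral_congr_ae (ae_of_all _ fun x => by ring)

/-! ### Normalisation -/

/-- The centred vector, scaled by `f^{-1/2}`. -/
def normalize (ν : Measure E) (x : E) : E := (√(fNorm ν 2))⁻¹ • (x - mean ν)

/-- The law of the normalised vector. -/
def normLaw (ν : Measure E) : Measure E := ν.map (normalize ν)

lemma measurable_normalize : Measurable (normalize ν) := by unfold normalize; fun_prop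

instance [IsProbabilityMeasure ν] : IsProbabilityMeasure (normLaw ν) :=
  Measure.isProbabilityMeasure_map measurable_normalize.aemeasurable

lemma hasLaw_normalize : HasLaw (normalize ν) (normLaw ν) ν :=
  ⟨measurable_normalize.aemeasurable, rfl⟩

lemma integral_normLaw {F : Type*} [NormedAddCommGroup F] [NormedSpace ℝ F]
    (h : covMat ν ≠ 0) (g : E → F) :
    ∫ y, g y ∂(normLaw ν) = ∫ x, g (normalize ν x) ∂ν := by
  have hc : (√(fNorm ν 2))⁻¹ ≠ 0 := inv_ne_zero (Real.sqrt_pos.2 (fNorm_two_pos h)).ne'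
  -- The normalisation is an invertible affine map, so the change of variables needs no
  -- measurability of `g`.
  have he : MeasurableEmbedding (normalize ν) :=
    ((MeasurableEquiv.subRight (mean ν)).trans (MeasurableEquiv.smul₀ _ hc)).measurableEmbedding
  exact he.integral_map g

lemma inner_normalize (h : covMat ν ≠ 0) (x z : E) :
    inner ℝ (normalize ν x) (normalize ν z) = inner ℝ (x - mean ν) (z - mean ν) / fNorm ν 2 := by
  rw [normalize, normalize, inner_smul_left, inner_smul_right, conj_trivial, ← mul_assoc,
    ← mul_inv, Real.mul_self_sqrt (fNorm_two_pos h).le, div_eq_inv_mul]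

lemma normSq_normalize (h : covMat ν ≠ 0) (x : E) :
    ‖normalize ν x‖ ^ 2 = ‖x - mean ν‖ ^ 2 / fNorm ν 2 := by
  rw [← real_inner_self_eq_norm_sq, inner_normalize h, real_inner_self_eq_norm_sq]

lemma sqMoment_normLaw [IsProbabilityMeasure ν] (hL : MemLp (fun x => x) 2 ν)
    (h : covMat ν ≠ 0) : sqMoment (normLaw ν) = fNorm ν 1 / fNorm ν 2 := by
  rw [sqMoment, integral_normLaw h]
  simp_rw [normSq_normalize h]
  rw [integral_div, fNorm_one hL]

lemma normSq_normalize_sub [IsProbabilityMeasure ν] (hL : MemLp (fun x => x) 2 ν)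
    (h : covMat ν ≠ 0) (x : E) :
    ‖normalize ν x‖ ^ 2 - sqMoment (normLaw ν) = diagTerm ν x := by
  rw [normSq_normalize h, sqMoment_normLaw hL h, diagTerm, sub_div]

lemma dirVar_normalize [IsProbabilityMeasure ν] (hL : MemLp (fun x => x) 2 ν)
    (h : covMat ν ≠ 0) (x : E) :
    dirVar (normLaw ν) (normalize ν x) = quadForm ν x / fNorm ν 2 ^ 2 := by
  rw [dirVar, integral_normLaw h, quadForm_eq_integral hL]
  simp_rw [inner_normalize h, div_pow]
  rw [integral_div]

lemma integral_dirVar_normLaw [IsProbabilityMeasure ν] (hL : MemLp (fun x => x) 2 ν)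
    (h : covMat ν ≠ 0) : ∫ y, dirVar (normLaw ν) y ∂(normLaw ν) = 1 := by
  rw [integral_normLaw h]
  simp_rw [dirVar_normalize hL h]
  have := fNorm_two_pos h
  rw [integral_div, integral_quadForm hL, ← fNorm_two_sq h, div_self (by positivity)]

/-- The moment of order `2(2+δ)` comes from `K_δ < ∞`: the squared norm of the normalised vector is
`diagTerm` plus the constant `f_1/f`. -/
lemma sameCov_normLaw [IsProbabilityMeasure ν] {δ : ℝ} (h0 : 0 < δ)
    (hL : MemLp (fun x => x) 2 ν) (h : covMat ν ≠ 0)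
    (hK : Integrable (fun x => |diagTerm ν x| ^ (2 + δ)) ν) :
    SameCov δ (normLaw ν) (normLaw ν) where
  prob := inferInstance
  mean := by
    have hi : Integrable (fun x => x) ν := hL.integrable (by norm_num)
    rw [integral_normLaw h]
    simp only [normalize]
    rw [integral_smul, integral_sub hi (integrable_const _), integral_const, probReal_univ,
      one_smul, mean, sub_self, smul_zero]
  memLp := by
    have hd : Measurable (diagTerm ν) := by unfold diagTerm; fun_prop
    have hdL : MemLp (diagTerm ν) (ENNReal.ofReal (2 + δ)) ν :=
      memLp_of_integrable_abs_rpow (by linarith) hd.aestronglyMeasurable hK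
    have h2 := integrable_abs_rpow_of_memLp (by linarith) le_rfl
      (hdL.add (memLp_const (fNorm ν 1 / fNorm ν 2)))
    rw [normLaw, memLp_map_measure_iff (by fun_prop) measurable_normalize.aemeasurable]
    have hq : 0 < 2 * (2 + δ) := by linarith
    rw [← integrable_norm_rpow_iff (by exact measurable_normalize.aestronglyMeasurable)
      (by simpa using hq) ENNReal.ofReal_ne_top, ENNReal.toReal_ofReal hq.le]
    refine h2.congr (ae_of_all _ fun x => ?_)
    simp only [Pi.add_apply, Function.comp_apply]
    rw [← normSq_normalize_sub hL h, ← sqMoment_normLaw hL h, sub_add_cancel,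
      abs_of_nonneg (by positivity), ← Real.rpow_natCast, ← Real.rpow_mul (norm_nonneg _)]
    norm_num
  var _ := rfl
  trace := rfl

/-! ### The moment quantity of the normalised law -/

lemma K_nonneg (ν : Measure E) (δ : ℝ) : 0 ≤ K ν δ :=
  Real.rpow_nonneg (integral_nonneg fun _ => by positivity) _

lemma D_nonneg (ν : Measure E) (δ : ℝ) : 0 ≤ D ν δ :=
  Real.rpow_nonneg (integral_nonneg fun _ => by positivity) _

lemma c_nonneg {δ : ℝ} (h : 0 ≤ δ) : 0 ≤ c δ :=
  mul_nonneg (by positivity) (Real.rpow_nonneg (integral_nonneg fun _ => by positivity) _)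

lemma d_nonneg {δ : ℝ} (h : 0 ≤ δ) : 0 ≤ d δ := mul_nonneg (by positivity) (sq_nonneg _)

lemma K_rpow {δ : ℝ} (h : 0 ≤ δ) : K ν δ ^ (2 + δ) = ∫ x, |diagTerm ν x| ^ (2 + δ) ∂ν := by
  rw [K, ← Real.rpow_mul (integral_nonneg fun _ => by positivity), one_div_mul_cancel (by linarith),
    Real.rpow_one]

lemma D_rpow {δ : ℝ} (h : 0 ≤ δ) :
    D ν δ ^ (2 + δ) = ∫ z, |crossTerm ν z| ^ (2 + δ) ∂(ν.prod ν) := by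
  rw [D, ← Real.rpow_mul (integral_nonneg fun _ => by positivity), one_div_mul_cancel (by linarith),
    Real.rpow_one]

/-- All terms of `momentBound` are nonnegative, so each is at most `κ`. The Gaussian constants `c`,
`d` only enlarge them; the size condition that absorbs Gaussian moments is supplied separately. -/
lemma smallMoments_normLaw [IsProbabilityMeasure ν] {δ κ : ℝ} (h0 : 0 < δ)
    (hL : MemLp (fun x => x) 2 ν) (h : covMat ν ≠ 0)
    (hD : Integrable (fun z => |crossTerm ν z| ^ (2 + δ)) (ν.prod ν)) {s : ℕ} (hs : 1 ≤ s)
    (hsize : ((s : ℝ) ^ (δ / 2))⁻¹ ≤ κ) (hb : momentBound ν δ s ≤ κ) :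
    SmallMoments δ κ s (normLaw ν) := by
  have hs0 : (0 : ℝ) < s := by exact_mod_cast hs
  have hf := fNorm_two_pos h
  have hq : 0 < 2 + δ := by linarith
  have hquad : ∀ x, 0 ≤ quadForm ν x := fun x => by
    rw [quadForm_eq_integral hL]; exact integral_nonneg fun _ => sq_nonneg _
  have c0 := c_nonneg le_rfl
  have cδ := c_nonneg h0.le
  have dδ := d_nonneg h0.le
  have K0 := K_nonneg ν 0
  have Kδ := K_nonneg ν δ
  have Dδ := D_nonneg ν δ
  have t1 : 0 ≤ (K ν 0 + c 0) ^ 2 / s := by positivity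
  have t2 : 0 ≤ (K ν δ + c δ) ^ (2 + δ) / (s : ℝ) ^ (1 + δ) := by positivity
  have t3 : 0 ≤ (∫ x, (quadForm ν x) ^ ((2 + δ) / 2) ∂ν)
      / ((s : ℝ) ^ (δ / 2) * fNorm ν 2 ^ (2 + δ)) :=
    div_nonneg (integral_nonneg fun x => Real.rpow_nonneg (hquad x) _) (by positivity)
  have t4 : 0 ≤ (D ν δ + d δ) ^ (2 + δ) / (s : ℝ) ^ δ := by positivity
  unfold momentBound at hb
  refine ⟨hs, hsize, ?_, ?_, ?_, ?_⟩
  · rw [integral_normLaw h]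
    simp_rw [normSq_normalize_sub hL h]
    have e : ∫ x, diagTerm ν x ^ 2 ∂ν = K ν 0 ^ 2 := by
      have := K_rpow (ν := ν) (le_refl (0 : ℝ))
      simp only [add_zero, Real.rpow_two, sq_abs] at this
      exact this.symm
    rw [e]
    have : K ν 0 ^ 2 / s ≤ (K ν 0 + c 0) ^ 2 / s := by gcongr; linarith
    linarith
  · rw [integral_normLaw h]
    simp_rw [normSq_normalize_sub hL h]
    rw [← K_rpow h0.le]
    have : K ν δ ^ (2 + δ) / (s : ℝ) ^ (1 + δ) ≤ (K ν δ + c δ) ^ (2 + δ) / (s : ℝ) ^ (1 + δ) := by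
      gcongr; linarith
    linarith
  · rw [integral_normLaw h]
    simp_rw [dirVar_normalize hL h, Real.div_rpow (hquad _) (sq_nonneg _)]
    have e : (fNorm ν 2 ^ 2) ^ ((2 + δ) / 2) = fNorm ν 2 ^ (2 + δ) := by
      rw [← Real.rpow_natCast, ← Real.rpow_mul hf.le]; congr 1; push_cast; ring
    rw [e, integral_div, div_div, mul_comm (fNorm ν 2 ^ (2 + δ))]
    linarith
  · have e : ∫ y, ∫ z, |inner ℝ y z| ^ (2 + δ) ∂(normLaw ν) ∂(normLaw ν) = D ν δ ^ (2 + δ) := by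
      rw [integral_normLaw h, D_rpow h0.le, integral_prod _ hD]
      refine integral_congr_ae (ae_of_all _ fun x => ?_)
      simp only
      rw [integral_normLaw h]
      simp_rw [inner_normalize h]
      rfl
    rw [e]
    have : D ν δ ^ (2 + δ) / (s : ℝ) ^ δ ≤ (D ν δ + d δ) ^ (2 + δ) / (s : ℝ) ^ δ := by
      gcongr; linarith
    linarith

/-! ### The distribution functions of the original sample -/

variable {n : ℕ}

lemma subMean_normalize {B : Finset (Fin n)} (hB : B.card ≠ 0) (x : Fin n → E) :
    subMean (fun i => normalize ν (x i)) B = normalize ν (subMean x B) := by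
  have hB' : (B.card : ℝ) ≠ 0 := by exact_mod_cast hB
  simp only [subMean, normalize]
  rw [← Finset.smul_sum, Finset.sum_sub_distrib, Finset.sum_const, smul_comm, smul_sub,
    ← Nat.cast_smul_eq_nsmul ℝ, smul_smul, inv_mul_cancel₀ hB', one_smul]

/-- Normalising the data amounts to the affine change of threshold `u = t/f - f_1/f`. The target
function undergoes the same change in `targetDF_eq`, so uniform distances agree. -/
lemma hatStat_normalize_le_iff (h : covMat ν ≠ 0) {m : ℕ} (hm : 1 ≤ m) (hmn : m < n)
    {B : Finset (Fin n)} (hB : B.card = m) (x : Fin n → E) (t : ℝ) :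
    hatStat (normLaw ν) m B (fun i => normalize ν (x i))
        ≤ t / fNorm ν 2 - sqMoment (normLaw ν)
      ↔ (m : ℝ) * ‖subMean x B - sampleMean x‖ ^ 2 ≤ t * (1 - (m : ℝ) / (n : ℝ)) := by
  have hf := fNorm_two_pos h
  have hn0 : (0 : ℝ) < n := by exact_mod_cast (by omega : 0 < n)
  have hr : 0 < 1 - (m : ℝ) / n := by
    rw [sub_pos, div_lt_one hn0]; exact_mod_cast hmn
  have e : subMean (fun i => normalize ν (x i)) B - sampleMean (fun i => normalize ν (x i))
      = (√(fNorm ν 2))⁻¹ • (subMean x B - sampleMean x) := by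
    rw [sampleMean, subMean_normalize (by omega), subMean_normalize (by
      rw [Finset.card_univ, Fintype.card_fin]; omega), sampleMean, normalize, normalize,
      ← smul_sub, sub_sub_sub_cancel_right]
  rw [hatStat, sub_le_sub_iff_right, e, norm_smul, mul_pow, Real.norm_eq_abs, sq_abs, inv_pow,
    Real.sq_sqrt hf.le, div_le_div_iff₀ hr hf]
  rw [show (m : ℝ) * ((fNorm ν 2)⁻¹ * ‖subMean x B - sampleMean x‖ ^ 2) * fNorm ν 2
    = m * ‖subMean x B - sampleMean x‖ ^ 2 by field_simp]

lemma empDF_eq_subDF (h : covMat ν ≠ 0) {m : ℕ} (hm : 1 ≤ m) (hmn : m < n) {N : ℕ}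
    {B : Fin N → Finset (Fin n)} (hB : ∀ j, (B j).card = m) (x : Fin n → E) (t : ℝ) :
    empDF m N B x t = subDF (normLaw ν) m B (fun i => normalize ν (x i))
      (t / fNorm ν 2 - sqMoment (normLaw ν)) := by
  unfold empDF subDF
  congr 1
  refine Finset.sum_congr rfl fun j _ => ?_
  unfold below
  simp only [hatStat_normalize_le_iff h hm hmn (hB j)]

lemma hasLaw_normalize_sample {Ω : Type*} [MeasurableSpace Ω] {P : Measure Ω}
    {X : Fin n → Ω → E} (hX : ∀ i, HasLaw (X i) ν P) (hind : iIndepFun X P) :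
    HasLaw (fun ω i => normalize ν (X i ω)) (sampleLaw n (normLaw ν)) P :=
  iIndepFun.hasLaw_pi (X := fun i ω => normalize ν (X i ω))
    (fun i => hasLaw_normalize.fun_comp (hX i))
    (hind.comp (fun _ => normalize ν) fun _ => measurable_normalize)

lemma targetDF_eq (h : covMat ν ≠ 0) [IsProbabilityMeasure ν] (hn : 1 ≤ n) {Ω : Type*}
    [MeasurableSpace Ω] {P : Measure Ω} {X : Fin n → Ω → E} (hX : ∀ i, HasLaw (X i) ν P)
    (hind : iIndepFun X P) (t : ℝ) :
    targetDF P X (mean ν) t = (convPow (normLaw ν) n).real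
      {w | stat (normLaw ν) n w ≤ t / fNorm ν 2 - sqMoment (normLaw ν)} := by
  have hf := fNorm_two_pos h
  have hn0 : (0 : ℝ) < n := by exact_mod_cast hn
  have hl := (hasLaw_sum_sampleLaw (ν := normLaw ν) (Finset.univ : Finset (Fin n))).fun_comp
    (hasLaw_normalize_sample hX hind)
  rw [Finset.card_univ, Fintype.card_fin] at hl
  rw [← hl.measureReal_eq (measurableSet_le (measurable_stat _ n) measurable_const), targetDF]
  congr 1
  ext ω
  simp only [Set.mem_ofPred_eq]
  have e : ∑ i, normalize ν (X i ω)
      = (n : ℝ) • normalize ν (sampleMean fun i => X i ω) := by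
    rw [sampleMean, ← subMean_normalize (by rw [Finset.card_univ, Fintype.card_fin]; omega),
      subMean, Finset.card_univ, Fintype.card_fin, smul_smul, mul_inv_cancel₀ hn0.ne', one_smul]
  rw [stat, sub_le_sub_iff_right, e, norm_smul, mul_pow, normSq_normalize h, Real.norm_eq_abs,
    sq_abs, div_le_div_iff₀ hn0 hf]
  rw [show (n : ℝ) ^ 2 * (‖(sampleMean fun i => X i ω) - mean ν‖ ^ 2 / fNorm ν 2) * fNorm ν 2
    = (n * ‖(sampleMean fun i => X i ω) - mean ν‖ ^ 2) * n by field_simp,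
    mul_le_mul_iff_left₀ hn0]

lemma IsUniformSubsampling.ae_card {Ω : Type*} [MeasurableSpace Ω] {P : Measure Ω} {m J : ℕ}
    {X : Fin n → Ω → E} {A : Fin J → Ω → Finset (Fin n)} (hU : IsUniformSubsampling P X m A) :
    ∀ᵐ ω ∂P, ∀ j, (A j ω).card = m :=
  ae_all_iff.2 fun j =>
    ((hU.uniform j).ae_iff (measurable_of_finite _)).2 (ae_card_subsetLaw n m)

lemma IsUniformSubsampling.hasLaw_joint [IsProbabilityMeasure ν] {Ω : Type*} [MeasurableSpace Ω]
    {P : Measure Ω} [IsProbabilityMeasure P] {m J : ℕ} (hmn : m ≤ n) {X : Fin n → Ω → E}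
    {A : Fin J → Ω → Finset (Fin n)} (hU : IsUniformSubsampling P X m A)
    (hX : ∀ i, HasLaw (X i) ν P) (hind : iIndepFun X P) :
    HasLaw (fun ω => (⟨fun j => A j ω, fun i => normalize ν (X i ω)⟩ :
      (Fin J → Finset (Fin n)) × (Fin n → E))) (jointLaw n m J (normLaw ν)) P := by
  have := isProbabilityMeasure_subsetLaw hmn
  have hu : ∀ j, HasLaw (A j) (subsetLaw n m) P := hU.uniform
  have hlA : HasLaw (fun ω j => A j ω) (Measure.pi fun _ : Fin J => subsetLaw n m) P :=
    iIndepFun.hasLaw_pi (X := A) (μ := fun _ => subsetLaw n m) hu hU.indep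
  have hψ : Measurable fun (x : Fin n → E) i => normalize ν (x i) :=
    measurable_pi_lambda _ fun i => measurable_normalize.comp (measurable_pi_apply i)
  have hi : IndepFun (fun ω j => A j ω) (fun ω i => normalize ν (X i ω)) P :=
    hU.indep_data.comp (φ := fun a => a) measurable_id hψ
  exact hi.hasLaw_prod hlA (hasLaw_normalize_sample hX hind)

end Vector

/-! ### Convergence in probability -/

/-- One parameter serves as deviation and as probability; with `η ≤ ε/4` the deviation `3η` is
strictly below `ε`. -/
lemma tendstoZeroInProb_of_eventually_le {Ω : ℕ → Type*} [∀ n, MeasurableSpace (Ω n)]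
    {P : ∀ n, Measure (Ω n)} {Z : ∀ n, Ω n → ℝ}
    (h : ∀ η : ℝ, 0 < η → ∀ᶠ n in atTop, P n {ω | 3 * η < |Z n ω|} ≤ ENNReal.ofReal η) :
    TendstoZeroInProb P Z := by
  intro ε hε
  rw [ENNReal.tendsto_nhds_zero]
  intro e he
  obtain ⟨r, hr0, hre⟩ : ∃ r : ℝ, 0 < r ∧ ENNReal.ofReal r ≤ e := by
    obtain ⟨r, hr, hr'⟩ := ENNReal.lt_iff_exists_nnreal_btwn.1 he
    exact ⟨r, by exact_mod_cast hr, by rw [ENNReal.ofReal_coe_nnreal]; exact hr'.le⟩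
  filter_upwards [h (min r (ε / 4)) (by positivity)] with n hn
  refine le_trans (measure_mono fun ω hω => ?_) (hn.trans (le_trans (ENNReal.ofReal_le_ofReal
    (min_le_left _ _)) hre))
  have : min r (ε / 4) ≤ ε / 4 := min_le_right _ _
  simp only [Set.mem_ofPred_eq] at hω ⊢
  linarith

lemma exists_lt_of_lt_abs_iSup {f : ℝ → ℝ} {a : ℝ} (h : a < abs (⨆ t, |f t|)) :
    ∃ t, a < |f t| := by
  by_contra! hcon
  rw [abs_of_nonneg (Real.iSup_nonneg fun t => abs_nonneg _)] at h
  exact absurd (ciSup_le hcon) (not_le.2 h)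

end HighDimMean

end

/-! ### The theorem for the triangular array. -/

theorem mainTheorem3
    (δ : ℝ) (hδ0 : 0 < δ) (hδ1 : δ ≤ 1)
    -- row `n` of the triangular array: dimension `p n`, law `ν n`, sample `X n 0, …, X n (n - 1)`
    (p : ℕ → ℕ)
    (ν : ∀ n, Measure (EuclideanSpace ℝ (Fin (p n)))) [∀ n, IsProbabilityMeasure (ν n)]
    {Ω : ℕ → Type*} [∀ n, MeasurableSpace (Ω n)]
    (P : ∀ n, Measure (Ω n)) [∀ n, IsProbabilityMeasure (P n)]
    (X : ∀ n, Fin n → Ω n → EuclideanSpace ℝ (Fin (p n)))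
    (hXlaw : ∀ n i, HasLaw (X n i) (ν n) (P n))
    (hXindep : ∀ n, iIndepFun (X n) (P n))
    -- finite second moments and nonzero covariance matrix
    (hL2 : ∀ n, MemLp (fun x => x) 2 (ν n))
    (hcov : ∀ n, HighDimMean.covMat (ν n) ≠ 0)
    -- the two moment conditions `K_δ < ∞` and `D_δ < ∞`
    (hK : ∀ n, Integrable (fun x => |HighDimMean.diagTerm (ν n) x| ^ (2 + δ)) (ν n))
    (hD : ∀ n, Integrable (fun z => |HighDimMean.crossTerm (ν n) z| ^ (2 + δ))
      ((ν n).prod (ν n)))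
    -- the block size
    (m : ℕ → ℕ) (hm : Tendsto m atTop atTop)
    (hmn : (fun n => (m n : ℝ)) =o[atTop] (fun n => (n : ℝ)))
    -- the moment quantity with sample size `m n` tends to zero
    (hbound : Tendsto (fun n => HighDimMean.momentBound (ν n) δ (m n)) atTop (𝓝 0)) :
    HighDimMean.TendstoZeroInProb P
      (fun n ω => ⨆ t : ℝ, |HighDimMean.blockDF (m n) (fun i => X n i ω) t
        - HighDimMean.targetDF (P n) (X n) (HighDimMean.mean (ν n)) t|)
    ∧
    ∀ (J : ℕ → ℕ), Tendsto J atTop atTop →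
      ∀ (A : ∀ n, Fin (J n) → Ω n → Finset (Fin n)),
        (∀ᶠ n in atTop, HighDimMean.IsUniformSubsampling (P n) (X n) (m n) (A n)) →
        HighDimMean.TendstoZeroInProb P
          (fun n ω => ⨆ t : ℝ,
            |HighDimMean.empDF (m n) (J n) (fun j => A n j ω) (fun i => X n i ω) t
              - HighDimMean.targetDF (P n) (X n) (HighDimMean.mean (ν n)) t|) := by
  have hev : ∀ κ : ℝ, 0 < κ → ∀ᶠ n in atTop,
      HighDimMean.SmallMoments δ κ (m n) (HighDimMean.normLaw (ν n)) ∧ 2 * m n ≤ n ∧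
      (m n : ℝ) / n ≤ κ := by
    intro κ hκ
    have hmR : Tendsto (fun n => (m n : ℝ)) atTop atTop := tendsto_natCast_atTop_atTop.comp hm
    have hsize : Tendsto (fun n => ((m n : ℝ) ^ (δ / 2))⁻¹) atTop (𝓝 0) :=
      tendsto_inv_atTop_zero.comp ((tendsto_rpow_atTop (by positivity)).comp hmR)
    filter_upwards [hm.eventually_ge_atTop 1, hsize.eventually_le_const hκ,
      -- The constant `1/2` yields `2 m ≤ n`, the constant `κ` yields `m / n ≤ κ`.
      hbound.eventually_le_const hκ, hmn.def (show 0 < min κ (1 / 2) by positivity),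
      eventually_ge_atTop 1] with n h1 h2 h3 h4 h5
    have hn0 : (0 : ℝ) < n := by exact_mod_cast h5
    rw [Real.norm_natCast, Real.norm_natCast] at h4
    refine ⟨HighDimMean.smallMoments_normLaw hδ0 (hL2 n) (hcov n) (hD n) h1 h2 h3, ?_, ?_⟩
    · have : (m n : ℝ) ≤ 1 / 2 * n :=
        h4.trans (mul_le_mul_of_nonneg_right (min_le_right _ _) hn0.le)
      have : (2 : ℝ) * m n ≤ n := by linarith
      exact_mod_cast this
    · rw [div_le_iff₀ hn0]
      exact h4.trans (mul_le_mul_of_nonneg_right (min_le_left _ _) hn0.le)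
  have hsame := fun n => HighDimMean.sameCov_normLaw hδ0 (hL2 n) (hcov n) (hK n)
  have hunit := fun n => HighDimMean.integral_dirVar_normLaw (hL2 n) (hcov n)
  have hlaw := fun n => HighDimMean.hasLaw_normalize_sample (hXlaw n) (hXindep n)
  refine ⟨HighDimMean.tendstoZeroInProb_of_eventually_le fun η hη => ?_, fun J hJ A hA =>
    HighDimMean.tendstoZeroInProb_of_eventually_le fun η hη => ?_⟩
  · obtain ⟨κ, hκ, H⟩ := HighDimMean.exists_subsampling_bound hδ0 hδ1 hη
    filter_upwards [hev κ hκ] with n hn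
    obtain ⟨hsm, h2, hr⟩ := hn
    have hm1 := hsm.pos
    obtain ⟨b, -⟩ := H (hsame n) (hunit n) hsm h2 hr
    rw [← (hlaw n).map_eq] at b
    -- For a set not known to be measurable, the measure of its preimage is still at most its
    -- measure under the image law, which is the direction needed.
    refine le_trans (measure_mono fun ω hω => ?_)
      ((Measure.le_map_apply (hlaw n).aemeasurable _).trans b)
    obtain ⟨t, ht⟩ := HighDimMean.exists_lt_of_lt_abs_iSup hω
    rw [HighDimMean.blockDF, HighDimMean.empDF_eq_subDF (hcov n) hm1 (by omega)
      (fun j : Fin (n / m n) => HighDimMean.card_block j.2),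
      HighDimMean.targetDF_eq (hcov n) (by omega) (hXlaw n) (hXindep n)] at ht
    exact ⟨_, ht⟩
  · obtain ⟨κ, hκ, H⟩ := HighDimMean.exists_subsampling_bound hδ0 hδ1 hη
    have hJi : Tendsto (fun n => ((J n : ℝ))⁻¹) atTop (𝓝 0) :=
      tendsto_inv_atTop_zero.comp (tendsto_natCast_atTop_atTop.comp hJ)
    filter_upwards [hev κ hκ, hA, hJ.eventually_ge_atTop 1, hJi.eventually_le_const hκ]
      with n hn hU hJ1 hJκ
    obtain ⟨hsm, h2, hr⟩ := hn
    have hm1 := hsm.pos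
    have b := (H (hsame n) (hunit n) hsm h2 hr).2 hJ1 hJκ
    have hjoint := hU.hasLaw_joint (by omega) (hXlaw n) (hXindep n)
    rw [← hjoint.map_eq] at b
    -- The inclusion holds only almost surely, because the random subsets have cardinality `m` only
    -- almost surely.
    refine le_trans (measure_mono_ae ?_) ((Measure.le_map_apply hjoint.aemeasurable _).trans b)
    filter_upwards [hU.ae_card] with ω hc hω
    obtain ⟨t, ht⟩ := HighDimMean.exists_lt_of_lt_abs_iSup hω
    rw [HighDimMean.empDF_eq_subDF (hcov n) hm1 (by omega) hc,
      HighDimMean.targetDF_eq (hcov n) (by omega) (hXlaw n) (hXindep n)] at ht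
    exact ⟨_, ht⟩
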